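/- We work in the word-RAM model with logarithmic word size: for a problem of size $n$ a machine word has $w$ bits, where $n<2^w$ and $w\le\kappa(\lfloor\log_2 n\rfloor+1)$ for a constant $\kappa$; arithmetic, bitwise operations, shifts, comparisons and memory accesses on words cost one step each. Space is the number of machine words that a data structure occupies, and time is deterministic worst-case. A weighted tree is a rooted tree whose nodes carry non-negative integer weights such that every node other than the root has a larger weight than its parent; weights fit into one machine word. Every node counts as an ancestor of itself. The predecessor of a number $d$ in a set of nodes is the node of the set of largest weight at most $d$; if there is none, a search reports this. (1) Consider a weighted tree on $n$ nodes, some of which are marked, such that every path from a leaf to the root contains $\mathcal{O}(\log n)$ marked nodes, that is, at most $C(\lfloor\log_2 n\rfloor+1)$ for a constant $C$. It can be preprocessed into a data structure of $\mathcal{O}(n)$ words such that, given any node $v$ and any one-word number $d$, the predecessor of $d$ among the marked ancestors of $v$ is found in $\mathcal{O}(1)$ time. The constants and the query program depend only on $C$ and $\kappa$. (2) Let $\mathrm{pred}(m,U)\ge 1$ be nondecreasing in $m$, and suppose that static predecessor search has a linear space solution with this query time: on machines whose word size is logarithmic (with constant $\kappa$) in some $N\geq m$, and for $U\le 2^w$,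 any $m\ge 1$ distinct integers from $[0,U)$ can be stored in $\mathcal{O}(m)$ words so that the position in sorted order of the predecessor of any number in $[0,U)$ is found in $\mathcal{O}(\mathrm{pred}(m,U))$ time. Then weighted ancestor queries (given a node $v$ and a one-word number $d$, find the predecessor of $d$ among all ancestors of $v$) in an arbitrary weighted tree on $n$ nodes with weights from $[0,U)$ can be answered in $\mathcal{O}(\mathrm{pred}(n,U))$ time, without an additive $\mathcal{O}(\log^* n)$ term, by a data structure of $\mathcal{O}(n)$ words. -/

import Mathlib

/-! ## The word RAM

Words are bit strings of length `w`.  The machine has registers `0, 1, 2, …`, each holding one word,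
and a memory made of arrays of words.  A cell is addressed by an array, which is named in the
instruction, and an index, which is the content of a register.  A program is a fixed finite piece of
code that does not depend on the input or on the word size. -/

namespace WordRAM

/-- The unit-cost operations on words: arithmetic modulo `2 ^ w`, unsigned division with remainder,
bitwise operations and logical shifts. -/
inductive BinOp where
  | add | sub | mul | div | mod | and | or | xor | shl | shr

def BinOp.eval {w : ℕ} : BinOp → BitVec w → BitVec w → BitVec w
  | .add, x, y => x + y
  | .sub, x, y => x - y
  | .mul, x, y => x * y
  | .div, x, y => x / y
  | .mod, x, y => x % y
  | .and, x, y => x &&& y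
  | .or, x, y => x ||| y
  | .xor, x, y => x ^^^ y
  | .shl, x, y => x <<< y
  | .shr, x, y => x >>> y

/-- Tests between the contents of two registers (unsigned comparison). -/
inductive Test where
  | eq (a b : ℕ)
  | lt (a b : ℕ)

/-- Programs. The natural number arguments `r a b` name registers, and `seg` names an array. -/
inductive Prog where
  | skip
  /-- `r := k` (modulo `2 ^ w`) -/
  | const (r k : ℕ)
  /-- `r := a` -/
  | copy (r a : ℕ)
  /-- `r := a op b` -/
  | op (o : BinOp) (r a b : ℕ)
  /-- `r := seg[a]` -/
  | load (r seg a : ℕ)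
  /-- `seg[a] := r` -/
  | store (seg a r : ℕ)
  | seq (p q : Prog)
  | ite (b : Test) (p q : Prog)
  | loop (b : Test) (p : Prog)

/-- The memory: a list of arrays of words. -/
abbrev Memory (w : ℕ) := List (List (BitVec w))

/-- The space occupied: the total number of words. -/
def Memory.size {w : ℕ} (m : Memory w) : ℕ := (m.map List.length).sum

/-- The array named `seg`. -/
def Memory.array {w : ℕ} (m : Memory w) (seg : ℕ) : List (BitVec w) := m.getD seg []

structure State (w : ℕ) where
  regs : ℕ → BitVec w
  mem : Memory w

def State.setReg {w : ℕ} (s : State w) (r : ℕ) (x : BitVec w) : State w :=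
  { s with regs := Function.update s.regs r x }

def State.setCell {w : ℕ} (s : State w) (seg i : ℕ) (x : BitVec w) : State w :=
  { s with mem := s.mem.set seg ((s.mem.array seg).set i x) }

def Test.holds {w : ℕ} (s : State w) : Test → Prop
  | .eq a b => s.regs a = s.regs b
  | .lt a b => s.regs a < s.regs b

/-- `Exec p s s' t`: started in `s`, the program `p` halts in `s'` after `t` steps. Every basic
instruction and every test costs one step. A memory access outside the allocated cells is an error:
such a run does not halt. -/
inductive Exec {w : ℕ} : Prog → State w → State w → ℕ → Prop
  | skip (s : State w) : Exec .skip s s 0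
  | const (s : State w) (r k : ℕ) : Exec (.const r k) s (s.setReg r (BitVec.ofNat w k)) 1
  | copy (s : State w) (r a : ℕ) : Exec (.copy r a) s (s.setReg r (s.regs a)) 1
  | op (s : State w) (o : BinOp) (r a b : ℕ) :
      Exec (.op o r a b) s (s.setReg r (o.eval (s.regs a) (s.regs b))) 1
  | load (s : State w) (r seg a : ℕ) (x : BitVec w)
      (h : (s.mem.array seg)[(s.regs a).toNat]? = some x) :
      Exec (.load r seg a) s (s.setReg r x) 1
  | store (s : State w) (seg a r : ℕ) (h : (s.regs a).toNat < (s.mem.array seg).length) :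
      Exec (.store seg a r) s (s.setCell seg (s.regs a).toNat (s.regs r)) 1
  | seq (p q : Prog) (s s₁ s₂ : State w) (t₁ t₂ : ℕ) (h₁ : Exec p s s₁ t₁)
      (h₂ : Exec q s₁ s₂ t₂) : Exec (.seq p q) s s₂ (t₁ + t₂)
  | ite_true (b : Test) (p q : Prog) (s s₁ : State w) (t : ℕ) (hb : b.holds s)
      (h : Exec p s s₁ t) : Exec (.ite b p q) s s₁ (t + 1)
  | ite_false (b : Test) (p q : Prog) (s s₁ : State w) (t : ℕ) (hb : ¬ b.holds s)
      (h : Exec q s s₁ t) : Exec (.ite b p q) s s₁ (t + 1)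
  | loop_true (b : Test) (p : Prog) (s s₁ s₂ : State w) (t₁ t₂ : ℕ) (hb : b.holds s)
      (h₁ : Exec p s s₁ t₁) (h₂ : Exec (.loop b p) s₁ s₂ t₂) :
      Exec (.loop b p) s s₂ (t₁ + t₂ + 1)
  | loop_false (b : Test) (p : Prog) (s : State w) (hb : ¬ b.holds s) :
      Exec (.loop b p) s s 1

/-- The initial state of a query: the arguments are in the first registers, all others are `0`. -/
def queryState {w : ℕ} (m : Memory w) (args : List (BitVec w)) : State w where
  regs := fun r => args.getD r 0
  mem := m

/-- On the data structure `m` and the given arguments, the program `q` halts after at most `t` steps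
with the number `out` in register `0`, and it leaves the data structure as it found it. -/
def Answers {w : ℕ} (q : Prog) (m : Memory w) (args : List (BitVec w)) (t out : ℕ) : Prop :=
  ∃ (s : State w) (k : ℕ), Exec q (queryState m args) s k ∧ k ≤ t ∧
    (s.regs 0).toNat = out ∧ s.mem = m

/-- Logarithmic word size for problems of size `n`: the numbers `0, …, n` fit into a word, and a
word has at most `κ * (⌊log₂ n⌋ + 1)` bits. -/
def LogWordSize (κ n w : ℕ) : Prop := n < 2 ^ w ∧ w ≤ κ * (Nat.log 2 n + 1)

end WordRAM

/-! ## Predecessors and weighted trees -/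

/-- The predecessor of `d` in the set `A` with respect to the keys `key`: an element of `A` whose
key is largest among those that are at most `d`, or `none` if there is no such key. -/
def IsPredecessor {ι : Type*} (A : Set ι) (key : ι → ℕ) (d : ℕ) : Option ι → Prop
  | none => ∀ i ∈ A, d < key i
  | some i => i ∈ A ∧ key i ≤ d ∧ ∀ j ∈ A, key j ≤ d → key j ≤ key i

/-- An answer as a number: an index below `n`, or `n` for "no predecessor". -/
def encodeAnswer {n : ℕ} : Option (Fin n) → ℕ
  | none => n
  | some i => i

/-- A rooted tree on the nodes `0, …, n - 1`, given by parents (the root is its own parent), with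
node weights that strictly increase from parent to child. -/
structure WeightedTree (n : ℕ) where
  root : Fin n
  parent : Fin n → Fin n
  parent_root : parent root = root
  reaches_root : ∀ v, ∃ k, parent^[k] v = root
  weight : Fin n → ℕ
  weight_parent_lt : ∀ v, v ≠ root → weight (parent v) < weight v

namespace WeightedTree

variable {n : ℕ} (T : WeightedTree n)

/-- The ancestors of `v`, including `v` itself: the nodes on the path from `v` to the root. -/
def ancestors (v : Fin n) : Set (Fin n) := {u | ∃ k, T.parent^[k] v = u}

def IsLeaf (v : Fin n) : Prop := ∀ u, u ≠ T.root → T.parent u ≠ v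

end WeightedTree

open WordRAM in
/-- `pred` is an achievable query time for linear space static predecessor search: `m ≥ 1` integers
from `[0, U)` can be stored in `O(m)` words so that the (index of the) predecessor of any number in
`[0, U)` is found in time `O(pred m U)`. The word size is logarithmic in a bound `N ≥ m`, the size
of the problem of which the set is a part. -/
def LinearSpacePredecessor (κ : ℕ) (pred : ℕ → ℕ → ℕ) : Prop :=
  ∃ (c : ℕ) (query : Prog), ∀ (N w U m : ℕ) (key : Fin m → ℕ),
    LogWordSize κ N w → U ≤ 2 ^ w → 0 < m → m ≤ N → StrictMono key → (∀ i, key i < U) →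
    ∃ mem : Memory w, mem.size ≤ c * m ∧
      ∀ d : BitVec w, d.toNat < U →
        ∃ ans : Option (Fin m), IsPredecessor Set.univ key d.toNat ans ∧
          Answers query mem [d] (c * pred m U) (encodeAnswer ans)

open WordRAM in
/-- Weighted ancestor search in arbitrary trees on `n` nodes with weights from `[0, U)` takes linear
space and query time `O(pred n U)`. -/
def LinearSpaceWeightedAncestor (κ : ℕ) (pred : ℕ → ℕ → ℕ) : Prop :=
  ∃ (c : ℕ) (query : Prog), ∀ (n w U : ℕ) (T : WeightedTree n),
    LogWordSize κ n w → U ≤ 2 ^ w → (∀ v, T.weight v < U) →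
    ∃ mem : Memory w, mem.size ≤ c * n ∧
      ∀ (v : Fin n) (d : BitVec w),
        ∃ ans : Option (Fin n), IsPredecessor (T.ancestors v) T.weight d.toNat ans ∧
          Answers query mem [BitVec.ofNat w v, d] (c * pred n U) (encodeAnswer ans)

/-!
Both parts rest on a search among polylogarithmically many keys in constant time. The rank of a
number among `√δ` keys of `δ = Θ(log n)` bits depends on the bits in which adjacent keys differ
first, and on a comparison with a single candidate key. The positions of these bits have so short a
code that the blind search can be tabulated for all codes in `O(n)` words. Two rounds of it handle
`δ + 1` keys, and a trie that reads a word in `O(1)` chunks of `δ` bits handles long keys.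

For the first part, the depth among the marked nodes splits these into `O(1)` classes such that
every node has at most `δ` marked ancestors in each class. A lowest node with more than `δ`
descendants has enough of them to pay for a trie that stores its marked ancestors. A highest node
with at most `δ` descendants gets a trie whose answers are bit strings for the light nodes of its
subtree; intersected with a bit string for the marked ancestors of the query node, they reveal the
lowest light marked ancestor.

For the second part, the nodes with the same value of `⌊log₂ (size of the subtree)⌋` form vertical
paths. Every node has at most `⌊log₂ n⌋ + 1` ancestors that are heads of such paths, hence the first
part applies to the marked heads. It yields the lowest head whose parent is light enough, and then a
single predecessor search on the path of this head suffices.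
-/

/-! ## Programs and expressions -/

namespace WordRAM

variable {w : ℕ}

/-- Total correctness with a time bound: started in `s`, the program `p` halts within `t` steps in a
state that satisfies `Q`. -/
def Runs (p : Prog) (s : State w) (t : ℕ) (Q : State w → Prop) : Prop :=
  ∃ (s' : State w) (k : ℕ), Exec p s s' k ∧ k ≤ t ∧ Q s'

namespace Runs

variable {p q : Prog} {b : Test} {s : State w} {t t₁ t₂ : ℕ} {Q R : State w → Prop}

theorem seq (hp : Runs p s t₁ Q) (hq : ∀ s', Q s' → Runs q s' t₂ R) :
    Runs (.seq p q) s (t₁ + t₂) R := by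
  obtain ⟨s₁, k₁, exec₁, hk₁, hQ⟩ := hp
  obtain ⟨s₂, k₂, exec₂, hk₂, hR⟩ := hq s₁ hQ
  exact ⟨s₂, _, .seq _ _ _ _ _ _ _ exec₁ exec₂, add_le_add hk₁ hk₂, hR⟩

theorem mono (hp : Runs p s t₁ Q) (ht : t₁ ≤ t₂) (h : ∀ s', Q s' → R s') : Runs p s t₂ R := by
  obtain ⟨s₁, k, exec, hk, hQ⟩ := hp
  exact ⟨s₁, k, exec, hk.trans ht, h _ hQ⟩

theorem mono_time (hp : Runs p s t₁ Q) (ht : t₁ ≤ t₂) : Runs p s t₂ Q :=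
  hp.mono ht fun _ => id

theorem ite_true (hb : b.holds s) (hp : Runs p s t Q) : Runs (.ite b p q) s (t + 1) Q := by
  obtain ⟨s', k, exec, hk, hQ⟩ := hp
  exact ⟨s', k + 1, .ite_true _ _ _ _ _ _ hb exec, by lia, hQ⟩

theorem ite_false (hb : ¬ b.holds s) (hq : Runs q s t Q) : Runs (.ite b p q) s (t + 1) Q := by
  obtain ⟨s', k, exec, hk, hQ⟩ := hq
  exact ⟨s', k + 1, .ite_false _ _ _ _ _ _ hb exec, by lia, hQ⟩

theorem loop_true (hb : b.holds s) (hp : Runs p s t₁ Q)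
    (hl : ∀ s', Q s' → Runs (.loop b p) s' t₂ R) : Runs (.loop b p) s (t₁ + t₂ + 1) R := by
  obtain ⟨s₁, k₁, exec₁, hk₁, hQ⟩ := hp
  obtain ⟨s₂, k₂, exec₂, hk₂, hR⟩ := hl s₁ hQ
  exact ⟨s₂, _, .loop_true _ _ _ _ _ _ _ hb exec₁ exec₂, by lia, hR⟩

theorem loop_false (hb : ¬ b.holds s) (h : Q s) : Runs (.loop b p) s 1 Q :=
  ⟨s, 1, .loop_false _ _ _ hb, le_rfl, h⟩

theorem const (r c : ℕ) (h : Q (s.setReg r (BitVec.ofNat w c))) : Runs (.const r c) s 1 Q :=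
  ⟨_, 1, .const s r c, le_rfl, h⟩

theorem copy (r a : ℕ) (h : Q (s.setReg r (s.regs a))) : Runs (.copy r a) s 1 Q :=
  ⟨_, 1, .copy s r a, le_rfl, h⟩

theorem op (o : BinOp) (r a b : ℕ) (h : Q (s.setReg r (o.eval (s.regs a) (s.regs b)))) :
    Runs (.op o r a b) s 1 Q :=
  ⟨_, 1, .op s o r a b, le_rfl, h⟩

theorem copy_seq {r a : ℕ} (h : Runs q (s.setReg r (s.regs a)) t Q) :
    Runs (.seq (.copy r a) q) s (1 + t) Q :=
  (copy (Q := (· = s.setReg r (s.regs a))) r a rfl).seq fun _ hs => hs ▸ h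

theorem op_seq {o : BinOp} {r a b : ℕ}
    (h : Runs q (s.setReg r (o.eval (s.regs a) (s.regs b))) t Q) :
    Runs (.seq (.op o r a b) q) s (1 + t) Q :=
  (op (Q := (· = s.setReg r (o.eval (s.regs a) (s.regs b)))) o r a b rfl).seq fun _ hs => hs ▸ h

theorem store (seg a r : ℕ) (ha : (s.regs a).toNat < (s.mem.array seg).length)
    (h : Q (s.setCell seg (s.regs a).toNat (s.regs r))) : Runs (.store seg a r) s 1 Q :=
  ⟨_, 1, .store s seg a r ha, le_rfl, h⟩

theorem load (r seg a : ℕ) {x : BitVec w} (hx : (s.mem.array seg)[(s.regs a).toNat]? = some x)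
    (h : Q (s.setReg r x)) : Runs (.load r seg a) s 1 Q :=
  ⟨_, 1, .load s r seg a x hx, le_rfl, h⟩

end Runs

/-- `State.EqBelow k s s'`: the states have the same memory and the same registers below `k`. -/
def State.EqBelow (k : ℕ) (s s' : State w) : Prop :=
  s'.mem = s.mem ∧ ∀ r < k, s'.regs r = s.regs r

theorem State.EqBelow.trans {k : ℕ} {s₁ s₂ s₃ : State w} (h₁₂ : EqBelow k s₁ s₂)
    (h₂₃ : EqBelow k s₂ s₃) : EqBelow k s₁ s₃ :=
  ⟨h₂₃.1.trans h₁₂.1, fun r hr => (h₂₃.2 r hr).trans (h₁₂.2 r hr)⟩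

theorem State.EqBelow.mono {j k : ℕ} {s s' : State w} (h : EqBelow k s s') (hjk : j ≤ k) :
    EqBelow j s s' :=
  ⟨h.1, fun r hr => h.2 r (hr.trans_le hjk)⟩

theorem State.eqBelow_setReg {k r : ℕ} (s : State w) (x : BitVec w) (hr : k ≤ r) :
    EqBelow k s (s.setReg r x) :=
  ⟨rfl, fun i hi => by simp [State.setReg, (hi.trans_le hr).ne]⟩

@[simp] theorem State.regs_setReg_self (s : State w) (r : ℕ) (x : BitVec w) :
    (s.setReg r x).regs r = x := by
  simp [State.setReg]

/-- Loop-free read-only computations: the value of an expression depends on the registers and the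
memory and is found without changing the memory. -/
inductive Expr where
  | reg (r : ℕ)
  | const (k : ℕ)
  | op (o : BinOp) (a b : Expr)
  | load (seg : ℕ) (a : Expr)
  /-- `p` if `a < b`, otherwise `q` -/
  | ifLt (a b p q : Expr)

namespace Expr

/-- The value of an expression, or `none` if the evaluation reads outside the allocated cells. -/
def eval (s : State w) : Expr → Option (BitVec w)
  | .reg r => some (s.regs r)
  | .const k => some (BitVec.ofNat w k)
  | .op o a b => (a.eval s).bind fun x => (b.eval s).map fun y => o.eval x y
  | .load seg a => (a.eval s).bind fun x => (s.mem.array seg)[x.toNat]?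
  | .ifLt a b p q => (a.eval s).bind fun x => (b.eval s).bind fun y =>
      if x < y then p.eval s else q.eval s

/-- A number above all registers that occur in an expression. -/
def regBound : Expr → ℕ
  | .reg r => r + 1
  | .const _ => 0
  | .op _ a b => max a.regBound b.regBound
  | .load _ a => a.regBound
  | .ifLt a b p q => max (max a.regBound b.regBound) (max p.regBound q.regBound)

/-- The program that evaluates an expression into register `k` and uses the registers above `k` as
scratch space. -/
def compile : Expr → ℕ → Prog
  | .reg r, k => .copy k r
  | .const c, k => .const k c
  | .op o a b, k => .seq (a.compile k) (.seq (b.compile (k + 1)) (.op o k k (k + 1)))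
  | .load seg a, k => .seq (a.compile k) (.load k seg k)
  | .ifLt a b p q, k => .seq (a.compile k) (.seq (b.compile (k + 1))
      (.ite (.lt k (k + 1)) (p.compile k) (q.compile k)))

/-- A bound for the running time of the compiled expression. -/
def cost : Expr → ℕ
  | .reg _ => 1
  | .const _ => 1
  | .op _ a b => a.cost + (b.cost + 1)
  | .load _ a => a.cost + 1
  | .ifLt a b p q => a.cost + (b.cost + (max p.cost q.cost + 1))

theorem eval_congr {k : ℕ} {s s' : State w} (h : s.EqBelow k s') :
    ∀ e : Expr, e.regBound ≤ k → e.eval s' = e.eval s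
  | .reg r, hk => by simp only [eval, h.2 r hk]
  | .const _, _ => rfl
  | .op o a b, hk => by
    simp only [regBound, max_le_iff] at hk
    simp only [eval, eval_congr h a hk.1, eval_congr h b hk.2]
  | .load seg a, hk => by simp only [eval, eval_congr h a hk, h.1]
  | .ifLt a b p q, hk => by
    simp only [regBound, max_le_iff] at hk
    simp only [eval, eval_congr h a hk.1.1, eval_congr h b hk.1.2, eval_congr h p hk.2.1,
      eval_congr h q hk.2.2]

/-- What a run of the compiled expression guarantees: the value is in register `k`, and the memory
and the registers below `k` are unchanged. -/
def Computed (k : ℕ) (s : State w) (x : BitVec w) (s' : State w) : Prop :=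
  s.EqBelow k s' ∧ s'.regs k = x

theorem runs_compile_pair {a b : Expr} {k : ℕ} {s : State w} {x y : BitVec w}
    (ha : Runs (a.compile k) s a.cost (Computed k s x))
    (hb : ∀ s', s.EqBelow k s' → Runs (b.compile (k + 1)) s' b.cost (Computed (k + 1) s' y))
    {p : Prog} {t : ℕ} {Q : State w → Prop}
    (hp : ∀ s', s.EqBelow k s' → s'.regs k = x → s'.regs (k + 1) = y → Runs p s' t Q) :
    Runs (.seq (a.compile k) (.seq (b.compile (k + 1)) p)) s (a.cost + (b.cost + t)) Q :=
  ha.seq fun s₁ h₁ => (hb s₁ h₁.1).seq fun s₂ h₂ =>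
    hp s₂ (h₁.1.trans (h₂.1.mono k.le_succ)) ((h₂.1.2 k k.lt_succ_self).trans h₁.2) h₂.2

theorem runs_compile (e : Expr) : ∀ {k : ℕ} {s : State w} {x : BitVec w}, e.regBound ≤ k →
    e.eval s = some x → Runs (e.compile k) s e.cost (Computed k s x) := by
  induction e with
  | reg r =>
    intro k s x _ hx
    cases hx
    exact .copy _ _ ⟨s.eqBelow_setReg _ le_rfl, by simp⟩
  | const c =>
    intro k s x _ hx
    cases hx
    exact .const _ _ ⟨s.eqBelow_setReg _ le_rfl, by simp⟩
  | op o a b iha ihb =>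
    intro k s x hk hx
    simp only [regBound, max_le_iff] at hk
    simp only [eval, Option.bind_eq_some_iff, Option.map_eq_some_iff] at hx
    obtain ⟨y, hy, z, hz, rfl⟩ := hx
    refine runs_compile_pair (iha hk.1 hy)
      (fun s' h => ihb (hk.2.trans k.le_succ) ((eval_congr h b hk.2).trans hz))
      fun s' h hsy hsz => .op _ _ _ _ ⟨h.trans (s'.eqBelow_setReg _ le_rfl), by simp [hsy, hsz]⟩
  | load seg a iha =>
    intro k s x hk hx
    simp only [eval, Option.bind_eq_some_iff] at hx
    obtain ⟨y, hy, hx⟩ := hx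
    exact (iha hk hy).seq fun s' h => .load _ _ _ (by rwa [h.2, h.1.1])
      ⟨h.1.trans (s'.eqBelow_setReg _ le_rfl), by simp⟩
  | ifLt a b p q iha ihb ihp ihq =>
    intro k s x hk hx
    simp only [regBound, max_le_iff] at hk
    simp only [eval, Option.bind_eq_some_iff] at hx
    obtain ⟨y, hy, z, hz, hx⟩ := hx
    refine runs_compile_pair (iha hk.1.1 hy)
      (fun s' h => ihb (hk.1.2.trans k.le_succ) ((eval_congr h b hk.1.2).trans hz))
      fun s' h hsy hsz => ?_
    have keep : ∀ s'', Computed k s' x s'' → Computed k s x s'' := fun _ h' => ⟨h.trans h'.1, h'.2⟩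
    split_ifs at hx with hyz
    · exact .ite_true (by simpa [Test.holds, hsy, hsz] using hyz)
        ((ihp hk.2.1 ((eval_congr h p hk.2.1).trans hx)).mono (le_max_left _ _) keep)
    · exact .ite_false (by simpa [Test.holds, hsy, hsz] using hyz)
        ((ihq hk.2.2 ((eval_congr h q hk.2.2).trans hx)).mono (le_max_right _ _) keep)

end Expr

/-- In the state `s` the expression `e` has the value `n`, as a natural number. -/
def HasValue (s : State w) (e : Expr) (n : ℕ) : Prop :=
  ∃ x : BitVec w, e.eval s = some x ∧ x.toNat = n

/-- The array with the entries `f 0, …, f (len - 1)`, reduced modulo `2 ^ w`. -/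
def table (w : ℕ) {len : ℕ} (f : Fin len → ℕ) : List (BitVec w) :=
  List.ofFn fun i => BitVec.ofNat w (f i)

@[simp] theorem length_table {len : ℕ} (f : Fin len → ℕ) : (table w f).length = len := by
  simp [table]

namespace HasValue

variable {s : State w} {a b p q : Expr} {n x y z : ℕ}

theorem reg (r : ℕ) : HasValue s (.reg r) (s.regs r).toNat := ⟨_, rfl, rfl⟩

theorem const (hn : n < 2 ^ w) : HasValue s (.const n) n :=
  ⟨_, rfl, by simp [Nat.mod_eq_of_lt hn]⟩

theorem add (ha : HasValue s a x) (hb : HasValue s b y) (h : x + y < 2 ^ w) :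
    HasValue s (.op .add a b) (x + y) := by
  obtain ⟨⟨u, hu, rfl⟩, ⟨v, hv, rfl⟩⟩ := And.intro ha hb
  exact ⟨u + v, by simp [Expr.eval, BinOp.eval, hu, hv], by simp [Nat.mod_eq_of_lt h]⟩

theorem sub (ha : HasValue s a x) (hb : HasValue s b y) (h : y ≤ x) :
    HasValue s (.op .sub a b) (x - y) := by
  obtain ⟨⟨u, hu, rfl⟩, ⟨v, hv, rfl⟩⟩ := And.intro ha hb
  exact ⟨u - v, by simp [Expr.eval, BinOp.eval, hu, hv], BitVec.toNat_sub_of_le h⟩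

theorem mul (ha : HasValue s a x) (hb : HasValue s b y) (h : x * y < 2 ^ w) :
    HasValue s (.op .mul a b) (x * y) := by
  obtain ⟨⟨u, hu, rfl⟩, ⟨v, hv, rfl⟩⟩ := And.intro ha hb
  exact ⟨u * v, by simp [Expr.eval, BinOp.eval, hu, hv], by simp [Nat.mod_eq_of_lt h]⟩

theorem mod (ha : HasValue s a x) (hb : HasValue s b y) : HasValue s (.op .mod a b) (x % y) := by
  obtain ⟨⟨u, hu, rfl⟩, ⟨v, hv, rfl⟩⟩ := And.intro ha hb
  exact ⟨u % v, by simp [Expr.eval, BinOp.eval, hu, hv], by simp⟩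

theorem and (ha : HasValue s a x) (hb : HasValue s b y) :
    HasValue s (.op .and a b) (x &&& y) := by
  obtain ⟨⟨u, hu, rfl⟩, ⟨v, hv, rfl⟩⟩ := And.intro ha hb
  exact ⟨u &&& v, by simp [Expr.eval, BinOp.eval, hu, hv], by simp⟩

theorem shr (ha : HasValue s a x) (hb : HasValue s b y) :
    HasValue s (.op .shr a b) (x / 2 ^ y) := by
  obtain ⟨⟨u, hu, rfl⟩, ⟨v, hv, rfl⟩⟩ := And.intro ha hb
  exact ⟨u >>> v, by simp [Expr.eval, BinOp.eval, hu, hv], by simp [Nat.shiftRight_eq_div_pow]⟩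

theorem load_table {seg len : ℕ} {f : Fin len → ℕ} (hs : s.mem.array seg = table w f)
    (ha : HasValue s a x) (hx : x < len) (hf : f ⟨x, hx⟩ < 2 ^ w) :
    HasValue s (.load seg a) (f ⟨x, hx⟩) := by
  obtain ⟨u, hu, rfl⟩ := ha
  exact ⟨BitVec.ofNat w (f ⟨u.toNat, hx⟩), by simp [Expr.eval, hu, hs, table, hx],
    by simp [Nat.mod_eq_of_lt hf]⟩

theorem ifLt (ha : HasValue s a x) (hb : HasValue s b y) (hp : x < y → HasValue s p z)
    (hq : y ≤ x → HasValue s q z) : HasValue s (.ifLt a b p q) z := by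
  obtain ⟨⟨u, hu, rfl⟩, ⟨v, hv, rfl⟩⟩ := And.intro ha hb
  simp only [HasValue, Expr.eval, hu, hv, Option.bind_some]
  split_ifs with huv
  · exact hp huv
  · exact hq (not_lt.1 huv)

theorem lt_two_pow (ha : HasValue s a x) : x < 2 ^ w := by
  obtain ⟨u, -, rfl⟩ := ha
  exact u.isLt

end HasValue

/-! ## Memory layout -/

namespace Memory

variable {m l l₁ l₂ : Memory w} {o : ℕ}

/-- The arrays `l` stand in the memory `m`, under the names `o, o + 1, …`. -/
def StoresAt (m : Memory w) (o : ℕ) (l : Memory w) : Prop := l <+: m.drop o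

theorem StoresAt.refl (m : Memory w) : m.StoresAt 0 m := List.prefix_rfl

theorem StoresAt.left (h : m.StoresAt o (l₁ ++ l₂)) : m.StoresAt o l₁ :=
  (List.prefix_append l₁ l₂).trans h

theorem StoresAt.right (h : m.StoresAt o (l₁ ++ l₂)) : m.StoresAt (o + l₁.length) l₂ := by
  obtain ⟨rest, h⟩ := h
  exact ⟨rest, by rw [← List.drop_drop, ← h]; simp⟩

theorem StoresAt.array_eq (h : m.StoresAt o l) (i : ℕ) {a : List (BitVec w)}
    (hi : l[i]? = some a) : m.array (o + i) = a := by
  obtain ⟨rest, h⟩ := h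
  have hm : (m.drop o)[i]? = some a := by
    rw [← h, List.getElem?_append_left (List.getElem?_eq_some_iff.1 hi).1, hi]
  rw [List.getElem?_drop] at hm
  simp [Memory.array, List.getD_eq_getElem?_getD, hm]

theorem StoresAt.flatten {l : List (Memory w)} {k : ℕ} (h : m.StoresAt o l.flatten)
    (hl : ∀ x ∈ l, x.length = k) {i : ℕ} {x : Memory w} (hi : l[i]? = some x) :
    m.StoresAt (o + i * k) x := by
  induction l generalizing o i with
  | nil => simp at hi
  | cons a l ih =>
    obtain ⟨ha, hl⟩ := List.forall_mem_cons.1 hl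
    rw [List.flatten_cons] at h
    cases i with
    | zero =>
      obtain rfl : a = x := by simpa using hi
      simpa using h.left
    | succ i =>
      have := ih h.right hl (by simpa using hi)
      rwa [ha, add_assoc, add_comm k, ← Nat.succ_mul] at this

theorem size_append (l₁ l₂ : Memory w) : size (l₁ ++ l₂) = l₁.size + l₂.size := by
  simp [size]

theorem size_flatten_le {l : List (Memory w)} {c : ℕ} (h : ∀ x ∈ l, x.size ≤ c) :
    size l.flatten ≤ l.length * c := by
  induction l with
  | nil => simp [size]
  | cons a l ih =>
    obtain ⟨ha, hl⟩ := List.forall_mem_cons.1 h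
    rw [List.flatten_cons, size_append, List.length_cons, Nat.succ_mul, add_comm]
    exact add_le_add (ih hl) ha

end Memory

/-- Disjoint blocks in an array of length `N`, one block of length `len a` for each `a ∈ s`. The
block of `a` starts at `base a`, and `owner p` tells in whose block, and where in this block, the
cell `p` is. -/
structure Allocation {ι : Type*} (s : Finset ι) (len : ι → ℕ) (N : ℕ) where
  base : ι → ℕ
  owner : ℕ → Option (ι × ℕ)
  owner_eq_some_iff : ∀ {p a i}, owner p = some (a, i) ↔ a ∈ s ∧ i < len a ∧ p = base a + i
  base_add_len_le : ∀ a ∈ s, base a + len a ≤ N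

namespace Allocation

variable {ι : Type*} {s : Finset ι} {len : ι → ℕ} {N : ℕ}

/-- The contents of an array in which the block of `a` holds `f a 0, f a 1, …`. -/
def contents (A : Allocation s len N) (f : ι → ℕ → ℕ) (p : ℕ) : ℕ :=
  ((A.owner p).map fun a => f a.1 a.2).getD 0

theorem contents_base_add (A : Allocation s len N) (f : ι → ℕ → ℕ) {a : ι} (ha : a ∈ s) {i : ℕ}
    (hi : i < len a) : A.contents f (A.base a + i) = f a i := by
  simp [contents, A.owner_eq_some_iff.2 ⟨ha, hi, rfl⟩]

theorem nonempty_sum (s : Finset ι) (len : ι → ℕ) :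
    Nonempty (Allocation s len (∑ a ∈ s, len a)) := by
  classical
  induction s using Finset.induction_on with
  | empty => exact ⟨fun _ => 0, fun _ => none, by simp, by simp⟩
  | insert c s hc ih =>
    obtain ⟨A⟩ := ih
    have hne : ∀ a ∈ s, a ≠ c := fun a ha hac => hc (hac ▸ ha)
    set S := ∑ a ∈ s, len a
    rw [Finset.sum_insert hc]
    refine ⟨Function.update A.base c S, fun p => if p < S then A.owner p else
      if p < S + len c then some (c, p - S) else none, fun {p a i} => ?_, fun a ha => ?_⟩
    · rcases eq_or_ne a c with rfl | hac
      · have : A.owner p ≠ some (a, i) := fun h => hc (A.owner_eq_some_iff.1 h).1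
        simp only [Finset.mem_insert_self, Function.update_self]
        grind
      · simp only [Finset.mem_insert, hac, false_or, Function.update_of_ne hac]
        rw [← A.owner_eq_some_iff]
        have : A.owner p = some (a, i) → p < S := fun h => by
          obtain ⟨ha, hi, rfl⟩ := A.owner_eq_some_iff.1 h
          have := A.base_add_len_le a ha
          lia
        grind
    · rcases Finset.mem_insert.1 ha with rfl | ha
      · simp [S, add_comm]
      · simpa [hne a ha] using (A.base_add_len_le a ha).trans (Nat.le_add_left _ _)

theorem exists_of_sum_le (h : ∑ a ∈ s, len a ≤ N) : Nonempty (Allocation s len N) := by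
  obtain ⟨A⟩ := nonempty_sum s len
  exact ⟨{ A with base_add_len_le := fun a ha => (A.base_add_len_le a ha).trans h }⟩

end Allocation

end WordRAM

/-! ## Blind search in short sequences -/

namespace Fusion

/-- The bit length of the part in which `a` and `b` differ: `a` and `b` become equal when so many
low bits are dropped, and not before. -/
def diffLength (a b : ℕ) : ℕ := (a ^^^ b).size

theorem diffLength_le_iff {a b t : ℕ} : diffLength a b ≤ t ↔ a / 2 ^ t = b / 2 ^ t := by
  rw [diffLength, Nat.size_le, ← Nat.shiftRight_eq_div_pow, ← Nat.shiftRight_eq_div_pow,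
    ← Nat.xor_eq_zero_iff, ← Nat.shiftRight_xor_distrib, Nat.shiftRight_eq_div_pow,
    Nat.div_eq_zero_iff_lt (by positivity)]

theorem diffLength_self (a : ℕ) : diffLength a a = 0 := by simp [diffLength]

theorem diffLength_comm (a b : ℕ) : diffLength a b = diffLength b a := by
  rw [diffLength, Nat.xor_comm, diffLength]

theorem diffLength_pos {a b : ℕ} (h : a ≠ b) : 0 < diffLength a b := by
  rw [Nat.pos_iff_ne_zero]
  exact fun h0 => h (by simpa using diffLength_le_iff.1 h0.le)

theorem diffLength_le_of_lt {a b t : ℕ} (ha : a < 2 ^ t) (hb : b < 2 ^ t) : diffLength a b ≤ t :=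
  diffLength_le_iff.2 (by rw [Nat.div_eq_of_lt ha, Nat.div_eq_of_lt hb])

theorem diffLength_le_max (a b c : ℕ) :
    diffLength a c ≤ max (diffLength a b) (diffLength b c) :=
  diffLength_le_iff.2 ((diffLength_le_iff.1 (le_max_left _ _)).trans
    (diffLength_le_iff.1 (le_max_right _ _)))

theorem diffLength_eq_max {a b c : ℕ} (hab : a ≤ b) (hbc : b ≤ c) :
    diffLength a c = max (diffLength a b) (diffLength b c) := by
  refine eq_of_forall_ge_iff fun t => ?_
  have := Nat.div_le_div_right (c := 2 ^ t) hab
  have := Nat.div_le_div_right (c := 2 ^ t) hbc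
  simp only [max_le_iff, diffLength_le_iff]
  lia

theorem testBit_of_lt {p q : ℕ} (h : p < q) :
    p.testBit (diffLength p q - 1) = false ∧ q.testBit (diffLength p q - 1) = true := by
  obtain ⟨t, ht⟩ := Nat.exists_eq_add_one.2 (diffLength_pos h.ne)
  have above : p / 2 ^ t / 2 = q / 2 ^ t / 2 := by
    simpa only [Nat.div_div_eq_div_mul, ← pow_succ] using diffLength_le_iff.1 ht.le
  have differ : p / 2 ^ t ≠ q / 2 ^ t := fun h' => by have := diffLength_le_iff.2 h'; lia
  have order := Nat.div_le_div_right (c := 2 ^ t) h.le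
  simp only [ht, Nat.add_sub_cancel, Nat.testBit_eq_decide_div_mod_eq, decide_eq_false_iff_not,
    decide_eq_true_eq]
  lia

theorem lt_diffLength_of_testBit_ne {a b t : ℕ} (h : a.testBit t ≠ b.testBit t) :
    t < diffLength a b := by
  by_contra! hle
  rw [Nat.testBit_eq_decide_div_mod_eq, Nat.testBit_eq_decide_div_mod_eq,
    diffLength_le_iff.1 hle] at h
  exact h rfl

/-- The bit position depends on `diffLength p q` alone: this is what makes the search blind. -/
theorem diffLength_le_of_testBit {p q z : ℕ} (h : p < q) :
    if z.testBit (diffLength p q - 1) then diffLength q z ≤ diffLength p z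
    else diffLength p z ≤ diffLength q z := by
  obtain ⟨hp, hq⟩ := testBit_of_lt h
  have hpos := diffLength_pos h.ne
  split_ifs with hz
  · have := lt_diffLength_of_testBit_ne (show p.testBit _ ≠ z.testBit _ by rw [hp, hz]; simp)
    have := diffLength_le_max q p z
    rw [diffLength_comm q p] at this
    lia
  · have := lt_diffLength_of_testBit_ne (show q.testBit _ ≠ z.testBit _ by rw [hq]; simpa using hz)
    have := diffLength_le_max p q z
    lia

/-- After one comparison of `z` with the candidate `p`, the prefix lengths decide about every other
key. -/
theorem le_iff_of_diffLength_le {p q z : ℕ} (h : diffLength p z ≤ diffLength q z) :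
    q ≤ z ↔ if p ≤ z then q ≤ p ∨ diffLength p q < diffLength p z
      else q < p ∧ diffLength p z ≤ diffLength p q := by
  rcases eq_or_ne p z with rfl | hne
  · simp [diffLength_self]
  obtain ⟨t, ht⟩ := Nat.exists_eq_add_one.2 (diffLength_pos hne)
  have above : p / 2 ^ t / 2 = z / 2 ^ t / 2 := by
    simpa only [Nat.div_div_eq_div_mul, ← pow_succ] using diffLength_le_iff.1 ht.le
  have hpz : p / 2 ^ t ≠ z / 2 ^ t := fun h' => by have := diffLength_le_iff.2 h'; lia
  have hqz : q / 2 ^ t ≠ z / 2 ^ t := fun h' => by have := diffLength_le_iff.2 h'; lia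
  have mono : ∀ {a b : ℕ}, a ≤ b → a / 2 ^ t ≤ b / 2 ^ t := fun h => Nat.div_le_div_right h
  have hpq := mono (a := p) (b := q)
  have hqp := mono (a := q) (b := p)
  have hzq := mono (a := z) (b := q)
  have hqz' := mono (a := q) (b := z)
  have hpz' := mono (a := p) (b := z)
  have hzp := mono (a := z) (b := p)
  have lt_iff : diffLength p q < t + 1 ↔ p / 2 ^ t = q / 2 ^ t := by
    rw [Nat.lt_succ_iff, diffLength_le_iff]
  have le_iff : t + 1 ≤ diffLength p q ↔ p / 2 ^ t ≠ q / 2 ^ t := by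
    rw [← not_lt, lt_iff]
  rw [ht, lt_iff, le_iff]
  split_ifs <;> lia

theorem diffLength_eq_sup {m : ℕ} {y : ℕ → ℕ} (hy : StrictMonoOn y (Set.Iio m)) {i j : ℕ}
    (hij : i ≤ j) (hj : j < m) :
    diffLength (y i) (y j) = (Finset.Ico i j).sup fun k => diffLength (y k) (y (k + 1)) := by
  induction j, hij using Nat.le_induction with
  | base => simp [diffLength_self]
  | succ j hij ih =>
    have hjm : j < m := j.lt_succ_self.trans hj
    rw [← Finset.insert_Ico_right_eq_Ico_add_one hij, Finset.sup_insert, ← ih hjm, max_comm]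
    exact diffLength_eq_max (hy.monotoneOn (hij.trans_lt hjm) hjm hij)
      (hy hjm hj j.lt_succ_self).le

/-- The index of a key that shares a longest prefix with `z`, among the keys with the indices
`0, …, m`, if `h k` is the length of the difference of the keys with the indices `k` and `k + 1`. -/
def blindCandidate (h : ℕ → ℕ) (z : ℕ) : ℕ → ℕ
  | 0 => 0
  | m + 1 =>
    let i := blindCandidate h z m
    if z.testBit ((Finset.Ico i (m + 1)).sup h - 1) then m + 1 else i

theorem blindCandidate_le (h : ℕ → ℕ) (z m : ℕ) : blindCandidate h z m ≤ m := by
  induction m with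
  | zero => rfl
  | succ m ih => rw [blindCandidate]; split_ifs <;> lia

theorem diffLength_blindCandidate_le {h y : ℕ → ℕ} {m : ℕ} (z : ℕ)
    (hy : StrictMonoOn y (Set.Iio (m + 1)))
    (hh : ∀ k < m, h k = diffLength (y k) (y (k + 1))) :
    ∀ j ≤ m, diffLength (y (blindCandidate h z m)) z ≤ diffLength (y j) z := by
  induction m with
  | zero => intro j hj; simp [blindCandidate, Nat.le_zero.1 hj]
  | succ m ih =>
    have hi := Nat.lt_succ_of_le (blindCandidate_le h z m)
    have ih := ih (hy.mono (Set.Iio_subset_Iio (m + 1).le_succ))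
      fun k hk => hh k (hk.trans_le m.le_succ)
    have hsup : (Finset.Ico (blindCandidate h z m) (m + 1)).sup h =
        diffLength (y (blindCandidate h z m)) (y (m + 1)) := by
      rw [diffLength_eq_sup hy hi.le (Nat.lt_succ_self _)]
      exact Finset.sup_congr rfl fun k hk => hh k (Finset.mem_Ico.1 hk).2
    have better := diffLength_le_of_testBit (z := z)
      (hy (hi.trans (Nat.lt_succ_self _)) (Nat.lt_succ_self _) hi)
    intro j hj
    rw [blindCandidate]
    simp only [hsup]
    rcases hj.eq_or_lt with rfl | hj
    · split_ifs with hz <;> simp_all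
    · have := ih j (Nat.le_of_lt_succ hj)
      split_ifs with hz <;> simp only [hz, if_true] at better
      · exact better.trans this
      · exact this

/-- The number of keys that are at most `z`, computed from the length `m` of an increasing sequence,
its adjacent differences `h`, the index `i` of a key that shares a longest prefix with `z`, and this
key `x`. -/
def blindRank (m : ℕ) (h : ℕ → ℕ) (i x z : ℕ) : ℕ :=
  Nat.count (fun j => if x ≤ z then j ≤ i ∨ (Finset.Ico i j).sup h < diffLength x z
    else j < i ∧ diffLength x z ≤ (Finset.Ico j i).sup h) m

theorem blindRank_eq {m : ℕ} {h y : ℕ → ℕ} {i z : ℕ} (hy : StrictMonoOn y (Set.Iio m))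
    (hh : ∀ k, k + 1 < m → h k = diffLength (y k) (y (k + 1))) (hi : i < m)
    (hmin : ∀ j < m, diffLength (y i) z ≤ diffLength (y j) z) :
    blindRank m h i (y i) z = Nat.count (fun j => y j ≤ z) m := by
  have hsup : ∀ {j k}, j ≤ k → k < m → (Finset.Ico j k).sup h = diffLength (y j) (y k) :=
    fun hjk hk => by
      rw [diffLength_eq_sup hy hjk hk]
      exact Finset.sup_congr rfl fun l hl => hh l (by grind)
  suffices key : ∀ j < m, (if y i ≤ z then j ≤ i ∨ (Finset.Ico i j).sup h < diffLength (y i) z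
      else j < i ∧ diffLength (y i) z ≤ (Finset.Ico j i).sup h) ↔ y j ≤ z from
    le_antisymm (Nat.count_mono_left fun j hj => (key j hj).1)
      (Nat.count_mono_left fun j hj => (key j hj).2)
  intro j hj
  rw [le_iff_of_diffLength_le (hmin j hj)]
  rcases le_total i j with hij | hji
  · rw [hsup hij hj, hy.le_iff_le hj hi, hy.lt_iff_lt hj hi]
    simp [hij.not_gt]
  · rw [hsup hji hi, hy.le_iff_le hj hi, hy.lt_iff_lt hj hi, diffLength_comm (y j)]
    simp [hji]

/-- The sequences that are searched blindly: between `1` and `B` keys of `δ` bits, in increasing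
order. -/
structure IsShortSeq (δ B m : ℕ) (y : ℕ → ℕ) : Prop where
  pos : 0 < m
  le : m ≤ B
  strictMonoOn : StrictMonoOn y (Set.Iio m)
  lt : ∀ i < m, y i < 2 ^ δ

/-- The length and the adjacent differences of a short sequence, coded as a number. -/
def shapeCode (δ B m : ℕ) (y : ℕ → ℕ) : ℕ :=
  m + (B + 1) * finFunctionFinEquiv fun k : Fin B =>
    Fin.ofNat (δ + 1) (diffLength (y k) (y (k + 1)))

/-- The adjacent differences, read off the code of a short sequence. -/
def shapeDiff (δ B c k : ℕ) : ℕ := c / (B + 1) / (δ + 1) ^ k % (δ + 1)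

/-- The blind search candidate for `z` in the short sequence with the code `c`. -/
def candidate (δ B c z : ℕ) : ℕ := blindCandidate (shapeDiff δ B c) z (c % (B + 1) - 1)

/-- The rank of `z` in the short sequence with the code `c` whose blind search candidate for `z` is
the key `x`. -/
def rank (δ B c x z : ℕ) : ℕ :=
  blindRank (c % (B + 1)) (shapeDiff δ B c) (candidate δ B c z) x z

namespace IsShortSeq

variable {δ B m : ℕ} {y : ℕ → ℕ}

theorem shapeCode_lt (hy : IsShortSeq δ B m y) : shapeCode δ B m y < (B + 1) * (δ + 1) ^ B := by
  have := (finFunctionFinEquiv fun k : Fin B =>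
    Fin.ofNat (δ + 1) (diffLength (y k) (y (k + 1)))).isLt
  have := hy.le
  rw [shapeCode]
  nlinarith

theorem shapeCode_mod (hy : IsShortSeq δ B m y) : shapeCode δ B m y % (B + 1) = m := by
  rw [shapeCode, Nat.add_mul_mod_self_left, Nat.mod_eq_of_lt (Nat.lt_succ_of_le hy.le)]

theorem shapeDiff_shapeCode (hy : IsShortSeq δ B m y) {k : ℕ} (hk : k + 1 < m) :
    shapeDiff δ B (shapeCode δ B m y) k = diffLength (y k) (y (k + 1)) := by
  have hkB : k < B := by have := hy.le; lia
  have hle : diffLength (y k) (y (k + 1)) ≤ δ :=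
    diffLength_le_of_lt (hy.lt k (by lia)) (hy.lt (k + 1) hk)
  set g := fun k : Fin B => Fin.ofNat (δ + 1) (diffLength (y k) (y (k + 1))) with hg
  have decode := finFunctionFinEquiv_symm_apply_val (finFunctionFinEquiv g) ⟨k, hkB⟩
  rw [Equiv.symm_apply_apply] at decode
  rw [shapeDiff, shapeCode, Nat.add_mul_div_left _ _ B.succ_pos,
    Nat.div_eq_of_lt (Nat.lt_succ_of_le hy.le), zero_add, ← hg, ← decode]
  simp [hg, Nat.mod_eq_of_lt (Nat.lt_succ_of_le hle)]

theorem candidate_lt (hy : IsShortSeq δ B m y) (z : ℕ) :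
    candidate δ B (shapeCode δ B m y) z < m := by
  have := blindCandidate_le (shapeDiff δ B (shapeCode δ B m y)) z (m - 1)
  have := hy.pos
  rw [candidate, hy.shapeCode_mod]
  lia

theorem rank_shapeCode (hy : IsShortSeq δ B m y) (z : ℕ) :
    rank δ B (shapeCode δ B m y) (y (candidate δ B (shapeCode δ B m y) z)) z =
      Nat.count (fun i => y i ≤ z) m := by
  rw [rank, hy.shapeCode_mod]
  refine blindRank_eq hy.strictMonoOn (fun k => hy.shapeDiff_shapeCode) (hy.candidate_lt z) ?_
  rw [candidate, hy.shapeCode_mod]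
  obtain ⟨l, rfl⟩ := Nat.exists_eq_add_one.2 hy.pos
  exact fun j hj => diffLength_blindCandidate_le z hy.strictMonoOn
    (fun k hk => hy.shapeDiff_shapeCode (Nat.succ_lt_succ hk)) j (Nat.le_of_lt_succ hj)

end IsShortSeq

end Fusion

namespace WordRAM

variable {w : ℕ}

/-- The array with the given contents, see `Allocation.contents`. -/
def Allocation.array {ι : Type*} {s : Finset ι} {len : ι → ℕ} {N : ℕ} (w : ℕ)
    (A : Allocation s len N) (f : ι → ℕ → ℕ) : List (BitVec w) :=
  table w fun p : Fin N => A.contents f p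

theorem HasValue.load_array {ι : Type*} {S : Finset ι} {len : ι → ℕ} {N : ℕ} {s : State w}
    {A : Allocation S len N} {f : ι → ℕ → ℕ} {seg : ℕ} (hs : s.mem.array seg = A.array w f)
    {e : Expr} {a : ι} {i : ℕ} (he : HasValue s e (A.base a + i)) (ha : a ∈ S) (hi : i < len a)
    (hf : f a i < 2 ^ w) : HasValue s (.load seg e) (f a i) := by
  have hlt : A.base a + i < N := (Nat.add_lt_add_left hi _).trans_le (A.base_add_len_le a ha)
  rw [← A.contents_base_add f ha hi] at hf ⊢
  exact he.load_table hs hlt hf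

end WordRAM

namespace Fusion

open WordRAM

/-! ## Ranks in small sets of short keys -/

section Counting

variable {m B z : ℕ} {y : ℕ → ℕ}

theorem le_iff_lt_count (hy : StrictMonoOn y (Set.Iio m)) {i : ℕ} (hi : i < m) :
    y i ≤ z ↔ i < Nat.count (fun i => y i ≤ z) m := by
  constructor
  · intro h
    have all : Nat.count (fun i => y i ≤ z) (i + 1) = i + 1 := Nat.count_iff_forall.2
      fun j hj => (hy.monotoneOn (hj.trans_le hi) hi (Nat.le_of_lt_succ hj)).trans h
    exact all.ge.trans (Nat.count_monotone _ hi)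
  · contrapose!
    intro h
    obtain ⟨k, rfl⟩ := Nat.exists_eq_add_of_le hi.le
    rw [Nat.count_add, Nat.count_iff_forall_not.2 fun j hj => not_le.2
      (h.trans_le (hy.monotoneOn hi (Nat.add_lt_add_left hj i) (Nat.le_add_right _ _))), add_zero]
    exact Nat.count_le _

theorem lt_ceilDiv_iff (hB : 0 < B) {k : ℕ} : k < m ⌈/⌉ B ↔ k * B < m := by
  rw [← not_le, ceilDiv_le_iff_le_mul hB, not_le, mul_comm]

theorem count_block (hB : 0 < B) (hy : StrictMonoOn y (Set.Iio m)) (hm : 0 < m) (hz : y 0 ≤ z)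
    {q : ℕ} (hq : q = Nat.count (fun k => y (k * B) ≤ z) (m ⌈/⌉ B) - 1) :
    q * B < m ∧ q * B + Nat.count (fun i => y (q * B + i) ≤ z) (min B (m - q * B)) =
      Nat.count (fun i => y i ≤ z) m := by
  set R := Nat.count (fun i => y i ≤ z) m
  set c := Nat.count (fun k => y (k * B) ≤ z) (m ⌈/⌉ B)
  have rank : ∀ {i}, i < m → (y i ≤ z ↔ i < R) := le_iff_lt_count hy
  have leader : ∀ {k}, k * B < m → (k * B < R ↔ k < c) := fun hk => by
    rw [← rank hk]
    exact le_iff_lt_count (y := fun k => y (k * B)) (fun i _ j hj hij =>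
      hy ((Nat.mul_lt_mul_of_pos_right hij hB).trans ((lt_ceilDiv_iff hB).1 hj))
        ((lt_ceilDiv_iff hB).1 hj) (Nat.mul_lt_mul_of_pos_right hij hB)) ((lt_ceilDiv_iff hB).2 hk)
  have hRm : R ≤ m := Nat.count_le _
  have hcm : c ≤ m ⌈/⌉ B := Nat.count_le _
  have hc0 : 0 < c := (leader (by simpa)).1 (by simpa using (rank hm).1 hz)
  have hqc : q < c := by lia
  have hqm : q * B < m := (lt_ceilDiv_iff hB).1 (hqc.trans_le hcm)
  have hqR : q * B < R := (leader hqm).2 hqc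
  have hRq : R ≤ (q + 1) * B := by
    by_contra! h
    have := (leader (h.trans_le hRm)).1 h
    lia
  rw [add_mul, one_mul] at hRq
  refine ⟨hqm, ?_⟩
  set k := min B (m - q * B)
  set r := Nat.count (fun i => y (q * B + i) ≤ z) k
  have block : ∀ {i}, i < k → (q * B + i < R ↔ i < r) := fun {i} hi => by
    rw [← rank (by lia)]
    exact le_iff_lt_count (y := fun i => y (q * B + i)) (fun i _ j (hj : j < k) hij =>
      hy (show q * B + i < m by lia) (show q * B + j < m by lia) (Nat.add_lt_add_left hij _)) hi
  have hrk : r ≤ k := Nat.count_le _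
  have := block (i := r)
  have := block (i := R - q * B)
  lia

theorem IsShortSeq.leaders {δ : ℕ} (hy : IsShortSeq δ (B * B) m y) (hB : 0 < B) :
    IsShortSeq δ B (m ⌈/⌉ B) fun k => y (k * B) where
  pos := (lt_ceilDiv_iff hB).2 (by simpa using hy.pos)
  le := (ceilDiv_le_iff_le_mul hB).2 hy.le
  strictMonoOn i _ j hj hij := by
    have hj := (lt_ceilDiv_iff hB).1 hj
    have hij := Nat.mul_lt_mul_of_pos_right hij hB
    exact hy.strictMonoOn (hij.trans hj) hj hij
  lt i hi := hy.lt _ ((lt_ceilDiv_iff hB).1 hi)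

theorem IsShortSeq.block {δ q : ℕ} (hy : IsShortSeq δ (B * B) m y) (hB : 0 < B) (hq : q * B < m) :
    IsShortSeq δ B (min B (m - q * B)) fun i => y (q * B + i) where
  pos := by lia
  le := min_le_left _ _
  strictMonoOn i _ j (hj : j < min B (m - q * B)) hij :=
    hy.strictMonoOn (show q * B + i < m by lia) (show q * B + j < m by lia)
      (Nat.add_lt_add_left hij _)
  lt _ _ := hy.lt _ (by lia)

end Counting

/-- Parameters of the search structure: a word of `w` bits is cut into `D` chunks of `δ` bits, and
`B` chunks can be searched at once with tables of at most `n` words. -/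
structure Params (δ B D n w : ℕ) : Prop where
  code_le : (B + 1) * (δ + 1) ^ B ≤ 2 ^ δ
  table_le : 2 ^ (3 * δ) ≤ n
  lt_word : n < 2 ^ w
  word_le : w ≤ δ * D
  shift_lt : δ * D < 2 ^ w
  levels_lt : D + 2 < 2 ^ w
  pos : 0 < B

/-- The tables of the blind search, preceded by an array of numbers that the programs need. -/
def searchTables (w δ B D : ℕ) : Memory w :=
  [table w fun i : Fin (D + 2) => if (i : ℕ) = 0 then 2 ^ δ else
      if (i : ℕ) = 1 then B else δ * (i - 2),
    table w fun x : Fin (2 ^ (2 * δ)) => candidate δ B (x / 2 ^ δ) (x % 2 ^ δ),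
    table w fun x : Fin (2 ^ (3 * δ)) =>
      rank δ B (x / 2 ^ δ / 2 ^ δ) (x / 2 ^ δ % 2 ^ δ) (x % 2 ^ δ)]

theorem mul_add_lt {a b P Q : ℕ} (ha : a < Q) (hb : b < P) : a * P + b < Q * P := by
  nlinarith

theorem mul_add_div_of_lt {a b P : ℕ} (hb : b < P) : (a * P + b) / P = a := by
  rw [mul_comm, Nat.mul_add_div (by lia), Nat.div_eq_of_lt hb, add_zero]

/-- The rank of `z` in the short sequence that starts at `base` in the array `seg` and has the given
shape code. The search tables are at `o`. -/
def rankExpr (o seg : ℕ) (base code z : Expr) : Expr :=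
  let code := .op .mul code (.load o (.const 0))
  let key := .load seg (.op .add base (.load (o + 1) (.op .add code z)))
  .load (o + 2) (.op .add (.op .mul (.op .add code key) (.load o (.const 0))) z)

namespace Params

variable {δ B D n w o : ℕ} {s : State w}

theorem pow_mul_le (hp : Params δ B D n w) {i : ℕ} (hi : i ≤ 3) : 2 ^ (i * δ) ≤ n :=
  (Nat.pow_le_pow_right two_pos (Nat.mul_le_mul_right _ hi)).trans hp.table_le

theorem pow_le (hp : Params δ B D n w) : 2 ^ δ ≤ n := by
  simpa using hp.pow_mul_le (show 1 ≤ 3 by norm_num)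

theorem lt_pow (hp : Params δ B D n w) : B < 2 ^ δ := by
  have h : 0 < (δ + 1) ^ B := by positivity
  exact (Nat.le_mul_of_pos_right (B + 1) h).trans hp.code_le

theorem shapeCode_lt (hp : Params δ B D n w) {m : ℕ} {y : ℕ → ℕ} (hy : IsShortSeq δ B m y) :
    shapeCode δ B m y < 2 ^ δ :=
  hy.shapeCode_lt.trans_le hp.code_le

theorem hasValue_radix (hp : Params δ B D n w) (hs : s.mem.StoresAt o (searchTables w δ B D)) :
    HasValue s (.load o (.const 0)) (2 ^ δ) :=
  (HasValue.const (by positivity)).load_table (hs.array_eq 0 rfl) (Nat.succ_pos _)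
    (hp.pow_le.trans_lt hp.lt_word)

theorem hasValue_width (hp : Params δ B D n w) (hs : s.mem.StoresAt o (searchTables w δ B D)) :
    HasValue s (.load o (.const 1)) B :=
  (HasValue.const (by have := hp.levels_lt; lia)).load_table (hs.array_eq 0 rfl) (by lia)
    (hp.lt_pow.trans (hp.pow_le.trans_lt hp.lt_word))

theorem hasValue_shift (hp : Params δ B D n w) (hs : s.mem.StoresAt o (searchTables w δ B D))
    {k : ℕ} (hk : k < D) : HasValue s (.load o (.const (k + 2))) (δ * k) :=
  (HasValue.const (by have := hp.levels_lt; lia)).load_table (hs.array_eq 0 rfl)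
    (Nat.add_lt_add_right hk 2) ((Nat.mul_le_mul_left δ hk.le).trans_lt hp.shift_lt)

theorem hasValue_rankExpr (hp : Params δ B D n w) (hs : s.mem.StoresAt o (searchTables w δ B D))
    {seg b m z : ℕ} {y : ℕ → ℕ} {base code ez : Expr} (hy : IsShortSeq δ B m y)
    (hz : z < 2 ^ δ) (hb : b + m ≤ n) (hbase : HasValue s base b)
    (hcode : HasValue s code (shapeCode δ B m y)) (hez : HasValue s ez z)
    (hload : ∀ i < m, ∀ e, HasValue s e (b + i) → HasValue s (.load seg e) (y i)) :
    HasValue s (rankExpr o seg base code ez) (Nat.count (fun i => y i ≤ z) m) := by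
  set c := shapeCode δ B m y
  have square : (2 : ℕ) ^ (2 * δ) = 2 ^ δ * 2 ^ δ := by rw [two_mul, pow_add]
  have cube : (2 : ℕ) ^ (3 * δ) = 2 ^ (2 * δ) * 2 ^ δ := by rw [← pow_add, ← Nat.succ_mul]
  have hc := hp.shapeCode_lt hy
  have small : ∀ {k}, k < 2 ^ (3 * δ) → k < 2 ^ w := fun hk =>
    hk.trans_le (hp.table_le.trans hp.lt_word.le)
  have small_square : ∀ {k}, k < 2 ^ (2 * δ) → k < 2 ^ w := fun hk =>
    hk.trans_le ((hp.pow_mul_le (by norm_num)).trans hp.lt_word.le)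
  have pair : ∀ {k}, k < 2 ^ δ → c * 2 ^ δ + k < 2 ^ (2 * δ) :=
    fun hk => square ▸ mul_add_lt hc hk
  have hshift := hcode.mul (hp.hasValue_radix hs)
    (small_square ((Nat.le_add_right _ _).trans_lt (pair hz)))
  have hcand_lt : candidate δ B c z < m := hy.candidate_lt z
  have hcand := (hshift.add hez (small_square (pair hz))).load_table (hs.array_eq 1 rfl) (pair hz)
    (by simp only [mul_add_div_of_lt hz, Nat.mul_add_mod_of_lt hz]; have := hp.lt_word; lia)
  simp only [mul_add_div_of_lt hz, Nat.mul_add_mod_of_lt hz] at hcand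
  have hx := hy.lt _ hcand_lt
  have hkey := hload _ hcand_lt _ (hbase.add hcand (by have := hp.lt_word; lia))
  set x := y (candidate δ B c z)
  have triple : (c * 2 ^ δ + x) * 2 ^ δ + z < 2 ^ (3 * δ) := cube ▸ mul_add_lt (pair hx) hz
  have entry : rank δ B (((c * 2 ^ δ + x) * 2 ^ δ + z) / 2 ^ δ / 2 ^ δ)
      (((c * 2 ^ δ + x) * 2 ^ δ + z) / 2 ^ δ % 2 ^ δ) (((c * 2 ^ δ + x) * 2 ^ δ + z) % 2 ^ δ) =
      Nat.count (fun i => y i ≤ z) m := by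
    rw [mul_add_div_of_lt hz, mul_add_div_of_lt hx, Nat.mul_add_mod_of_lt hx,
      Nat.mul_add_mod_of_lt hz]
    exact hy.rank_shapeCode z
  have hcount : Nat.count (fun i => y i ≤ z) m ≤ m := Nat.count_le _
  have hidx := ((hshift.add hkey (small_square (pair hx))).mul (hp.hasValue_radix hs)
    (small (by lia))).add hez (small triple)
  have := hidx.load_table (hs.array_eq 2 rfl) triple
    (by simp only [entry]; have := hp.lt_word; lia)
  simp only [entry] at this
  exact this

end Params

/-- Arrays for searches in a family of up to `B * B` keys each: the keys, the leaders of the blocks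
of `B` keys, the shape codes of the sequences of leaders, and the shape codes of the blocks. -/
def index {ι : Type*} {S : Finset ι} {len : ι → ℕ} {n : ℕ} (w δ B : ℕ) (A : Allocation S len n)
    (y : ι → ℕ → ℕ) : Memory w :=
  [A.array w y, A.array w fun a k => y a (k * B),
    A.array w fun a _ => shapeCode δ B (len a ⌈/⌉ B) fun k => y a (k * B),
    A.array w fun a q => shapeCode δ B (min B (len a - q * B)) fun i => y a (q * B + i)]

/-- The position in the index at `g` behind the last key that is at most `z`, in the block that
starts at `base`. -/
def indexExpr (o g : ℕ) (base z : Expr) : Expr :=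
  let q := .op .sub (rankExpr o (g + 1) base (.load (g + 2) base) z) (.const 1)
  let start := .op .add base (.op .mul q (.load o (.const 1)))
  .op .add start (rankExpr o g start (.load (g + 3) (.op .add base q)) z)

theorem Params.hasValue_indexExpr {δ B D n w o g : ℕ} {s : State w} (hp : Params δ B D n w)
    (hs : s.mem.StoresAt o (searchTables w δ B D)) {ι : Type*} {S : Finset ι} {len : ι → ℕ}
    {A : Allocation S len n} {y : ι → ℕ → ℕ} (hg : s.mem.StoresAt g (index w δ B A y)) {a : ι}
    (ha : a ∈ S) (hy : IsShortSeq δ (B * B) (len a) (y a)) {z : ℕ} (hz : z < 2 ^ δ)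
    (h0 : y a 0 ≤ z) {base ez : Expr} (hbase : HasValue s base (A.base a))
    (hez : HasValue s ez z) :
    HasValue s (indexExpr o g base ez)
      (A.base a + Nat.count (fun i => y a i ≤ z) (len a)) := by
  have hlen := A.base_add_len_le a ha
  have hn := hp.lt_word
  have key_lt : ∀ {i}, i < len a → y a i < 2 ^ w := fun hi =>
    (hy.lt _ hi).trans_le (hp.pow_le.trans hn.le)
  have code_lt : ∀ {m x}, IsShortSeq δ B m x → shapeCode δ B m x < 2 ^ w := fun h =>
    (hp.shapeCode_lt h).trans_le (hp.pow_le.trans hn.le)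
  have leaders := hy.leaders hp.pos
  have leader_lt : ∀ {k}, k < len a ⌈/⌉ B → k * B < len a := (lt_ceilDiv_iff hp.pos).1
  have leaders_le : len a ⌈/⌉ B ≤ len a :=
    (ceilDiv_le_iff_le_mul hp.pos).2 (Nat.le_mul_of_pos_left _ hp.pos)
  have first := hp.hasValue_rankExpr hs leaders hz (by lia) hbase
    (hbase.load_array (hg.array_eq 2 rfl) ha (i := 0) hy.pos (code_lt leaders)) hez
    fun k hk e he => he.load_array (hg.array_eq 1 rfl) ha (by lia) (key_lt (leader_lt hk))
  obtain ⟨q, hq⟩ : ∃ q, q = Nat.count (fun k => y a (k * B) ≤ z) (len a ⌈/⌉ B) - 1 := ⟨_, rfl⟩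
  obtain ⟨hqlen, hcount⟩ := count_block hp.pos hy.strictMonoOn hy.pos h0 hq
  have hcount_le : Nat.count (fun i => y a i ≤ z) (len a) ≤ len a := Nat.count_le _
  have first_pos := (le_iff_lt_count leaders.strictMonoOn leaders.pos).1
    (show y a (0 * B) ≤ z by simpa using h0)
  have hqval := first.sub (.const (n := 1) (by have := hp.levels_lt; lia)) first_pos
  rw [← hq] at hqval
  have block := hy.block hp.pos hqlen
  have hq_lt : q < len a := by have := hp.pos; nlinarith
  have start := hbase.add (hqval.mul (hp.hasValue_width hs) (by lia)) (by lia)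
  have code := (hbase.add hqval (by lia)).load_array (hg.array_eq 3 rfl) ha hq_lt (code_lt block)
  have second := hp.hasValue_rankExpr hs block hz (by lia) start code hez fun i hi e he =>
    (add_assoc (A.base a) _ _ ▸ he).load_array (hg.array_eq 0 rfl) ha (by lia) (key_lt (by lia))
  have total := start.add second (by lia)
  rwa [add_assoc, hcount] at total

end Fusion

namespace Fusion

open WordRAM

/-! ## Tries with linear space -/

/-- The search for `d` in the part of a trie where `s` chunks of `d` are left to be read. The number
`h` is the position of the current trie node in its level, or the result if `s = 0`. -/
def trieQuery (o : ℕ) : ℕ → Expr → Expr → Expr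
  | 0, h, _ => h
  | s + 1, h, d =>
    let g := o + 3 + s * 7
    let z := .op .mod (.op .shr d (.load o (.const (s + 2)))) (.load o (.const 0))
    let e := .op .sub (indexExpr o g h z) (.const 1)
    .ifLt z (.load g h) (.load (g + 4) h)
      (.ifLt (.load g e) z (.load (g + 5) e) (trieQuery o s (.load (g + 6) e) d))

/-- One level of a trie. The nodes are the blocks of `A`, and the edges of the node `a` have the
labels `y a 0 < y a 1 < …`. A search leaves the node with the result `low a` before the first edge
or `gap a i` behind the edge `i`, or follows this edge and takes `edge a i` to the next level. -/
def level {ι : Type*} {S : Finset ι} {len : ι → ℕ} {n : ℕ} (w δ B : ℕ) (A : Allocation S len n)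
    (y : ι → ℕ → ℕ) (low : ι → ℕ) (gap edge : ι → ℕ → ℕ) : Memory w :=
  index w δ B A y ++ [A.array w fun a _ => low a, A.array w gap, A.array w edge]

theorem Params.hasValue_trieQuery_succ {δ B D n w o k : ℕ} {s : State w} (hp : Params δ B D n w)
    (hs : s.mem.StoresAt o (searchTables w δ B D)) {ι : Type*} {S : Finset ι} {len : ι → ℕ}
    {A : Allocation S len n} {y gap edge : ι → ℕ → ℕ} {low : ι → ℕ}
    (hg : s.mem.StoresAt (o + 3 + k * 7) (level w δ B A y low gap edge)) {a : ι} (ha : a ∈ S)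
    (hy : IsShortSeq δ (B * B) (len a) (y a)) (low_lt : low a < 2 ^ w)
    (gap_lt : ∀ i < len a, gap a i < 2 ^ w) (edge_lt : ∀ i < len a, edge a i < 2 ^ w)
    (hk : k < D) {h ed : Expr} {d z r : ℕ} (hh : HasValue s h (A.base a)) (hd : HasValue s ed d)
    (hz : z = d / 2 ^ (δ * k) % 2 ^ δ) (hlow : z < y a 0 → low a = r)
    (hgap : ∀ i < len a, y a i < z → (∀ j < len a, y a j ≤ z → y a j ≤ y a i) → gap a i = r)
    (hedge : ∀ i < len a, y a i = z →
      ∀ e, HasValue s e (edge a i) → HasValue s (trieQuery o k e ed) r) :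
    HasValue s (trieQuery o (k + 1) h ed) r := by
  have hn := hp.lt_word
  have hP := hp.pow_le
  have key_lt : ∀ i < len a, y a i < 2 ^ w := fun i hi => (hy.lt i hi).trans_le (hP.trans hn.le)
  have arr : ∀ {i l}, (level w δ B A y low gap edge)[i]? = some l → _ := hg.array_eq _
  have ez : HasValue s _ z :=
    hz ▸ (hd.shr (hp.hasValue_shift hs hk)).mod (hp.hasValue_radix hs)
  have hzlt : z < 2 ^ δ := hz ▸ Nat.mod_lt _ (by positivity)
  refine ez.ifLt (hh.load_array (i := 0) (arr (i := 0) rfl) ha hy.pos (key_lt 0 hy.pos))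
    (fun hlt => ?_) fun h0 => ?_
  · exact hlow hlt ▸ hh.load_array (i := 0) (arr (i := 4) rfl) ha hy.pos low_lt
  have rank : ∀ {i}, i < len a → (y a i ≤ z ↔ i < Nat.count (fun i => y a i ≤ z) (len a)) :=
    le_iff_lt_count hy.strictMonoOn
  have hcount : Nat.count (fun i => y a i ≤ z) (len a) ≤ len a := Nat.count_le _
  have hval := hp.hasValue_indexExpr hs hg.left ha hy hzlt h0 hh ez
  obtain ⟨i, hi⟩ : ∃ i, Nat.count (fun i => y a i ≤ z) (len a) = i + 1 :=
    Nat.exists_eq_add_one.2 ((rank hy.pos).1 h0)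
  rw [hi] at hcount rank hval
  have ee : HasValue s _ (A.base a + i) :=
    hval.sub (.const (n := 1) (by have := hp.levels_lt; lia)) (by lia)
  refine (ee.load_array (arr (i := 0) rfl) ha hcount (key_lt i hcount)).ifLt ez (fun hlt => ?_)
    fun hle => ?_
  · refine hgap i hcount hlt (fun j hj hjz => hy.strictMonoOn.monotoneOn hj hcount ?_) ▸
      ee.load_array (arr (i := 5) rfl) ha hcount (gap_lt i hcount)
    exact Nat.le_of_lt_succ ((rank hj).1 hjz)
  · exact hedge i hcount (((rank hcount).2 i.lt_succ_self).antisymm hle) _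
      (ee.load_array (arr (i := 6) rfl) ha hcount (edge_lt i hcount))

section Enumeration

variable {Y : Finset ℕ}

theorem exists_lt_card_nth_eq {x : ℕ} (hx : x ∈ Y) : ∃ i < Y.card, Nat.nth (· ∈ Y) i = x := by
  obtain ⟨i, hi, h⟩ := Nat.exists_lt_card_finite_nth_eq (p := (· ∈ Y)) Y.finite_toSet hx
  exact ⟨i, by simpa using hi, h⟩

theorem nth_mem_of_lt_card {i : ℕ} (hi : i < Y.card) : Nat.nth (· ∈ Y) i ∈ Y :=
  Nat.nth_mem_of_lt_card (p := (· ∈ Y)) Y.finite_toSet (by simpa using hi)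

theorem isShortSeq_nth {δ B : ℕ} (hne : Y.Nonempty) (hB : Y.card ≤ B) (hY : ∀ x ∈ Y, x < 2 ^ δ) :
    IsShortSeq δ B Y.card (Nat.nth (· ∈ Y)) where
  pos := hne.card_pos
  le := hB
  strictMonoOn := by simpa using Nat.nth_strictMonoOn (p := (· ∈ Y)) Y.finite_toSet
  lt _ hi := hY _ (nth_mem_of_lt_card hi)

end Enumeration

section Chunks

variable {ι : Type*} (δ : ℕ) (J : Finset ι) (K : ι → Finset ℕ) (s : ℕ) (a : (_ : ι) × ℕ)

/-- The keys of `a.1` that are equal to `a.2` without their last `s` chunks of `δ` bits. -/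
def keysAt : Finset ℕ := {x ∈ K a.1 | x / 2 ^ (δ * s) = a.2}

/-- The labels of the edges of the trie node `a`: the chunks that come after `a.2` in the keys of
`a.1` and are followed by `s` chunks. -/
def chunks : Finset ℕ := (keysAt δ K (s + 1) a).image fun x => x / 2 ^ (δ * s) % 2 ^ δ

/-- The trie nodes with `s + 1` chunks left, in the tries of all `j ∈ J`. -/
def nodes : Finset ((_ : ι) × ℕ) := J.sigma fun j => (K j).image fun x => x / 2 ^ (δ * (s + 1))

theorem card_chunks_le : (chunks δ K s a).card ≤ (K a.1).card :=
  Finset.card_image_le.trans (Finset.card_filter_le _ _)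

theorem sum_card_chunks_le : ∑ a ∈ nodes δ J K s, (chunks δ K s a).card ≤ ∑ j ∈ J, (K j).card := by
  rw [nodes, Finset.sum_sigma]
  refine Finset.sum_le_sum fun j _ => ?_
  rw [Finset.card_eq_sum_card_image (fun x => x / 2 ^ (δ * (s + 1))) (K j)]
  exact Finset.sum_le_sum fun p _ => Finset.card_image_le

theorem div_pow_mul_succ (x : ℕ) : x / 2 ^ (δ * (s + 1)) = x / 2 ^ (δ * s) / 2 ^ δ := by
  rw [Nat.div_div_eq_div_mul, ← pow_add, mul_add_one]

theorem div_pow_mul_succ_mul_add (x : ℕ) :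
    x / 2 ^ (δ * (s + 1)) * 2 ^ δ + x / 2 ^ (δ * s) % 2 ^ δ = x / 2 ^ (δ * s) := by
  rw [div_pow_mul_succ, Nat.div_add_mod']

variable {δ J K s a}

theorem lt_of_mem_chunks {y : ℕ} (hy : y ∈ chunks δ K s a) : y < 2 ^ δ := by
  obtain ⟨x, -, rfl⟩ := Finset.mem_image.1 hy
  exact Nat.mod_lt _ (by positivity)

theorem keysAt_nonempty_of_mem_chunks {y : ℕ} (hy : y ∈ chunks δ K s a) :
    (keysAt δ K s ⟨a.1, a.2 * 2 ^ δ + y⟩).Nonempty := by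
  obtain ⟨x, hx, rfl⟩ := Finset.mem_image.1 hy
  obtain ⟨hxK, hxa⟩ := Finset.mem_filter.1 hx
  exact ⟨x, Finset.mem_filter.2 ⟨hxK, by rw [← hxa, div_pow_mul_succ_mul_add]⟩⟩

theorem mem_nodes_of_keysAt_nonempty (ha : a.1 ∈ J) (h : (keysAt δ K (s + 1) a).Nonempty) :
    a ∈ nodes δ J K s := by
  obtain ⟨x, hx⟩ := h
  exact Finset.mem_sigma.2 ⟨ha, Finset.mem_image.2 ⟨x, Finset.mem_filter.1 hx⟩⟩

/-- A search that leaves a trie node between two edges may replace `d + 1` by the lower end of the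
gap. -/
theorem lt_iff_of_gap {j : ι} {d u : ℕ} (hu : u ≤ d / 2 ^ (δ * s) % 2 ^ δ)
    (hgap : ∀ c ∈ chunks δ K s ⟨j, d / 2 ^ (δ * (s + 1))⟩, u ≤ c → d / 2 ^ (δ * s) % 2 ^ δ < c)
    {x : ℕ} (hx : x ∈ K j) :
    x < (d / 2 ^ (δ * (s + 1)) * 2 ^ δ + u) * 2 ^ (δ * s) ↔ x < d + 1 := by
  have hd := div_pow_mul_succ_mul_add δ s d
  have hx_eq := div_pow_mul_succ_mul_add δ s x
  rw [← Nat.div_lt_iff_lt_mul (by positivity), Nat.lt_succ_iff]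
  refine ⟨fun h => ?_, fun hxd => ?_⟩
  · by_contra! hdx
    have := Nat.div_le_div_right (c := 2 ^ (δ * s)) hdx.le
    lia
  · by_contra! h
    have hle := Nat.div_le_div_right (c := 2 ^ (δ * s)) hxd
    have hz := Nat.mod_lt (d / 2 ^ (δ * s)) (show 0 < 2 ^ δ by positivity)
    have same_leading : x / 2 ^ (δ * (s + 1)) = d / 2 ^ (δ * (s + 1)) := by
      rw [div_pow_mul_succ δ s x]
      exact Nat.div_eq_of_lt_le (by lia) (by rw [Nat.add_one_mul]; lia)
    rw [same_leading] at hx_eq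
    have := hgap _ (Finset.mem_image_of_mem _ (Finset.mem_filter.2 ⟨hx, same_leading⟩)) (by lia)
    lia

end Chunks

/-- Step functions `F j` for `j ∈ J`, the steps of `F j` being among the keys `K j`: few keys for
each `j`, and at most `n` keys in total. -/
structure IsStepFamily {ι : Type*} (B n w : ℕ) (J : Finset ι) (K : ι → Finset ℕ)
    (F : ι → ℕ → ℕ) : Prop where
  keys_nonempty : ∀ j ∈ J, (K j).Nonempty
  card_keys_le : ∀ j ∈ J, (K j).card ≤ B * B
  sum_card_keys_le : ∑ j ∈ J, (K j).card ≤ n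
  key_lt : ∀ j ∈ J, ∀ x ∈ K j, x < 2 ^ w
  value_lt : ∀ j ∈ J, ∀ e, F j e < 2 ^ w
  value_eq : ∀ j ∈ J, ∀ e e', (∀ x ∈ K j, x < e ↔ x < e') → F j e = F j e'

section Trie

variable {ι : Type*} {δ B D n w : ℕ} {J : Finset ι} {K : ι → Finset ℕ}
  (A : ∀ s, Allocation (nodes δ J K s) (fun a => (chunks δ K s a).card) n) (F : ι → ℕ → ℕ)

/-- What a search knows about a trie node with `s` chunks left: its position in its level, or the
result if `s = 0`. -/
def handle : ℕ → (_ : ι) × ℕ → ℕ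
  | 0, a => F a.1 (a.2 + 1)
  | s + 1, a => (A s).base a

/-- The level with `s + 1` chunks left of the tries for the step functions `F`. -/
noncomputable def trieLevel (w B s : ℕ) : Memory w :=
  level w δ B (A s) (fun a => Nat.nth (· ∈ chunks δ K s a))
    (fun a => F a.1 (a.2 * 2 ^ δ * 2 ^ (δ * s)))
    (fun a i => F a.1 ((a.2 * 2 ^ δ + (Nat.nth (· ∈ chunks δ K s a) i + 1)) * 2 ^ (δ * s)))
    (fun a i => handle A F s ⟨a.1, a.2 * 2 ^ δ + Nat.nth (· ∈ chunks δ K s a) i⟩)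

/-- The tries for the step functions `F`, preceded by the search tables. -/
noncomputable def tries (w B D : ℕ) : Memory w :=
  searchTables w δ B D ++ ((List.range D).map (trieLevel A F w B)).flatten

theorem length_tries : (tries A F w B D).length = 3 + D * 7 := by
  simp [tries, trieLevel, level, index, searchTables, Function.comp_def]
  ring

theorem size_tries_le (hp : Params δ B D n w) : (tries A F w B D).size ≤ (D * 8 + 4) * n := by
  have levels : Memory.size ((List.range D).map (trieLevel A F w B)).flatten ≤ D * (7 * n) := by
    refine (Memory.size_flatten_le (c := 7 * n) ?_).trans (by simp)
    simp only [List.mem_map, forall_exists_index, and_imp]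
    rintro x s - rfl
    simp [trieLevel, level, index, Allocation.array, Memory.size]
    lia
  have tables : (searchTables w δ B D).size = D + 2 + 2 ^ (2 * δ) + 2 ^ (3 * δ) := by
    simp [Memory.size, searchTables, add_assoc]
  have square := hp.pow_mul_le (show 2 ≤ 3 by norm_num)
  have cube := hp.table_le
  have hpos : 0 < 2 ^ (3 * δ) := by positivity
  rw [tries, Memory.size_append, tables]
  nlinarith

variable {A F}

theorem handle_lt (hn : n < 2 ^ w) (hF : IsStepFamily B n w J K F) {s : ℕ} {a : (_ : ι) × ℕ}
    (ha : a.1 ∈ J) (hne : (keysAt δ K s a).Nonempty) : handle A F s a < 2 ^ w := by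
  cases s with
  | zero => exact hF.value_lt _ ha _
  | succ s =>
    have := (A s).base_add_len_le a (mem_nodes_of_keysAt_nonempty ha hne)
    simp only [handle]
    lia

theorem IsStepFamily.keysAt_root (hF : IsStepFamily B n w J K F) (hw : w ≤ δ * D) {j : ι}
    (hj : j ∈ J) : (keysAt δ K D ⟨j, 0⟩).Nonempty := by
  obtain ⟨x, hx⟩ := hF.keys_nonempty j hj
  exact ⟨x, Finset.mem_filter.2 ⟨hx, Nat.div_eq_of_lt
    ((hF.key_lt j hj x hx).trans_le (Nat.pow_le_pow_right two_pos hw))⟩⟩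

theorem hasValue_trieQuery (hp : Params δ B D n w) (hF : IsStepFamily B n w J K F) {s : State w}
    {o : ℕ} (hs : s.mem.StoresAt o (tries A F w B D)) {j : ι} (hj : j ∈ J) {d : ℕ} {ed : Expr}
    (hd : HasValue s ed d) {k : ℕ} (hk : k ≤ D) {eh : Expr}
    (hne : (keysAt δ K k ⟨j, d / 2 ^ (δ * k)⟩).Nonempty)
    (hh : HasValue s eh (handle A F k ⟨j, d / 2 ^ (δ * k)⟩)) :
    HasValue s (trieQuery o k eh ed) (F j (d + 1)) := by
  induction k generalizing eh with
  | zero => simpa [handle, trieQuery] using hh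
  | succ k ih =>
    set a : (_ : ι) × ℕ := ⟨j, d / 2 ^ (δ * (k + 1))⟩
    set z := d / 2 ^ (δ * k) % 2 ^ δ with hz
    set Y := chunks δ K k a
    have hz_eq : a.2 * 2 ^ δ + z = d / 2 ^ (δ * k) := div_pow_mul_succ_mul_add δ k d
    have hlevel : s.mem.StoresAt (o + 3 + k * 7) (trieLevel A F w B k) :=
      hs.right.flatten (k := 7) (by simp [trieLevel, level, index])
        (by simp [show k < D by lia])
    have value_eq : ∀ {u}, u ≤ z → (∀ c ∈ Y, u ≤ c → z < c) →
        F j ((a.2 * 2 ^ δ + u) * 2 ^ (δ * k)) = F j (d + 1) := fun hu hgap =>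
      hF.value_eq j hj _ _ fun x hx => lt_iff_of_gap hu hgap hx
    have hshort : IsShortSeq δ (B * B) Y.card (Nat.nth (· ∈ Y)) := isShortSeq_nth (hne.image _)
      ((card_chunks_le δ K k a).trans (hF.card_keys_le j hj)) fun x => lt_of_mem_chunks
    refine hp.hasValue_trieQuery_succ hs.left hlevel (mem_nodes_of_keysAt_nonempty hj hne) hshort
      (hF.value_lt j hj _) (fun i _ => hF.value_lt j hj _)
      (fun i hi => handle_lt hp.lt_word hF hj
        (keysAt_nonempty_of_mem_chunks (nth_mem_of_lt_card hi)))
      hk hh hd hz (fun hlow => ?_) (fun i _ hlt hmax => ?_) fun i hi heq e he => ?_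
    · refine value_eq (Nat.zero_le z) fun c hc _ => hlow.trans_le ?_
      obtain ⟨i, hi, rfl⟩ := exists_lt_card_nth_eq hc
      exact hshort.strictMonoOn.monotoneOn hshort.pos hi (Nat.zero_le i)
    · refine value_eq hlt fun c hc hic => ?_
      obtain ⟨l, hl, rfl⟩ := exists_lt_card_nth_eq hc
      by_contra! hle
      exact absurd (hmax l hl hle) (by lia)
    · rw [heq, hz_eq] at he
      refine ih (by lia) ?_ he
      rw [← hz_eq, ← heq]
      exact keysAt_nonempty_of_mem_chunks (nth_mem_of_lt_card hi)

theorem IsStepFamily.exists_memory (hp : Params δ B D n w) (hF : IsStepFamily B n w J K F) :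
    ∃ (m : Memory w) (root : ι → ℕ), m.length = 3 + D * 7 ∧ m.size ≤ (D * 8 + 4) * n ∧
      (∀ j ∈ J, root j < 2 ^ w) ∧ ∀ (s : State w) (o : ℕ), s.mem.StoresAt o m → ∀ j ∈ J,
        ∀ (d : ℕ) (eh ed : Expr), HasValue s eh (root j) → HasValue s ed d →
          HasValue s (trieQuery o D eh ed) (F j (d + 1)) := by
  have A (s : ℕ) : Allocation (nodes δ J K s) (fun a => (chunks δ K s a).card) n :=
    (Allocation.exists_of_sum_le
      ((sum_card_chunks_le δ J K s).trans hF.sum_card_keys_le)).some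
  refine ⟨tries A F w B D, fun j => handle A F D ⟨j, 0⟩, length_tries A F, size_tries_le A F hp,
    fun j hj => handle_lt hp.lt_word hF hj (hF.keysAt_root hp.word_le hj),
    fun s o hs j hj d eh ed hh hd => hasValue_trieQuery hp hF hs hj hd le_rfl ?_ ?_⟩
  all_goals rw [Nat.div_eq_of_lt (hd.lt_two_pow.trans_le (Nat.pow_le_pow_right two_pos hp.word_le))]
  exacts [hF.keysAt_root hp.word_le hj, hh]

end Trie

end Fusion

/-! ## Weighted trees -/

section Predecessor

variable {ι : Type*} {A A' : Set ι} {key : ι → ℕ} {d d' : ℕ}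

theorem IsPredecessor.of_iff {o : Option ι} (ho : IsPredecessor A key d o)
    (h : ∀ i, i ∈ A ∧ key i ≤ d ↔ i ∈ A' ∧ key i ≤ d') : IsPredecessor A' key d' o := by
  cases o with
  | none =>
    exact fun i hi => not_le.1 fun hid =>
      have h := (h i).2 ⟨hi, hid⟩
      (ho i h.1).not_ge h.2
  | some i =>
    exact ⟨((h i).1 ⟨ho.1, ho.2.1⟩).1, ((h i).1 ⟨ho.1, ho.2.1⟩).2, fun j hj hjd =>
      ho.2.2 j ((h j).2 ⟨hj, hjd⟩).1 ((h j).2 ⟨hj, hjd⟩).2⟩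

variable [Finite ι]

open Classical in
/-- An element of `S` with the largest key, or `none` if `S` is empty. -/
noncomputable def maximizer (key : ι → ℕ) (S : Set ι) : Option ι :=
  if h : S.Nonempty then some (S.toFinite.exists_maximalFor key S h).choose else none

theorem isPredecessor_maximizer (A : Set ι) (key : ι → ℕ) (d : ℕ) :
    IsPredecessor A key d (maximizer key {i ∈ A | key i ≤ d}) := by
  unfold maximizer
  split_ifs with h
  · have hmax := (Set.toFinite {i ∈ A | key i ≤ d}).exists_maximalFor key _ h |>.choose_spec
    exact ⟨hmax.1.1, hmax.1.2, fun j hj hjd => (le_total _ _).elim id (hmax.2 ⟨hj, hjd⟩)⟩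
  · exact fun i hi => not_le.1 fun hid => h ⟨i, hi, hid⟩

end Predecessor

theorem encodeAnswer_le {n : ℕ} (o : Option (Fin n)) : encodeAnswer o ≤ n := by
  cases o with
  | none => exact le_rfl
  | some i => exact i.2.le

namespace WeightedTree

variable {n : ℕ} {T : WeightedTree n} {a b u v : Fin n}

theorem mem_ancestors_self (v : Fin n) : v ∈ T.ancestors v := ⟨0, rfl⟩

theorem root_mem_ancestors (v : Fin n) : T.root ∈ T.ancestors v := T.reaches_root v

theorem mem_ancestors_iff : u ∈ T.ancestors v ↔ u = v ∨ u ∈ T.ancestors (T.parent v) := by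
  constructor
  · rintro ⟨_ | k, hk⟩
    exacts [.inl hk.symm, .inr ⟨k, hk⟩]
  · rintro (rfl | ⟨k, hk⟩)
    exacts [mem_ancestors_self _, ⟨k + 1, hk⟩]

theorem ancestors_root : T.ancestors T.root = {T.root} := by
  ext u
  simp [ancestors, Function.iterate_fixed T.parent_root, eq_comm]

theorem mem_ancestors_trans (hab : a ∈ T.ancestors b) (hbv : b ∈ T.ancestors v) :
    a ∈ T.ancestors v := by
  obtain ⟨k, rfl⟩ := hbv
  obtain ⟨l, rfl⟩ := hab
  exact ⟨l + k, Function.iterate_add_apply _ _ _ _⟩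

theorem weight_lt_of_mem_ancestors (h : a ∈ T.ancestors v) (hne : a ≠ v) :
    T.weight a < T.weight v := by
  obtain ⟨k, hk⟩ := h
  induction k generalizing v with
  | zero => exact (hne hk.symm).elim
  | succ k ih =>
    rcases eq_or_ne v T.root with rfl | hv
    · exact (hne (hk ▸ Function.iterate_fixed T.parent_root (k + 1))).elim
    · rcases eq_or_ne a (T.parent v) with rfl | hav
      · exact T.weight_parent_lt v hv
      · exact (ih hav hk).trans (T.weight_parent_lt v hv)

theorem weight_le_of_mem_ancestors (h : a ∈ T.ancestors v) : T.weight a ≤ T.weight v := by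
  rcases eq_or_ne a v with rfl | hne
  · exact le_rfl
  · exact (weight_lt_of_mem_ancestors h hne).le

theorem mem_ancestors_total (ha : a ∈ T.ancestors v) (hb : b ∈ T.ancestors v) :
    a ∈ T.ancestors b ∨ b ∈ T.ancestors a := by
  obtain ⟨k, rfl⟩ := ha
  obtain ⟨l, rfl⟩ := hb
  rcases le_total k l with h | h <;> obtain ⟨i, rfl⟩ := Nat.exists_eq_add_of_le' h
  · exact .inr ⟨i, (Function.iterate_add_apply _ _ _ _).symm⟩
  · exact .inl ⟨i, (Function.iterate_add_apply _ _ _ _).symm⟩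

theorem mem_ancestors_of_weight_le (ha : a ∈ T.ancestors v) (hb : b ∈ T.ancestors v)
    (h : T.weight a ≤ T.weight b) : a ∈ T.ancestors b := by
  rcases mem_ancestors_total ha hb with h' | h'
  · exact h'
  · rcases eq_or_ne b a with rfl | hne
    · exact h'
    · exact absurd (weight_lt_of_mem_ancestors h' hne) h.not_gt

variable (T) in
open Classical in
/-- The nodes of the subtree with root `v`. -/
noncomputable def descendants (v : Fin n) : Finset (Fin n) := {u | v ∈ T.ancestors u}

theorem mem_descendants : u ∈ T.descendants v ↔ v ∈ T.ancestors u := by simp [descendants]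

theorem card_descendants_le (h : a ∈ T.ancestors b) :
    (T.descendants b).card ≤ (T.descendants a).card :=
  Finset.card_le_card fun _ hu => mem_descendants.2 (mem_ancestors_trans h (mem_descendants.1 hu))

theorem descendants_root : T.descendants T.root = Finset.univ := by
  ext u
  simp [mem_descendants, root_mem_ancestors u]

theorem sum_card_descendants_le (J : Finset (Fin n))
    (hJ : ∀ a ∈ J, ∀ b ∈ J, a ∈ T.ancestors b → a = b) :
    ∑ a ∈ J, (T.descendants a).card ≤ n := by
  rw [← Finset.card_biUnion fun a ha b hb hab => Finset.disjoint_left.2 fun u hua hub => ?_]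
  · exact (Finset.card_le_univ _).trans (by simp)
  · rcases mem_ancestors_total (mem_descendants.1 hua) (mem_descendants.1 hub) with h | h
    exacts [hab (hJ a ha b hb h), hab (hJ b hb a ha h).symm]

variable (T) in
theorem exists_isLeaf (v : Fin n) : ∃ l, T.IsLeaf l ∧ v ∈ T.ancestors l := by
  obtain ⟨l, hl, hmax⟩ := (T.descendants v).exists_max_image T.weight
    ⟨v, mem_descendants.2 (mem_ancestors_self v)⟩
  refine ⟨l, fun u hu hul => ?_, mem_descendants.1 hl⟩
  have hlu : l ∈ T.ancestors u := ⟨1, hul⟩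
  exact (hmax u (mem_descendants.2 (mem_ancestors_trans (mem_descendants.1 hl) hlu))).not_gt
    (hul ▸ T.weight_parent_lt u hu)

section Numbering

variable (T) (s : Finset (Fin n))

/-- Ties between weights are broken by the names of the nodes. -/
def weightKey (u : Fin n) : ℕ := T.weight u * n + u

/-- The position of `u` in the set `s` of nodes, sorted by weight. -/
def numberIn (u : Fin n) : ℕ := Nat.count (· ∈ s.image T.weightKey) (T.weightKey u)

/-- The node at position `i` of the set `s`, see `numberIn`. -/
noncomputable def nodeAt (i : ℕ) : ℕ := Nat.nth (· ∈ s.image T.weightKey) i % n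

variable {T s}

theorem weightKey_mod (u : Fin n) : T.weightKey u % n = u := by
  rw [weightKey, Nat.mul_add_mod_of_lt u.2]

theorem weightKey_lt (h : T.weight u < T.weight v) : T.weightKey u < T.weightKey v := by
  have := u.2
  simp only [weightKey]
  nlinarith

theorem weightKey_injective : Function.Injective T.weightKey := fun u v h =>
  Fin.ext (by rw [← weightKey_mod (T := T) u, h, weightKey_mod])

theorem numberIn_lt (hu : u ∈ s) : T.numberIn s u < s.card := by
  refine (Nat.count_lt_card (p := (· ∈ s.image T.weightKey)) (Finset.finite_toSet _)
    (Finset.mem_image_of_mem _ hu)).trans_eq ?_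
  rw [← Finset.card_image_of_injective s weightKey_injective]
  exact congrArg Finset.card (Finset.finite_toSet_toFinset _)

theorem nodeAt_numberIn (hu : u ∈ s) : T.nodeAt s (T.numberIn s u) = u := by
  rw [nodeAt, numberIn, Nat.nth_count (Finset.mem_image_of_mem _ hu), weightKey_mod]

theorem numberIn_lt_numberIn (hu : u ∈ s) (h : T.weight u < T.weight v) :
    T.numberIn s u < T.numberIn s v :=
  Nat.count_strict_mono (Finset.mem_image_of_mem _ hu) (weightKey_lt h)

theorem numberIn_injOn : Set.InjOn (T.numberIn s) s := fun u hu v hv h =>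
  Fin.ext (by rw [← nodeAt_numberIn hu, h, nodeAt_numberIn hv])

theorem nodeAt_lt (i : ℕ) : T.nodeAt s i < n := Nat.mod_lt _ T.root.pos

end Numbering

section Mask

variable {s : Finset (Fin n)} {A A' : Set (Fin n)}

variable (T s) (A) in
open Classical in
/-- The nodes in `s` that belong to `A`, as a bit string: bit `i` stands for the node at position
`i` of `s`. -/
noncomputable def mask : ℕ := ∑ i ∈ {u ∈ s | u ∈ A}.image (T.numberIn s), 2 ^ i

theorem testBit_mask (i : ℕ) :
    (T.mask s A).testBit i = true ↔ ∃ u ∈ s, u ∈ A ∧ T.numberIn s u = i := by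
  rw [← Nat.mem_bitIndices, ← List.mem_toFinset, mask,
    Finset.toFinset_bitIndices_sum_two_pow]
  simp [and_assoc]

theorem mask_lt : T.mask s A < 2 ^ s.card :=
  Nat.geomSum_lt le_rfl fun i hi => by
    obtain ⟨u, ⟨hu, -⟩, rfl⟩ := by simpa using hi
    exact numberIn_lt hu

theorem mask_congr (h : ∀ u ∈ s, u ∈ A ↔ u ∈ A') : T.mask s A = T.mask s A' := by
  classical
  rw [mask, mask, Finset.filter_congr h]

theorem mask_and_mask : T.mask s A &&& T.mask s A' = T.mask s (A ∩ A') := by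
  refine Nat.eq_of_testBit_eq fun i => Bool.eq_iff_iff.2 ?_
  rw [Nat.testBit_and, Bool.and_eq_true, testBit_mask, testBit_mask, testBit_mask]
  constructor
  · rintro ⟨⟨u, hu, huA, rfl⟩, u', hu', huA', heq⟩
    exact ⟨u, hu, ⟨huA, numberIn_injOn hu' hu heq ▸ huA'⟩, rfl⟩
  · rintro ⟨u, hu, huA, rfl⟩
    exact ⟨⟨u, hu, huA.1, rfl⟩, u, hu, huA.2, rfl⟩

theorem notMem_of_mask_eq_zero (h : T.mask s A = 0) (hu : u ∈ s) : u ∉ A := fun huA => by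
  have := (testBit_mask (T := T) _).2 ⟨u, hu, huA, rfl⟩
  simp [h] at this

theorem exists_nodeAt_log2_mask (h : T.mask s A ≠ 0) : ∃ u ∈ s, u ∈ A ∧
    T.nodeAt s (Nat.log2 (T.mask s A)) = u ∧ ∀ v ∈ s, v ∈ A → T.weight v ≤ T.weight u := by
  obtain ⟨u, hu, huA, heq⟩ := (testBit_mask _).1 (Nat.testBit_log2 h)
  refine ⟨u, hu, huA, heq ▸ nodeAt_numberIn hu, fun v hv hvA => ?_⟩
  have hle : T.numberIn s v ≤ T.numberIn s u := heq ▸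
    (Nat.le_log2 h).2 (Nat.ge_two_pow_of_testBit ((testBit_mask _).2 ⟨v, hv, hvA, rfl⟩))
  exact not_lt.1 fun hlt => (numberIn_lt_numberIn hu hlt).not_ge hle

end Mask

open WordRAM in
variable (T) in
/-- The data structure `m` supports predecessor search among marked ancestors: if it stands in the
memory from array `o` on, then the expression `query o ev ed` finds the predecessor of the value of
`ed` among the marked ancestors of the value of `ev`. -/
def IsSearchStructure (marked : Set (Fin n)) {w : ℕ} (m : Memory w)
    (query : ℕ → Expr → Expr → Expr) : Prop :=
  ∀ (s : State w) (o : ℕ), s.mem.StoresAt o m → ∀ (v : Fin n) (d : ℕ) (ev ed : Expr),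
    HasValue s ev v → HasValue s ed d →
      ∃ ans, IsPredecessor (T.ancestors v ∩ marked) T.weight d ans ∧
        HasValue s (query o ev ed) (encodeAnswer ans)

end WeightedTree

/-! ## Few marked ancestors -/

namespace WeightedTree

open WordRAM Fusion

variable {n : ℕ} {T : WeightedTree n} {δ B D w : ℕ} {marked : Set (Fin n)}

section LargeAndSmall

variable (T δ)

open Classical in
/-- The lowest nodes with more than `δ` descendants. -/
noncomputable def largeLeaves : Finset (Fin n) :=
  {l | δ < (T.descendants l).card ∧
    ∀ u, l ∈ T.ancestors u → δ < (T.descendants u).card → l = u}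

open Classical in
/-- The highest nodes with at most `δ` descendants. -/
noncomputable def smallRoots : Finset (Fin n) :=
  {r | (T.descendants r).card ≤ δ ∧
    ∀ a ∈ T.ancestors r, (T.descendants a).card ≤ δ → a = r}

variable {T δ}

theorem mem_largeLeaves {l : Fin n} : l ∈ T.largeLeaves δ ↔ δ < (T.descendants l).card ∧
    ∀ u, l ∈ T.ancestors u → δ < (T.descendants u).card → l = u := by
  simp [largeLeaves]

theorem mem_smallRoots {r : Fin n} : r ∈ T.smallRoots δ ↔ (T.descendants r).card ≤ δ ∧
    ∀ a ∈ T.ancestors r, (T.descendants a).card ≤ δ → a = r := by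
  simp [smallRoots]

theorem sum_card_largeLeaves_le : ∑ l ∈ T.largeLeaves δ, (T.descendants l).card ≤ n :=
  T.sum_card_descendants_le _ fun _ ha b hb hab =>
    (mem_largeLeaves.1 ha).2 b hab (mem_largeLeaves.1 hb).1

theorem sum_card_smallRoots_le : ∑ r ∈ T.smallRoots δ, (T.descendants r).card ≤ n :=
  T.sum_card_descendants_le _ fun a ha _ hb hab =>
    (mem_smallRoots.1 hb).2 a hab (mem_smallRoots.1 ha).1

theorem exists_largeLeaf {p : Fin n} (hp : δ < (T.descendants p).card) :
    ∃ l ∈ T.largeLeaves δ, p ∈ T.ancestors l := by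
  obtain ⟨l, ⟨hpl, hl⟩, hmax⟩ := (Set.toFinite {l | p ∈ T.ancestors l ∧
    δ < (T.descendants l).card}).exists_maximalFor T.weight _ ⟨p, mem_ancestors_self p, hp⟩
  refine ⟨l, mem_largeLeaves.2 ⟨hl, fun u hu hularge => by_contra fun hne => ?_⟩, hpl⟩
  have hlt := weight_lt_of_mem_ancestors hu hne
  exact hlt.not_ge (hmax ⟨mem_ancestors_trans hpl hu, hularge⟩ hlt.le)

/-- The nodes with large subtrees form a tree with the leaves `largeLeaves`, which the path from `v`
to the root enters at `p`. -/
theorem exists_branch (hδ : δ < n) (v : Fin n) :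
    ∃ l ∈ T.largeLeaves δ, ∃ p ∈ T.ancestors v, p ∈ T.ancestors l ∧
      ∀ a ∈ T.ancestors v, δ < (T.descendants a).card → a ∈ T.ancestors p := by
  have hroot : δ < (T.descendants T.root).card := by simpa [descendants_root] using hδ
  obtain ⟨p, ⟨hpv, hp⟩, hmax⟩ := (Set.toFinite {p | p ∈ T.ancestors v ∧
    δ < (T.descendants p).card}).exists_maximalFor T.weight _
    ⟨T.root, root_mem_ancestors v, hroot⟩
  obtain ⟨l, hl, hpl⟩ := exists_largeLeaf hp
  exact ⟨l, hl, p, hpv, hpl, fun a ha halarge => mem_ancestors_of_weight_le ha hpv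
    ((le_total _ _).elim id (hmax ⟨ha, halarge⟩))⟩

theorem exists_smallRoot {v : Fin n} (hv : (T.descendants v).card ≤ δ) :
    ∃ r ∈ T.smallRoots δ, r ∈ T.ancestors v ∧
      ∀ a ∈ T.ancestors v, (T.descendants a).card ≤ δ → r ∈ T.ancestors a := by
  obtain ⟨r, ⟨hrv, hr⟩, hmin⟩ := (Set.toFinite {r | r ∈ T.ancestors v ∧
    (T.descendants r).card ≤ δ}).exists_minimalFor T.weight _ ⟨v, mem_ancestors_self v, hv⟩
  refine ⟨r, mem_smallRoots.2 ⟨hr, fun a ha hasmall => by_contra fun hne => ?_⟩, hrv,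
    fun a ha hasmall => mem_ancestors_of_weight_le hrv ha
      ((le_total _ _).elim id (hmin ⟨ha, hasmall⟩))⟩
  have hlt := weight_lt_of_mem_ancestors ha hne
  exact hlt.not_ge (hmin ⟨mem_ancestors_trans ha hrv, hasmall⟩ hlt.le)

end LargeAndSmall

section Upper

/-- The search among the marked ancestors with large subtrees: on the path to the root from a lowest
large subtree, no deeper than where this path leaves the path from the given node. -/
def upperQuery (o D : ℕ) (ev ed : Expr) : Expr :=
  trieQuery (o + 2) D (.load o ev) (.ifLt ed (.load (o + 1) ev) ed (.load (o + 1) ev))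

theorem isStepFamily_largeLeaves (hp : Params δ B D n w) (hB : δ + 1 ≤ B * B)
    (hw : ∀ v, T.weight v < 2 ^ w) (hm : ∀ v, (T.ancestors v ∩ marked).ncard ≤ δ) :
    IsStepFamily B n w (T.largeLeaves δ)
      (fun l => (Set.toFinite (insert l (T.ancestors l ∩ marked))).toFinset.image T.weight)
      (fun l e => encodeAnswer
        (maximizer T.weight {u ∈ T.ancestors l ∩ marked | T.weight u < e})) := by
  have card_le (l : Fin n) : ((Set.toFinite (insert l (T.ancestors l ∩ marked))).toFinset.image
      T.weight).card ≤ δ + 1 := by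
    refine Finset.card_image_le.trans ?_
    rw [← Set.ncard_eq_toFinset_card]
    exact (Set.ncard_insert_le _ _).trans (Nat.succ_le_succ (hm l))
  refine ⟨fun l _ => by simp, fun l _ => (card_le l).trans hB, ?_, ?_,
    fun l _ e => (encodeAnswer_le _).trans_lt hp.lt_word, fun l _ e e' h => ?_⟩
  · refine (Finset.sum_le_sum fun l hl => ?_).trans sum_card_largeLeaves_le
    exact (card_le l).trans (mem_largeLeaves.1 hl).1
  · simp only [Finset.mem_image]
    rintro l - _ ⟨u, -, rfl⟩
    exact hw u
  · congr 2
    ext u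
    refine and_congr_right fun hu => h _ (Finset.mem_image_of_mem _ ?_)
    exact (Set.Finite.mem_toFinset _).2 (.inr hu)

theorem isPredecessor_large {l p v : Fin n} {d : ℕ} {ans : Option (Fin n)}
    (hl : δ < (T.descendants l).card) (hpv : p ∈ T.ancestors v) (hpl : p ∈ T.ancestors l)
    (hlarge : ∀ a ∈ T.ancestors v, δ < (T.descendants a).card → a ∈ T.ancestors p)
    (hans : IsPredecessor (T.ancestors l ∩ marked) T.weight (min d (T.weight p)) ans) :
    IsPredecessor {u ∈ T.ancestors v ∩ marked | δ < (T.descendants u).card} T.weight d ans := by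
  refine hans.of_iff fun a => ?_
  rw [le_min_iff]
  refine ⟨fun ⟨⟨ha, hmarked⟩, had, hap⟩ => ?_, fun ⟨⟨⟨ha, hmarked⟩, ha_large⟩, had⟩ => ?_⟩
  · have hap := mem_ancestors_of_weight_le ha hpl hap
    exact ⟨⟨⟨mem_ancestors_trans hap hpv, hmarked⟩, hl.trans_le (card_descendants_le ha)⟩, had⟩
  · have hap := hlarge a ha ha_large
    exact ⟨⟨mem_ancestors_trans hap hpl, hmarked⟩, had, weight_le_of_mem_ancestors hap⟩

theorem exists_memory_upperQuery (hp : Params δ B D n w) (hB : δ + 1 ≤ B * B)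
    (hw : ∀ v, T.weight v < 2 ^ w) (hm : ∀ v, (T.ancestors v ∩ marked).ncard ≤ δ) :
    ∃ m : Memory w, m.length = 5 + D * 7 ∧ m.size ≤ (D * 8 + 6) * n ∧
      ∀ (s : State w) (o : ℕ), s.mem.StoresAt o m → ∀ (v : Fin n) (d : ℕ) (ev ed : Expr),
        HasValue s ev v → HasValue s ed d →
          ∃ ans, IsPredecessor {u ∈ T.ancestors v ∩ marked | δ < (T.descendants u).card}
            T.weight d ans ∧ HasValue s (upperQuery o D ev ed) (encodeAnswer ans) := by
  have hδ : δ < n := Nat.lt_two_pow_self.trans_le hp.pow_le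
  choose leaf hleaf branch hbranch hbranchleaf habove using exists_branch (T := T) hδ
  obtain ⟨m, root, hlen, hsize, hroot, hquery⟩ :=
    (isStepFamily_largeLeaves hp hB hw hm).exists_memory hp
  refine ⟨[table w fun v => root (leaf v), table w fun v => T.weight (branch v)] ++ m,
    by simp [hlen]; lia, ?_, fun s o hs v d ev ed hev hed => ?_⟩
  · rw [Memory.size_append]
    simp only [Memory.size, List.map_cons, length_table, List.map_nil, List.sum_cons, List.sum_nil]
      at hsize ⊢
    lia
  have hhandle := hev.load_table (hs.left.array_eq 0 rfl) v.2 (hroot _ (hleaf v))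
  have hweight := hev.load_table (hs.left.array_eq 1 rfl) v.2 (hw (branch v))
  have harg : HasValue s (.ifLt ed (.load (o + 1) ev) ed (.load (o + 1) ev))
      (min d (T.weight (branch v))) :=
    hed.ifLt hweight (fun h => by rwa [min_eq_left h.le]) fun h => by rwa [min_eq_right h]
  have hans := hquery s (o + 2) hs.right (leaf v) (hleaf v) _ _ _ hhandle harg
  simp only [Nat.lt_succ_iff] at hans
  exact ⟨_, isPredecessor_large (mem_largeLeaves.1 (hleaf v)).1 (hbranch v) (hbranchleaf v)
    (habove v) (isPredecessor_maximizer _ _ _), hans⟩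

end Upper

section Lower

/-- The search in a small subtree: a bit mask of the marked ancestors of the given node in its small
subtree is intersected with the mask of the nodes of small weight. The result is that of `fallback`
if this intersection is empty. -/
def lowerQuery (o D : ℕ) (ev ed fallback : Expr) : Expr :=
  let hits : Expr := .op .and (.load (o + 2) ev) (trieQuery (o + 5) D (.load (o + 3) ev) ed)
  .ifLt (.load (o + 2) ev) (.const 1) fallback (.ifLt hits (.const 1) fallback
    (.load (o + 1) (.op .add (.load (o + 4) ev) (.load o hits))))

theorem mask_lt_of_mem_smallRoots {r : Fin n} (hr : r ∈ T.smallRoots δ) {A : Set (Fin n)} :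
    T.mask (T.descendants r) A < 2 ^ δ :=
  mask_lt.trans_le (Nat.pow_le_pow_right two_pos (mem_smallRoots.1 hr).1)

theorem isStepFamily_smallRoots (hp : Params δ B D n w) (hB : δ ≤ B * B)
    (hw : ∀ v, T.weight v < 2 ^ w) :
    IsStepFamily B n w (T.smallRoots δ) (fun r => (T.descendants r).image T.weight)
      (fun r e => T.mask (T.descendants r) {u | T.weight u < e}) where
  keys_nonempty r _ := ⟨_, Finset.mem_image_of_mem _ (mem_descendants.2 (mem_ancestors_self r))⟩
  card_keys_le r hr := (Finset.card_image_le.trans (mem_smallRoots.1 hr).1).trans hB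
  sum_card_keys_le := (Finset.sum_le_sum fun _ _ => Finset.card_image_le).trans
    sum_card_smallRoots_le
  key_lt := by
    simp only [Finset.mem_image]
    rintro r - _ ⟨u, -, rfl⟩
    exact hw u
  value_lt r hr e := ((mask_lt_of_mem_smallRoots hr).trans_le hp.pow_le).trans hp.lt_word
  value_eq r _ e e' h := mask_congr fun u hu => h _ (Finset.mem_image_of_mem _ hu)

theorem exists_isPredecessor_of_mask_ne_zero {r v : Fin n} {d : ℕ}
    (h : T.mask (T.descendants r) (T.ancestors v ∩ marked ∩ {u | T.weight u < d + 1}) ≠ 0) :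
    ∃ u : Fin n, T.nodeAt (T.descendants r) (Nat.log2 (T.mask (T.descendants r)
        (T.ancestors v ∩ marked ∩ {u | T.weight u < d + 1}))) = u ∧
      IsPredecessor (T.ancestors v ∩ marked) T.weight d (some u) := by
  obtain ⟨u, hu, ⟨huv, hud⟩, heq, hmax⟩ := exists_nodeAt_log2_mask h
  refine ⟨u, heq, huv, Nat.lt_succ_iff.1 hud, fun a ha had => not_lt.1 fun hlt => ?_⟩
  have hua := mem_ancestors_of_weight_le huv.1 ha.1 hlt.le
  have har := mem_descendants.2 (mem_ancestors_trans (mem_descendants.1 hu) hua)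
  exact hlt.not_ge (hmax a har ⟨ha, Nat.lt_succ_iff.2 had⟩)

theorem isPredecessor_of_mask_eq_zero {r v : Fin n} {d : ℕ} {ans : Option (Fin n)}
    (hr : ∀ a ∈ T.ancestors v, (T.descendants a).card ≤ δ → r ∈ T.ancestors a)
    (h : T.mask (T.descendants r) (T.ancestors v ∩ marked ∩ {u | T.weight u < d + 1}) = 0)
    (hans : IsPredecessor {u ∈ T.ancestors v ∩ marked | δ < (T.descendants u).card}
      T.weight d ans) :
    IsPredecessor (T.ancestors v ∩ marked) T.weight d ans := by
  refine hans.of_iff fun a => and_congr_left fun had => and_iff_left_of_imp fun ha => ?_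
  by_contra! hsmall
  exact notMem_of_mask_eq_zero h (mem_descendants.2 (hr a ha.1 hsmall))
    ⟨ha, Nat.lt_succ_iff.2 had⟩

theorem exists_smallRoots_choice (T : WeightedTree n) (δ : ℕ) :
    ∃ small : Fin n → Fin n, ∀ v, (T.descendants v).card ≤ δ → small v ∈ T.smallRoots δ ∧
      ∀ a ∈ T.ancestors v, (T.descendants a).card ≤ δ → small v ∈ T.ancestors a := by
  have (v : Fin n) : ∃ r, (T.descendants v).card ≤ δ → r ∈ T.smallRoots δ ∧
      ∀ a ∈ T.ancestors v, (T.descendants a).card ≤ δ → r ∈ T.ancestors a := by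
    by_cases hv : (T.descendants v).card ≤ δ
    · obtain ⟨r, hr, -, habove⟩ := exists_smallRoot hv
      exact ⟨r, fun _ => ⟨hr, habove⟩⟩
    · exact ⟨v, fun h => absurd h hv⟩
  exact Classical.skolem.1 this

variable (A : Allocation (T.smallRoots δ) (fun r => (T.descendants r).card) n)
  (marked : Set (Fin n)) (small : Fin n → Fin n) (root : Fin n → ℕ)

/-- The marked ancestors of `v` in the subtree of `small v` as a bit string, or `0` if `v` is in no
small subtree. -/
noncomputable def pathMask (T : WeightedTree n) (δ : ℕ) (v : Fin n) : ℕ :=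
  if (T.descendants v).card ≤ δ then T.mask (T.descendants (small v)) (T.ancestors v ∩ marked)
  else 0

/-- The arrays that `lowerQuery` reads, apart from the tries with the handles `root`. -/
noncomputable def lowerTables (w : ℕ) : Memory w :=
  [table w fun x : Fin (2 ^ δ) => Nat.log2 x,
    A.array w fun r => T.nodeAt (T.descendants r),
    table w (pathMask marked small T δ),
    table w fun v => root (small v),
    table w fun v => A.base (small v)]

variable {A marked small root}

theorem hasValue_nodeAt_log2 (hp : Params δ B D n w) {s : State w} {o x : ℕ}
    (hs : s.mem.StoresAt o (lowerTables A marked small root w)) {v : Fin n} {ev ex : Expr}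
    (hr : small v ∈ T.smallRoots δ) (hev : HasValue s ev v) (hex : HasValue s ex x) (hx : x ≠ 0)
    (hlt : x < 2 ^ (T.descendants (small v)).card) :
    HasValue s (.load (o + 1) (.op .add (.load (o + 4) ev) (.load o ex)))
      (T.nodeAt (T.descendants (small v)) (Nat.log2 x)) := by
  have hn := hp.lt_word
  have hlog_lt := (Nat.log2_lt hx).2 hlt
  have hbase_le := A.base_add_len_le _ hr
  have hx_lt : x < 2 ^ δ :=
    hlt.trans_le (Nat.pow_le_pow_right two_pos (mem_smallRoots.1 hr).1)
  have hlog := hex.load_table (hs.array_eq 0 rfl) hx_lt (by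
    simp only
    lia)
  have hbase := hev.load_table (hs.array_eq 4 rfl) v.2
    (((Nat.le_add_right _ _).trans hbase_le).trans_lt hn)
  have haddr := hbase.add hlog (by
    simp only [Fin.eta]
    lia)
  exact HasValue.load_array (hs.array_eq 1 rfl) haddr hr hlog_lt ((nodeAt_lt _).trans hn)

theorem exists_isPredecessor_lowerQuery (hp : Params δ B D n w) {s : State w} {o d : ℕ}
    (hs : s.mem.StoresAt o (lowerTables A marked small root w)) {v : Fin n}
    {ev ed fallback : Expr} {ans : Option (Fin n)}
    (hsmall : (T.descendants v).card ≤ δ → small v ∈ T.smallRoots δ ∧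
      ∀ a ∈ T.ancestors v, (T.descendants a).card ≤ δ → small v ∈ T.ancestors a)
    (htrie : (T.descendants v).card ≤ δ →
      HasValue s (trieQuery (o + 5) D (.load (o + 3) ev) ed)
        (T.mask (T.descendants (small v)) {u | T.weight u < d + 1}))
    (hev : HasValue s ev v) (hfallback : HasValue s fallback (encodeAnswer ans))
    (hans : IsPredecessor {u ∈ T.ancestors v ∩ marked | δ < (T.descendants u).card}
      T.weight d ans) :
    ∃ ans, IsPredecessor (T.ancestors v ∩ marked) T.weight d ans ∧
      HasValue s (lowerQuery o D ev ed fallback) (encodeAnswer ans) := by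
  have hpow := hp.pow_le
  have hn := hp.lt_word
  have hone : HasValue s (.const 1) 1 := .const (by lia)
  have hmask (h : pathMask marked small T δ v < 2 ^ w) :
      HasValue s (.load (o + 2) ev) (pathMask marked small T δ v) :=
    hev.load_table (hs.array_eq 2 rfl) v.2 h
  by_cases hv : (T.descendants v).card ≤ δ
  swap
  · simp only [pathMask, hv, if_false] at hmask
    exact ⟨ans, hans.of_iff fun a => and_congr_left fun _ => and_iff_left_of_imp fun ha =>
      (not_le.1 hv).trans_le (card_descendants_le ha.1),
      (hmask (by lia)).ifLt hone (fun _ => hfallback) (by simp)⟩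
  obtain ⟨hr, habove⟩ := hsmall hv
  simp only [pathMask, hv, if_true] at hmask
  replace hmask := hmask (((mask_lt_of_mem_smallRoots hr).trans_le hpow).trans hn)
  have hits := hmask.and (htrie hv)
  rw [mask_and_mask] at hits
  by_cases hzero : T.mask (T.descendants (small v))
    (T.ancestors v ∩ marked ∩ {u | T.weight u < d + 1}) = 0
  · exact ⟨ans, isPredecessor_of_mask_eq_zero habove hzero hans,
      hmask.ifLt hone (fun _ => hfallback) fun _ =>
        hits.ifLt hone (fun _ => hfallback) fun h => absurd hzero (by lia)⟩
  obtain ⟨u, hu, hpred⟩ := exists_isPredecessor_of_mask_ne_zero hzero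
  have hnode := hasValue_nodeAt_log2 hp hs hr hev hits hzero mask_lt
  rw [hu] at hnode
  refine ⟨some u, hpred, hmask.ifLt hone (fun h => absurd ?_ hzero) fun _ =>
    hits.ifLt hone (fun h => absurd (Nat.lt_one_iff.1 h) hzero) fun _ => hnode⟩
  simp [← mask_and_mask, Nat.lt_one_iff.1 h]

theorem exists_memory_lowerQuery (hp : Params δ B D n w) (hB : δ ≤ B * B)
    (hw : ∀ v, T.weight v < 2 ^ w) (marked : Set (Fin n)) :
    ∃ m : Memory w, m.length = 8 + D * 7 ∧ m.size ≤ (D * 8 + 9) * n ∧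
      ∀ (s : State w) (o : ℕ), s.mem.StoresAt o m →
      ∀ (v : Fin n) (d : ℕ) (ev ed fallback : Expr) (ans : Option (Fin n)),
        HasValue s ev v → HasValue s ed d → HasValue s fallback (encodeAnswer ans) →
        IsPredecessor {u ∈ T.ancestors v ∩ marked | δ < (T.descendants u).card} T.weight d ans →
          ∃ ans, IsPredecessor (T.ancestors v ∩ marked) T.weight d ans ∧
            HasValue s (lowerQuery o D ev ed fallback) (encodeAnswer ans) := by
  obtain ⟨small, hsmall⟩ := exists_smallRoots_choice T δ
  obtain ⟨m, root, hlen, hsize, hroot, hquery⟩ :=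
    (isStepFamily_smallRoots hp hB hw).exists_memory hp
  obtain ⟨A⟩ := Allocation.exists_of_sum_le (sum_card_smallRoots_le (T := T) (δ := δ))
  refine ⟨lowerTables A marked small root w ++ m, by simp [lowerTables, hlen]; lia, ?_,
    fun s o hs v d ev ed fallback ans hev hed hfallback hans =>
      exists_isPredecessor_lowerQuery hp hs.left (hsmall v) (fun hv => ?_) hev hfallback hans⟩
  · have hpow := hp.pow_le
    rw [Memory.size_append]
    simp only [Memory.size, lowerTables, List.map_cons, length_table, Allocation.array,
      List.map_nil, List.sum_cons, List.sum_nil] at hsize ⊢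
    lia
  · have hr := (hsmall v hv).1
    exact hquery s (o + 5) hs.right _ hr d _ ed
      (hev.load_table (hs.left.array_eq 3 rfl) v.2 (hroot _ hr)) hed

/-- The search for trees with at most `δ` marked ancestors per node. -/
def sparseQuery (D o : ℕ) (ev ed : Expr) : Expr :=
  lowerQuery (o + (5 + D * 7)) D ev ed (upperQuery o D ev ed)

theorem exists_isSearchStructure_sparseQuery (hp : Params δ B D n w) (hB : δ + 1 ≤ B * B)
    (hw : ∀ v, T.weight v < 2 ^ w) (hm : ∀ v, (T.ancestors v ∩ marked).ncard ≤ δ) :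
    ∃ m : Memory w, m.length = 13 + D * 14 ∧ m.size ≤ (D * 16 + 15) * n ∧
      T.IsSearchStructure marked m (sparseQuery D) := by
  obtain ⟨m, hlen, hsize, hupper⟩ := exists_memory_upperQuery hp hB hw hm
  obtain ⟨m', hlen', hsize', hlower⟩ :=
    exists_memory_lowerQuery hp ((Nat.le_succ δ).trans hB) hw marked
  refine ⟨m ++ m', by simp [hlen, hlen']; lia, by rw [Memory.size_append]; lia,
    fun s o hs v d ev ed hev hed => ?_⟩
  obtain ⟨ans, hans, heval⟩ := hupper s o hs.left v d ev ed hev hed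
  exact hlower s _ (hlen ▸ hs.right) v d ev ed _ ans hev hed heval hans

end Lower

end WeightedTree

/-! ## Logarithmically many marked ancestors -/

namespace Fusion

theorem mul_lt_two_pow {k w : ℕ} (h : 2 * k + 4 ≤ w) : k * w < 2 ^ w := by
  induction w, h using Nat.le_induction with
  | base =>
    have htwice : 2 * k < 2 ^ (k + 2) := by
      have := @Nat.lt_two_pow_self k
      rw [pow_add]
      lia
    calc k * (2 * k + 4) = (2 * k) * (k + 2) := by ring
      _ < 2 ^ (k + 2) * 2 ^ (k + 2) :=
        Nat.mul_lt_mul'' htwice Nat.lt_two_pow_self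
      _ = 2 ^ (2 * k + 4) := by rw [← pow_add]; ring_nf
  | succ w hw ih =>
    have hkw : k < 2 ^ w := Nat.lt_two_pow_self.trans_le (Nat.pow_le_pow_right two_pos (by lia))
    rw [pow_succ, mul_add]
    lia

theorem sqrt_add_one_le_two_pow {δ : ℕ} (h : 400 ≤ δ) :
    Nat.sqrt δ + 1 ≤ 2 ^ (Nat.sqrt δ / 4) := by
  have linear_le : ∀ u ≥ 5, 4 * u + 4 ≤ 2 ^ u := fun u hu => by
    induction u, hu using Nat.le_induction with
    | base => norm_num
    | succ u hu ih =>
      rw [pow_succ]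
      lia
  have hsqrt : 20 ≤ Nat.sqrt δ := Nat.le_sqrt.2 (by lia)
  have := linear_le (Nat.sqrt δ / 4) (by lia)
  lia

theorem code_count_le {δ : ℕ} (h : 400 ≤ δ) :
    (Nat.sqrt δ + 1 + 1) * (δ + 1) ^ (Nat.sqrt δ + 1) ≤ 2 ^ δ := by
  have hsqrt : 20 ≤ Nat.sqrt δ := Nat.le_sqrt.2 (by lia)
  have hpow := sqrt_add_one_le_two_pow h
  set t := Nat.sqrt δ
  have ht : t * t ≤ δ := Nat.sqrt_le δ
  have hδ : δ + 1 ≤ 2 ^ (2 * (t / 4)) :=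
    calc δ + 1 ≤ (t + 1) * (t + 1) := Nat.lt_succ_sqrt δ
      _ ≤ 2 ^ (t / 4) * 2 ^ (t / 4) := Nat.mul_le_mul hpow hpow
      _ = 2 ^ (2 * (t / 4)) := by rw [← pow_add, two_mul]
  have hexp : 2 * (t / 4) * (t + 2) ≤ t * t := by
    have : 4 * (t / 4) ≤ t := Nat.mul_div_le t 4
    nlinarith
  calc (t + 1 + 1) * (δ + 1) ^ (t + 1) ≤ (δ + 1) * (δ + 1) ^ (t + 1) :=
        Nat.mul_le_mul_right _ (by nlinarith)
    _ = (δ + 1) ^ (t + 2) := (pow_succ' _ _).symm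
    _ ≤ (2 ^ (2 * (t / 4))) ^ (t + 2) := Nat.pow_le_pow_left hδ _
    _ = 2 ^ (2 * (t / 4) * (t + 2)) := (pow_mul _ _ _).symm
    _ ≤ 2 ^ δ := Nat.pow_le_pow_right two_pos (hexp.trans ht)

open WordRAM in
theorem exists_params {κ n w : ℕ} (hlog : LogWordSize κ n w) (hn : 0 < n)
    (hw : 3232 * κ + 8 ≤ w) :
    ∃ δ, Params δ (Nat.sqrt δ + 1) (16 * κ) n w ∧ 0 < δ ∧ Nat.log 2 n + 1 ≤ 16 * δ := by
  obtain ⟨hnw, hword⟩ := hlog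
  have hpow : 2 ^ Nat.log 2 n ≤ n := Nat.pow_log_le_self 2 hn.ne'
  have hlogw : Nat.log 2 n < w := (Nat.pow_lt_pow_iff_right one_lt_two).1 (hpow.trans_lt hnw)
  have hbig : 3200 ≤ Nat.log 2 n + 1 := by
    by_contra! hlt
    have := Nat.mul_le_mul_left κ hlt.le
    lia
  obtain ⟨δ, hδ⟩ : ∃ δ, δ = (Nat.log 2 n + 1) / 8 := ⟨_, rfl⟩
  have hwide : (16 * κ + 2) * w < 2 ^ w := mul_lt_two_pow (by lia)
  refine ⟨δ, ⟨code_count_le (by lia), ?_, hnw, ?_, ?_, ?_, Nat.succ_pos _⟩, by lia, by lia⟩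
  · exact (Nat.pow_le_pow_right two_pos (by lia)).trans hpow
  · calc w ≤ κ * (Nat.log 2 n + 1) := hword
      _ ≤ κ * (16 * δ) := Nat.mul_le_mul_left _ (by lia)
      _ = δ * (16 * κ) := by ring
  · rw [mul_comm]
    exact (Nat.mul_le_mul (Nat.le_add_right _ 2) (by lia)).trans_lt hwide
  · exact (Nat.le_mul_of_pos_right _ (by lia)).trans_lt hwide

end Fusion

namespace WeightedTree

open WordRAM Fusion

variable {n w : ℕ} {T : WeightedTree n} {marked : Set (Fin n)} {u v : Fin n} {d : ℕ}

/-- Walking up the tree, for at most the given number of steps. The arrays from `o` on hold the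
marks, the weights, the parents and the number `n`. -/
def walk (o : ℕ) : ℕ → Expr → Expr → Expr
  | 0, _, _ => .load (o + 3) (.const 0)
  | k + 1, ev, ed =>
    let next : Expr := .ifLt (.load (o + 1) (.load (o + 2) ev)) (.load (o + 1) ev)
      (walk o k (.load (o + 2) ev) ed) (.load (o + 3) (.const 0))
    .ifLt (.load o ev) (.const 1) next (.ifLt ed (.load (o + 1) ev) next ev)

open Classical in
/-- The arrays that `walk` reads. -/
noncomputable def walkArrays (w : ℕ) (T : WeightedTree n) (marked : Set (Fin n)) : Memory w :=
  [table w fun v => if v ∈ marked then 1 else 0, table w T.weight,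
    table w fun v => (T.parent v : ℕ), table w fun _ : Fin 1 => n]

theorem size_walkArrays : (walkArrays w T marked).size = 3 * n + 1 := by
  simp [walkArrays, Memory.size]
  ring

theorem isPredecessor_of_parent {ans : Option (Fin n)} (hv : v ∈ marked → d < T.weight v)
    (h : IsPredecessor (T.ancestors (T.parent v) ∩ marked) T.weight d ans) :
    IsPredecessor (T.ancestors v ∩ marked) T.weight d ans :=
  h.of_iff fun a => by
    rw [Set.mem_inter_iff, Set.mem_inter_iff, mem_ancestors_iff (v := v)]
    have : a = v → a ∈ marked → d < T.weight a := by rintro rfl; exact hv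
    grind

theorem exists_isPredecessor_walk (hnw : n < 2 ^ w) (hw : ∀ v, T.weight v < 2 ^ w) {s : State w}
    {o : ℕ} (hs : s.mem.StoresAt o (walkArrays w T marked)) {ed : Expr} (hed : HasValue s ed d)
    (k : ℕ) : ∀ (v : Fin n) (ev : Expr), T.weight v < k → HasValue s ev v →
      ∃ ans, IsPredecessor (T.ancestors v ∩ marked) T.weight d ans ∧
        HasValue s (walk o k ev ed) (encodeAnswer ans) := by
  have hnone : HasValue s (.load (o + 3) (.const 0)) n :=
    (HasValue.const (by lia)).load_table (hs.array_eq 3 rfl) one_pos hnw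
  have hweight {v : Fin n} {ev : Expr} (hev : HasValue s ev v) :
      HasValue s (.load (o + 1) ev) (T.weight v) :=
    hev.load_table (hs.array_eq 1 rfl) v.2 (hw v)
  induction k with
  | zero => exact fun v _ h => absurd h (Nat.not_lt_zero _)
  | succ k ih =>
    intro v ev hk hev
    have hone : HasValue s (.const 1) 1 := .const (by have := v.2; lia)
    have hmark := hev.load_table (hs.array_eq 0 rfl) v.2 (by
      have := v.2
      simp only [Fin.eta]
      split_ifs <;> lia)
    have hparent := hev.load_table (hs.array_eq 2 rfl) v.2 ((T.parent v).2.trans hnw)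
    by_cases hgood : v ∈ marked ∧ T.weight v ≤ d
    · refine ⟨some v, ⟨⟨mem_ancestors_self v, hgood.1⟩, hgood.2,
        fun j hj _ => weight_le_of_mem_ancestors hj.1⟩, ?_⟩
      exact hmark.ifLt hone (fun h => by simp [hgood.1] at h) fun _ =>
        hed.ifLt (hweight hev) (fun h => absurd hgood.2 h.not_ge) fun _ => hev
    suffices ∃ ans, IsPredecessor (T.ancestors v ∩ marked) T.weight d ans ∧
        HasValue s (.ifLt (.load (o + 1) (.load (o + 2) ev)) (.load (o + 1) ev)
          (walk o k (.load (o + 2) ev) ed) (.load (o + 3) (.const 0))) (encodeAnswer ans) by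
      obtain ⟨ans, hans, hnext⟩ := this
      exact ⟨ans, hans, hmark.ifLt hone (fun _ => hnext) fun hm =>
        hed.ifLt (hweight hev) (fun _ => hnext) fun hd =>
          absurd ⟨by by_contra h; simp [h] at hm, hd⟩ hgood⟩
    have hv : v ∈ marked → d < T.weight v := fun h => not_le.1 fun hd => hgood ⟨h, hd⟩
    rcases eq_or_ne v T.root with rfl | hroot
    · refine ⟨none, ?_,
        (hweight hparent).ifLt (hweight hev) (fun h => by simp [T.parent_root] at h) fun _ => hnone⟩
      rintro i ⟨hi, him⟩
      rw [ancestors_root, Set.mem_singleton_iff] at hi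
      exact hi ▸ hv (hi ▸ him)
    · have hlt := T.weight_parent_lt v hroot
      obtain ⟨ans, hans, hval⟩ := ih (T.parent v) _ (by lia) hparent
      exact ⟨ans, isPredecessor_of_parent hv hans,
        (hweight hparent).ifLt (hweight hev) (fun _ => hval) fun h => absurd hlt h.not_gt⟩

variable (T marked) in
/-- The number of marked ancestors. -/
noncomputable def markedDepth (v : Fin n) : ℕ := (T.ancestors v ∩ marked).ncard

theorem markedDepth_le (h : u ∈ T.ancestors v) : T.markedDepth marked u ≤ T.markedDepth marked v :=
  Set.ncard_le_ncard (fun _ ha => ⟨mem_ancestors_trans ha.1 h, ha.2⟩) (Set.toFinite _)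

theorem markedDepth_lt (h : u ∈ T.ancestors v) (hne : u ≠ v) (hv : v ∈ marked) :
    T.markedDepth marked u < T.markedDepth marked v :=
  Set.ncard_lt_ncard ⟨fun _ ha => ⟨mem_ancestors_trans ha.1 h, ha.2⟩, fun hsub =>
    (weight_lt_of_mem_ancestors h hne).not_ge
      (weight_le_of_mem_ancestors (hsub ⟨mem_ancestors_self v, hv⟩).1)⟩ (Set.toFinite _)

theorem markedDepth_injOn : Set.InjOn (T.markedDepth marked) (T.ancestors v ∩ marked) := by
  intro a ha b hb hab
  by_contra hne
  rcases mem_ancestors_total ha.1 hb.1 with h | h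
  exacts [(markedDepth_lt h hne hb.2).ne hab, (markedDepth_lt h (Ne.symm hne) ha.2).ne' hab]

theorem ncard_markedDepth_div_eq_le {δ : ℕ} (hδ : 0 < δ) (i : ℕ) (v : Fin n) :
    (T.ancestors v ∩ {u ∈ marked | T.markedDepth marked u / δ = i}).ncard ≤ δ := by
  have hinj : Set.InjOn (T.markedDepth marked)
      (T.ancestors v ∩ {u ∈ marked | T.markedDepth marked u / δ = i}) :=
    markedDepth_injOn.mono (Set.inter_subset_inter_right _ fun _ h => h.1)
  rw [← hinj.ncard_image]
  calc _ ≤ (Finset.Ico (i * δ) (i * δ + δ) : Set ℕ).ncard := by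
        refine Set.ncard_le_ncard ?_ (Finset.finite_toSet _)
        rintro _ ⟨u, ⟨-, -, rfl⟩, rfl⟩
        have := Nat.div_add_mod' (T.markedDepth marked u) δ
        have := Nat.mod_lt (T.markedDepth marked u) hδ
        simp only [Finset.coe_Ico, Set.mem_Ico]
        lia
    _ = δ := by rw [Set.ncard_coe_finset]; simp

/-- The last answer among the given number of searches; `fail` is the answer of a failing search. -/
def lastOf (fail : Expr) (f : ℕ → Expr) : ℕ → Expr
  | 0 => fail
  | i + 1 => .ifLt (f i) fail (f i) (lastOf fail f i)

theorem exists_isPredecessor_lastOf {s : State w} {fail : Expr} {f : ℕ → Expr}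
    (hfail : HasValue s fail n) {level : Fin n → ℕ}
    (hlevel : ∀ a b, a ∈ T.ancestors b → level a ≤ level b) {q : ℕ}
    (hf : ∀ i < q, ∃ ans, IsPredecessor (T.ancestors v ∩ {u ∈ marked | level u = i}) T.weight d ans
      ∧ HasValue s (f i) (encodeAnswer ans)) :
    ∃ ans, IsPredecessor (T.ancestors v ∩ {u ∈ marked | level u < q}) T.weight d ans ∧
      HasValue s (lastOf fail f q) (encodeAnswer ans) := by
  induction q with
  | zero => exact ⟨none, fun i hi => absurd hi.2.2 (Nat.not_lt_zero _), hfail⟩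
  | succ q ih =>
    obtain ⟨ans, hans, hval⟩ := ih fun i hi => hf i (by lia)
    obtain ⟨top, htop, htopval⟩ := hf q (by lia)
    cases top with
    | none =>
      refine ⟨ans, hans.of_iff fun a => ?_,
        htopval.ifLt hfail (fun h => absurd h (lt_irrefl n)) fun _ => hval⟩
      have := htop a
      simp only [Set.mem_inter_iff, Set.mem_ofPred_eq] at this ⊢
      grind
    | some u =>
      obtain ⟨⟨hu, hum, hq⟩, hud, hmax⟩ := htop
      refine ⟨some u, ⟨⟨hu, hum, by lia⟩, hud, fun a ha had => ?_⟩,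
        htopval.ifLt hfail (fun _ => htopval) fun h => absurd u.2 (not_lt.2 h)⟩
      by_contra! hlt
      have hle := hlevel u a (mem_ancestors_of_weight_le hu ha.1 hlt.le)
      have := ha.2.2
      exact (hmax a ⟨ha.1, ha.2.1, by lia⟩ had).not_gt hlt

/-- The search among logarithmically many marked ancestors. The array `o` tells whether words are
short, so that it suffices to walk up the tree, or the answer is to be found among the answers for
`q` classes of marked nodes. -/
def ancestorQuery (W q D o : ℕ) (ev ed : Expr) : Expr :=
  .ifLt (.load o (.const 0)) (.const 1) (walk (o + 1) (2 ^ W) ev ed)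
    (lastOf (.load (o + 4) (.const 0))
      (fun i => sparseQuery D (o + 5 + i * (13 + D * 14)) ev ed) q)

/-- The data structure for `ancestorQuery`, up to the part that depends on the word size. -/
noncomputable def ancestorArrays (w : ℕ) (T : WeightedTree n) (marked : Set (Fin n)) (flag : ℕ) :
    Memory w :=
  (table w fun _ : Fin 1 => flag) :: walkArrays w T marked

theorem size_ancestorArrays (flag : ℕ) :
    (ancestorArrays w T marked flag).size = 3 * n + 2 := by
  have := size_walkArrays (w := w) (T := T) (marked := marked)
  simp only [ancestorArrays, Memory.size, List.map_cons, length_table, List.sum_cons] at this ⊢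
  lia

theorem isSearchStructure_of_short_words (hnw : n < 2 ^ w) (hw : ∀ v, T.weight v < 2 ^ w)
    {W : ℕ} (hW : w ≤ W) (q D : ℕ) (m : Memory w) :
    T.IsSearchStructure marked (ancestorArrays w T marked 0 ++ m) (ancestorQuery W q D) := by
  intro s o hs v d ev ed hev hed
  have hflag := (HasValue.const (by lia)).load_table (hs.left.array_eq 0 rfl) one_pos (by simp)
  obtain ⟨ans, hans, hval⟩ := exists_isPredecessor_walk hnw hw
    (hs.left.right (l₁ := [table w fun _ : Fin 1 => 0])) hed (2 ^ W) v ev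
    ((hw v).trans_le (Nat.pow_le_pow_right two_pos hW)) hev
  exact ⟨ans, hans, hflag.ifLt (.const (by have := v.2; lia)) (fun _ => hval)
    fun h => absurd h (by simp)⟩

theorem isSearchStructure_of_classes (hnw : n < 2 ^ w) {level : Fin n → ℕ}
    (hlevel : ∀ a b, a ∈ T.ancestors b → level a ≤ level b) (W D : ℕ) {q : ℕ}
    (hq : ∀ v, level v < q) {m : ℕ → Memory w} (hlen : ∀ i, (m i).length = 13 + D * 14)
    (hm : ∀ i, T.IsSearchStructure {u ∈ marked | level u = i} (m i) (sparseQuery D)) :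
    T.IsSearchStructure marked
      (ancestorArrays w T marked 1 ++ ((List.range q).map m).flatten) (ancestorQuery W q D) := by
  intro s o hs v d ev ed hev hed
  have hzero : HasValue s (.const 0) 0 := .const (by lia)
  have hflag := hzero.load_table (hs.left.array_eq 0 rfl) one_pos (by have := v.2; lia)
  have hnone := hzero.load_table (hs.left.array_eq 4 rfl) one_pos hnw
  obtain ⟨ans, hans, hval⟩ := exists_isPredecessor_lastOf (v := v) (d := d) hnone hlevel (q := q)
    (f := fun i => sparseQuery D (o + 5 + i * (13 + D * 14)) ev ed) fun i hi =>
      hm i s _ (hs.right.flatten (by simp [hlen]) (by simp [hi])) v d ev ed hev hed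
  simp only [hq, and_true, Set.ofPred_mem_eq] at hans
  exact ⟨ans, hans, hflag.ifLt (.const (by have := v.2; lia)) (fun h => absurd h (by simp))
    fun _ => hval⟩

theorem exists_isSearchStructure (κ C : ℕ) :
    ∃ (A c : ℕ) (query : ℕ → Expr → Expr → Expr), ∀ (n w : ℕ) (T : WeightedTree n)
      (marked : Set (Fin n)), LogWordSize κ n w → (∀ v, T.weight v < 2 ^ w) →
      (∀ v, (T.ancestors v ∩ marked).ncard ≤ C * (Nat.log 2 n + 1)) →
      ∃ m : Memory w, m.length = A ∧ m.size ≤ c * n ∧ T.IsSearchStructure marked m query := by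
  obtain ⟨D, hD⟩ : ∃ D, D = 16 * κ := ⟨_, rfl⟩
  obtain ⟨q, hq⟩ : ∃ q, q = 16 * C + 1 := ⟨_, rfl⟩
  refine ⟨5 + q * (13 + D * 14), 5 + q * (D * 16 + 15), ancestorQuery (3232 * κ + 8) q D,
    fun n w T marked hlog hw hm => ?_⟩
  have hn : 0 < n := T.root.pos
  rcases le_total w (3232 * κ + 8) with hsmall | hlarge
  · refine ⟨ancestorArrays w T marked 0 ++ List.replicate (q * (13 + D * 14)) [],
      by simp [ancestorArrays, walkArrays]; lia, ?_,
      isSearchStructure_of_short_words hlog.1 hw hsmall q D _⟩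
    rw [Memory.size_append, size_ancestorArrays, add_mul]
    simp only [Memory.size, List.map_replicate, List.length_nil, List.sum_replicate, smul_zero]
    lia
  · obtain ⟨δ, hp, hδ, hlogδ⟩ := exists_params hlog hn hlarge
    rw [← hD] at hp
    have hlevel v : T.markedDepth marked v / δ < q := by
      rw [Nat.div_lt_iff_lt_mul hδ, hq]
      have := (hm v).trans (Nat.mul_le_mul_left C hlogδ)
      simp only [markedDepth]
      lia
    choose m hlen hsize hsearch using fun i => exists_isSearchStructure_sparseQuery hp
      (Nat.lt_succ_sqrt δ) hw (ncard_markedDepth_div_eq_le (T := T) (marked := marked) hδ i)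
    refine ⟨ancestorArrays w T marked 1 ++ ((List.range q).map m).flatten,
      by simp [ancestorArrays, walkArrays, List.length_flatten, Function.comp_def, hlen]; lia, ?_,
      isSearchStructure_of_classes hlog.1 (fun a b h => Nat.div_le_div_right (markedDepth_le h))
        _ D hlevel hlen hsearch⟩
    have hclasses := Memory.size_flatten_le (l := (List.range q).map m)
      (c := (D * 16 + 15) * n) (List.forall_mem_map.2 fun i _ => hsize i)
    rw [Memory.size_append, size_ancestorArrays, add_mul, mul_assoc]
    simp only [List.length_map, List.length_range] at hclasses
    lia

end WeightedTree

/-! ## Packing many memories into one -/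

namespace WordRAM

variable {w : ℕ}

/-- The content of the cell with index `p.2` in the array `p.1`. -/
def Memory.cell (m : Memory w) (p : ℕ × ℕ) : Option (BitVec w) := (m.array p.1)[p.2]?

theorem Memory.isSome_cell {m : Memory w} {p : ℕ × ℕ} :
    (m.cell p).isSome ↔ p.2 < (m.array p.1).length := by
  simp [cell]

theorem Memory.ext_cell {m m' : Memory w} (hlen : m.length = m'.length)
    (h : ∀ p, m.cell p = m'.cell p) : m = m' := by
  refine List.ext_getElem hlen fun q hq hq' => List.ext_getElem? fun i => ?_
  simpa [cell, Memory.array, hq, hq'] using h (q, i)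

theorem Memory.length_array_le (m : Memory w) (seg : ℕ) : (m.array seg).length ≤ m.size := by
  by_cases h : seg < m.length
  · simp only [Memory.array, List.getD_eq_getElem?_getD, h, List.getElem?_eq_getElem,
      Option.getD_some, Memory.size]
    exact List.single_le_sum (by simp) _ (List.mem_map_of_mem (List.getElem_mem h))
  · simp [Memory.array, List.getD_eq_getElem?_getD, List.getElem?_eq_none (not_lt.1 h)]

theorem State.cell_setCell (s : State w) (seg i : ℕ) (y : BitVec w) (p : ℕ × ℕ) :
    (s.setCell seg i y).mem.cell p =
      if p = (seg, i) then (s.mem.cell p).map fun _ => y else s.mem.cell p := by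
  obtain ⟨q, j⟩ := p
  simp only [setCell, Memory.cell, Memory.array, List.getD_eq_getElem?_getD, List.getElem?_set,
    Prod.mk.injEq]
  grind

/-- A number above all registers that occur in a test. -/
def Test.bound : Test → ℕ
  | .eq a b => max a b + 1
  | .lt a b => max a b + 1

/-- A number above all registers and arrays that occur in a program. -/
def Prog.bound : Prog → ℕ
  | .skip => 0
  | .const r _ => r + 1
  | .copy r a => max r a + 1
  | .op _ r a b => max r (max a b) + 1
  | .load r seg a => max r (max seg a) + 1
  | .store seg a r => max r (max seg a) + 1
  | .seq p q => max p.bound q.bound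
  | .ite b p q => max b.bound (max p.bound q.bound)
  | .loop b p => max b.bound p.bound

/-- Access to a cell of an array that is cut into `k` pieces: register `R` holds the length of a
piece, register `R + 1` the position of the pieces in the arrays `a, a + 1, …`, and register `R + 2`
the index of the cell. -/
def bank (R : ℕ) (access : ℕ → Prog) (a : ℕ) : ℕ → Prog
  | 0 => .skip
  | k + 1 => .ite (.lt (R + 2) R) (.seq (.op .add (R + 2) (R + 2) (R + 1)) (access a))
      (.seq (.op .sub (R + 2) (R + 2) R) (bank R access (a + 1) k))

/-- The program that runs `p`, in which only names below `R` occur, on a memory whose arrays are cut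
into `k` pieces each. Piece `j` of the array `seg` is a part of the array `A + (seg * k + j)`.
With pieces, a space bound `k * n` does not need `k * n < 2 ^ w`, only `n < 2 ^ w`. -/
def Prog.pack (R A k : ℕ) : Prog → Prog
  | .load r seg a =>
    .seq (.copy (R + 2) a) (bank R (fun b => .load r b (R + 2)) (A + seg * k) k)
  | .store seg a r =>
    .seq (.copy (R + 2) a) (bank R (fun b => .store b (R + 2) r) (A + seg * k) k)
  | .seq p q => .seq (p.pack R A k) (q.pack R A k)
  | .ite b p q => .ite b (p.pack R A k) (q.pack R A k)
  | .loop b p => .loop b (p.pack R A k)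
  | .skip => .skip
  | .const r c => .const r c
  | .copy r a => .copy r a
  | .op o r a b => .op o r a b

theorem runs_bank {R len base : ℕ} {access : ℕ → Prog} (hfit : base + len < 2 ^ w) {t : ℕ}
    {Q : State w → Prop} (k : ℕ) : ∀ {a x : ℕ} {s : State w}, x < k * len →
      (s.regs R).toNat = len → (s.regs (R + 1)).toNat = base → (s.regs (R + 2)).toNat = x →
      (∀ s', s.EqBelow (R + 2) s' → (s'.regs (R + 2)).toNat = base + x % len →
        Runs (access (a + x / len)) s' t Q) →
      Runs (bank R access a k) s (2 * k + t) Q := by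
  induction k with
  | zero => intro a x s hx; lia
  | succ k ih =>
    intro a x s hx hlen hbase hindex haccess
    have hpos : 0 < len := Nat.pos_of_ne_zero fun h => by simp [h] at hx
    have test : (Test.lt (R + 2) R).holds s ↔ x < len := by
      simp [Test.holds, BitVec.lt_def, hlen, hindex]
    rcases lt_or_ge x len with hlt | hge
    · have hacc := haccess (s.setReg (R + 2) (s.regs (R + 2) + s.regs (R + 1)))
        (s.eqBelow_setReg _ le_rfl) (by
          rw [State.regs_setReg_self, BitVec.toNat_add, hbase, hindex, Nat.mod_eq_of_lt hlt,
            Nat.mod_eq_of_lt (by lia), add_comm])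
      rw [Nat.div_eq_of_lt hlt, add_zero] at hacc
      exact (Runs.ite_true (test.2 hlt) (.op_seq hacc)).mono_time (by lia)
    · have hdiff : (s.regs (R + 2) - s.regs R).toNat = x - len := by
        rw [BitVec.toNat_sub_of_le (by rw [BitVec.le_def]; lia), hlen, hindex]
      set s₁ := s.setReg (R + 2) (s.regs (R + 2) - s.regs R) with hs₁
      have keep : s.EqBelow (R + 2) s₁ := s.eqBelow_setReg _ le_rfl
      have hrest : Runs (bank R access (a + 1) k) s₁ (2 * k + t) Q := by
        refine ih (x := x - len) (by rw [Nat.succ_mul] at hx; lia) ?_ ?_ ?_ fun s' h h' => ?_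
        · rw [keep.2 R (by lia), hlen]
        · rw [keep.2 (R + 1) (by lia), hbase]
        · rw [hs₁, State.regs_setReg_self, hdiff]
        · rw [add_assoc, add_comm 1, ← Nat.div_eq_sub_div hpos hge]
          exact haccess s' (keep.trans h) (by rw [h', ← Nat.mod_eq_sub_mod hge])
      exact (Runs.ite_false (mt test.1 hge.not_gt) (.op_seq hrest)).mono_time (by lia)

/-- The place of a memory inside a larger one: each of its arrays is cut into `pieces` pieces of the
length `len`, which stand at the position `base` in consecutive arrays from `first` on. -/
structure Block where
  first : ℕ
  pieces : ℕ
  len : ℕ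
  base : ℕ

namespace Block

/-- The cell of the larger memory that stands for the cell `p`. -/
def place (B : Block) (p : ℕ × ℕ) : ℕ × ℕ :=
  (B.first + (p.1 * B.pieces + p.2 / B.len), B.base + p.2 % B.len)

/-- `B.Holds R m M`: the arrays of `m` below `R` fit into the block `B` of the memory `M` and are
stored there. -/
def Holds (B : Block) (R : ℕ) (m M : Memory w) : Prop :=
  ∀ p : ℕ × ℕ, p.1 < R → (m.cell p).isSome →
    p.2 < B.pieces * B.len ∧ M.cell (B.place p) = m.cell p

/-- The state `st` of a machine with the initial memory `M₀` represents the state `s` of a machine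
whose memory is stored in the block `B`. -/
structure Represents (B : Block) (R : ℕ) (M₀ : Memory w) (st s : State w) : Prop where
  regs : ∀ r < R, st.regs r = s.regs r
  regs_len : (st.regs R).toNat = B.len
  regs_base : (st.regs (R + 1)).toNat = B.base
  holds : B.Holds R s.mem st.mem
  length_mem : st.mem.length = M₀.length
  cell_of_ne : ∀ q, (∀ p : ℕ × ℕ, p.1 < R → (s.mem.cell p).isSome → B.place p ≠ q) →
    st.mem.cell q = M₀.cell q

variable {B : Block} {R t : ℕ} {M₀ : Memory w} {st st' s s' : State w}

theorem place_injOn : Set.InjOn B.place {p | p.2 < B.pieces * B.len} := by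
  rintro ⟨q, i⟩ hi ⟨q', i'⟩ hi' h
  simp only [place, Prod.mk.injEq, add_right_inj] at h
  have hpos : 0 < B.len := Nat.pos_of_ne_zero fun h => by simp [h] at hi
  have hdiv := (Nat.div_lt_iff_lt_mul hpos).2 hi
  have hdiv' := (Nat.div_lt_iff_lt_mul hpos).2 hi'
  have hq := congrArg (· / B.pieces) h.1
  have hr := congrArg (· % B.pieces) h.1
  simp only [Fusion.mul_add_div_of_lt hdiv, Fusion.mul_add_div_of_lt hdiv',
    Nat.mul_add_mod_of_lt hdiv, Nat.mul_add_mod_of_lt hdiv'] at hq hr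
  rw [Prod.mk.injEq, ← Nat.div_add_mod i B.len, ← Nat.div_add_mod i' B.len, hr, h.2]
  exact ⟨hq, rfl⟩

namespace Represents

theorem mem_eq (h : B.Represents R M₀ st s) (h₀ : B.Holds R s.mem M₀) : st.mem = M₀ := by
  refine Memory.ext_cell h.length_mem fun q => ?_
  by_cases hq : ∀ p : ℕ × ℕ, p.1 < R → (s.mem.cell p).isSome → B.place p ≠ q
  · exact h.cell_of_ne q hq
  · push Not at hq
    obtain ⟨p, hp, hs, rfl⟩ := hq
    rw [(h.holds p hp hs).2, (h₀ p hp hs).2]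

theorem of_eqBelow (h : B.Represents R M₀ st s) (heq : st.EqBelow (R + 2) st') :
    B.Represents R M₀ st' s where
  regs r hr := by rw [heq.2 r (by lia), h.regs r hr]
  regs_len := by rw [heq.2 R (by lia), h.regs_len]
  regs_base := by rw [heq.2 (R + 1) (by lia), h.regs_base]
  holds := heq.1 ▸ h.holds
  length_mem := heq.1 ▸ h.length_mem
  cell_of_ne := heq.1 ▸ h.cell_of_ne

theorem setReg (h : B.Represents R M₀ st s) {r : ℕ} (hr : r < R) (x : BitVec w) :
    B.Represents R M₀ (st.setReg r x) (s.setReg r x) where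
  regs r' hr' := by
    by_cases h' : r' = r
    · simp [h']
    · simpa [State.setReg, h'] using h.regs r' hr'
  regs_len := by simpa [State.setReg, hr.ne'] using h.regs_len
  regs_base := by simpa [State.setReg, show R + 1 ≠ r by lia] using h.regs_base
  holds := h.holds
  length_mem := h.length_mem
  cell_of_ne := h.cell_of_ne

theorem setCell (h : B.Represents R M₀ st s) {p : ℕ × ℕ} (hp : p.1 < R)
    (hs : (s.mem.cell p).isSome) (y : BitVec w) :
    B.Represents R M₀ (st.setCell (B.place p).1 (B.place p).2 y) (s.setCell p.1 p.2 y) where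
  regs := h.regs
  regs_len := h.regs_len
  regs_base := h.regs_base
  holds p' hp' hs' := by
    have hsome : (s.mem.cell p').isSome := by
      rw [State.cell_setCell] at hs'
      split_ifs at hs' <;> simpa using hs'
    obtain ⟨hfit, hcell⟩ := h.holds p' hp' hsome
    refine ⟨hfit, ?_⟩
    simp only [State.cell_setCell, Prod.mk.eta, place_injOn.eq_iff hfit (h.holds p hp hs).1, hcell]
  length_mem := by simpa [State.setCell] using h.length_mem
  cell_of_ne q hq := by
    have hkeep : ∀ p' : ℕ × ℕ, p'.1 < R → (s.mem.cell p').isSome → B.place p' ≠ q :=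
      fun p' hp' hs' => hq p' hp' (by rw [State.cell_setCell]; split_ifs <;> simpa using hs')
    rw [State.cell_setCell, if_neg (hkeep p hp hs).symm, h.cell_of_ne q hkeep]

theorem holds_test_iff (h : B.Represents R M₀ st s) {b : Test} (hb : b.bound ≤ R) :
    b.holds st ↔ b.holds s := by
  cases b with simp only [Test.bound] at hb
  | eq a b => simp only [Test.holds, h.regs a (by lia), h.regs b (by lia)]
  | lt a b => simp only [Test.holds, h.regs a (by lia), h.regs b (by lia)]

theorem runs_access (h : B.Represents R M₀ st s) (hfit : B.base + B.len < 2 ^ w) {seg a : ℕ}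
    (ha : a < R) (hseg : seg < R) (hs : (s.mem.cell (seg, (s.regs a).toNat)).isSome)
    {access : ℕ → Prog} {Q : State w → Prop}
    (haccess : ∀ st', B.Represents R M₀ st' s →
      (st'.regs (R + 2)).toNat = (B.place (seg, (s.regs a).toNat)).2 →
      Runs (access (B.place (seg, (s.regs a).toNat)).1) st' 1 Q) :
    Runs (.seq (.copy (R + 2) a) (bank R access (B.first + seg * B.pieces) B.pieces)) st
      (2 * B.pieces + 2) Q := by
  have h₁ := h.of_eqBelow (st.eqBelow_setReg (st.regs a) le_rfl)
  refine (Runs.copy_seq (runs_bank hfit (t := 1) _ (h.holds _ hseg hs).1 h₁.regs_len h₁.regs_base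
    (by rw [State.regs_setReg_self, h.regs a ha]) fun st' h' hindex => ?_)).mono_time
    (by lia)
  rw [add_assoc]
  exact haccess st' (h₁.of_eqBelow h') hindex

theorem runs_pack_load (h : B.Represents R M₀ st s) (hfit : B.base + B.len < 2 ^ w)
    {r seg a : ℕ} (hr : r < R) (hseg : seg < R) (ha : a < R) {x : BitVec w}
    (hx : s.mem.cell (seg, (s.regs a).toNat) = some x) :
    Runs (Prog.pack R B.first B.pieces (.load r seg a)) st (2 * B.pieces + 2)
      (B.Represents R M₀ · (s.setReg r x)) := by
  have hs := Option.isSome_of_eq_some hx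
  refine h.runs_access hfit ha hseg hs fun st' h' hindex => .load _ _ _ ?_ (h'.setReg hr x)
  rw [hindex]
  exact (h'.holds _ hseg hs).2.trans hx

theorem runs_pack_store (h : B.Represents R M₀ st s) (hfit : B.base + B.len < 2 ^ w)
    {r seg a : ℕ} (hr : r < R) (hseg : seg < R) (ha : a < R)
    (hs : (s.mem.cell (seg, (s.regs a).toNat)).isSome) :
    Runs (Prog.pack R B.first B.pieces (.store seg a r)) st (2 * B.pieces + 2)
      (B.Represents R M₀ · (s.setCell seg (s.regs a).toNat (s.regs r))) := by
  refine h.runs_access hfit ha hseg hs fun st' h' hindex => .store _ _ _ ?_ ?_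
  · rw [hindex]
    exact Memory.isSome_cell.1 ((h'.holds _ hseg hs).2 ▸ hs)
  · rw [hindex, h'.regs r hr]
    exact h'.setCell hseg hs _

theorem runs_pack {p : Prog} (he : Exec p s s' t) (hfit : B.base + B.len < 2 ^ w)
    (hp : p.bound ≤ R) (h : B.Represents R M₀ st s) :
    Runs (p.pack R B.first B.pieces) st ((2 * B.pieces + 2) * t) (B.Represents R M₀ · s') := by
  induction he generalizing st with simp only [Prog.bound, max_le_iff] at hp
  | skip s => exact ⟨st, 0, .skip st, by simp, h⟩
  | const s r x =>
    rw [Prog.pack]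
    exact .mono_time (.const r x (h.setReg hp _)) (by lia)
  | copy s r a =>
    rw [Prog.pack]
    refine .mono_time (.copy r a ?_) (by lia)
    rw [h.regs a (by lia)]
    exact h.setReg (by lia) _
  | op s o r a b =>
    rw [Prog.pack]
    refine .mono_time (.op o r a b ?_) (by lia)
    rw [h.regs a (by lia), h.regs b (by lia)]
    exact h.setReg (by lia) _
  | load _ _ _ _ _ hx =>
    exact (mul_one (2 * B.pieces + 2)).symm ▸
      h.runs_pack_load hfit (by lia) (by lia) (by lia) hx
  | store _ _ _ _ hx =>
    exact (mul_one (2 * B.pieces + 2)).symm ▸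
      h.runs_pack_store hfit (by lia) (by lia) (by lia) (Memory.isSome_cell.2 hx)
  | seq _ _ _ _ _ _ _ _ _ ih₁ ih₂ =>
    rw [mul_add]
    exact (ih₁ hp.1 h).seq fun _ h' => ih₂ hp.2 h'
  | ite_true _ _ _ _ _ _ hb _ ih =>
    rw [Prog.pack, mul_add]
    exact (Runs.ite_true ((h.holds_test_iff hp.1).2 hb) (ih hp.2.1 h)).mono_time (by lia)
  | ite_false _ _ _ _ _ _ hb _ ih =>
    rw [Prog.pack, mul_add]
    exact (Runs.ite_false (mt (h.holds_test_iff hp.1).1 hb) (ih hp.2.2 h)).mono_time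
      (by lia)
  | loop_true _ _ _ _ _ _ _ hb _ _ ih₁ ih₂ =>
    rw [Prog.pack, mul_add, mul_add]
    exact (Runs.loop_true ((h.holds_test_iff hp.1).2 hb) (ih₁ hp.2 h) fun _ h' =>
      ih₂ (max_le hp.1 hp.2) h').mono_time (by lia)
  | loop_false _ _ _ hb =>
    rw [Prog.pack]
    exact (Runs.loop_false (mt (h.holds_test_iff hp.1).1 hb) h).mono_time (by lia)

end Represents

theorem runs_pack_of_answers {q : Prog} {m : Memory w} {d : BitVec w} {out : ℕ}
    (hans : Answers q m [d] t out) (hq : q.bound ≤ R) (hR : 0 < R)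
    (hfit : B.base + B.len < 2 ^ w) (hm : B.Holds R m st.mem) (hd : st.regs 0 = d)
    (hzero : ∀ r, 0 < r → r < R → st.regs r = 0) (hlen : (st.regs R).toNat = B.len)
    (hbase : (st.regs (R + 1)).toNat = B.base) :
    Runs (q.pack R B.first B.pieces) st ((2 * B.pieces + 2) * t) fun st' =>
      st'.mem = st.mem ∧ (st'.regs 0).toNat = out ∧ (st'.regs (R + 1)).toNat = B.base := by
  obtain ⟨s', k, exec, hk, rfl, rfl⟩ := hans
  have start : B.Represents R st.mem st (queryState s'.mem [d]) :=
    { regs := fun r hr => by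
        cases r with
        | zero => simpa [queryState] using hd
        | succ r => simpa [queryState] using hzero _ r.succ_pos hr
      regs_len := hlen
      regs_base := hbase
      holds := hm
      length_mem := rfl
      cell_of_ne := fun _ _ => rfl }
  exact (Represents.runs_pack exec hfit hq start).mono (Nat.mul_le_mul_left _ hk) fun st' h =>
    ⟨h.mem_eq hm, congrArg BitVec.toNat (h.regs 0 hR), h.regs_base⟩

end Block

section packed

variable {ι : Type*} {S : Finset ι} {len : ι → ℕ} {N : ℕ}

theorem Allocation.getElem?_array (A : Allocation S len N) (f : ι → ℕ → ℕ) {c : ι} (hc : c ∈ S)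
    {i : ℕ} (hi : i < len c) : (A.array w f)[A.base c + i]? = some (BitVec.ofNat w (f c i)) := by
  have hlt : A.base c + i < N := (Nat.add_lt_add_left hi _).trans_le (A.base_add_len_le c hc)
  simp [Allocation.array, table, hlt, A.contents_base_add f hc hi]

/-- The first `R` arrays of the memories `loc c`, cut into `k` pieces each and packed into arrays of
length `N`, with the pieces of `loc c` at the block of `c`. -/
def packed (R k : ℕ) (A : Allocation S len N) (loc : ι → Memory w) : Memory w :=
  (List.range (R * k)).map fun q =>
    A.array w fun c i => (((loc c).cell (q / k, q % k * len c + i)).getD 0).toNat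

theorem size_packed (R k : ℕ) (A : Allocation S len N) (loc : ι → Memory w) :
    (packed R k A loc).size = R * k * N := by
  simp [packed, Memory.size, Allocation.array, Function.comp_def]

theorem Block.holds_of_storesAt_packed {R k o : ℕ} {A : Allocation S len N} {loc : ι → Memory w}
    {M : Memory w} (hM : M.StoresAt o (packed R k A loc)) {c : ι} (hc : c ∈ S)
    (hlen : ∀ seg, ((loc c).array seg).length ≤ k * len c) :
    (⟨o, k, len c, A.base c⟩ : Block).Holds R (loc c) M := by
  rintro ⟨seg, x⟩ hseg hs
  have hx : x < k * len c := (Memory.isSome_cell.1 hs).trans_le (hlen seg)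
  have hpos : 0 < len c := Nat.pos_of_ne_zero fun h => by simp [h] at hx
  have hpiece : x / len c < k := (Nat.div_lt_iff_lt_mul hpos).2 hx
  refine ⟨hx, ?_⟩
  obtain ⟨y, hy⟩ := Option.isSome_iff_exists.1 hs
  have harray := hM.array_eq (seg * k + x / len c) (by
    rw [packed, List.getElem?_map, List.getElem?_range (Fusion.mul_add_lt hseg hpiece)]
    rfl)
  change (M.array (o + (seg * k + x / len c)))[A.base c + x % len c]? = _
  rw [harray, A.getElem?_array _ hc (Nat.mod_lt x hpos), Fusion.mul_add_div_of_lt hpiece,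
    Nat.mul_add_mod_of_lt hpiece, Nat.div_add_mod', hy]
  simp

end packed

end WordRAM

/-! ## Path decomposition -/

namespace WeightedTree

variable {n : ℕ} {T : WeightedTree n} {a b c u v : Fin n} {d : ℕ}

theorem parent_mem_ancestors (h : a ∈ T.ancestors v) : T.parent a ∈ T.ancestors v :=
  mem_ancestors_trans (mem_ancestors_iff.2 (.inr (mem_ancestors_self _))) h

variable (T) in
/-- The tree in which a node other than the root carries the weight of its parent plus one. In this
tree `v` has weight at most `d + 1` if and only if its parent has weight at most `d` in `T`. -/
def shifted : WeightedTree n where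
  root := T.root
  parent := T.parent
  parent_root := T.parent_root
  reaches_root := T.reaches_root
  weight v := if v = T.root then 0 else T.weight (T.parent v) + 1
  weight_parent_lt v hv := by
    rw [if_neg hv]
    split_ifs with h
    · exact Nat.succ_pos _
    · exact Nat.succ_lt_succ (T.weight_parent_lt _ h)

theorem shifted_weight_of_ne (h : v ≠ T.root) :
    T.shifted.weight v = T.weight (T.parent v) + 1 :=
  if_neg h

theorem shifted_weight_le (v : Fin n) : T.shifted.weight v ≤ T.weight v := by
  rcases eq_or_ne v T.root with rfl | hv
  · exact (if_pos rfl).trans_le (Nat.zero_le _)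
  · exact (shifted_weight_of_ne hv).trans_le (T.weight_parent_lt v hv)

theorem exists_lt_weight_shifted_weight_le (h : d < T.weight v) :
    ∃ j ∈ T.ancestors v, d < T.weight j ∧ T.shifted.weight j ≤ d + 1 := by
  obtain ⟨j, ⟨hjv, hdj⟩, hmin⟩ := Set.exists_min_image {x ∈ T.ancestors v | d < T.weight x}
    T.weight (Set.toFinite _) ⟨v, mem_ancestors_self v, h⟩
  refine ⟨j, hjv, hdj, ?_⟩
  rcases eq_or_ne j T.root with rfl | hj
  · exact (if_pos rfl).trans_le (Nat.zero_le _)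
  · rw [shifted_weight_of_ne hj]
    by_contra! hd
    exact (hmin _ ⟨parent_mem_ancestors hjv, by lia⟩).not_gt (T.weight_parent_lt j hj)

variable (T) in
/-- The logarithm of the size of the subtree of `v`. The nodes of one size class form vertical
paths. -/
noncomputable def sizeClass (v : Fin n) : ℕ := Nat.log 2 (T.descendants v).card

variable (T) in
/-- The uppermost nodes of the paths into which the size classes split the tree. -/
def heads : Set (Fin n) := {v | v = T.root ∨ T.sizeClass v ≠ T.sizeClass (T.parent v)}

variable (T) in
open Classical in
/-- The descendants of `c` in the size class of `c`; a path of the decomposition if `c` is one of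
the `heads`. -/
noncomputable def path (c : Fin n) : Finset (Fin n) :=
  {u | c ∈ T.ancestors u ∧ T.sizeClass u = T.sizeClass c}

theorem mem_path : u ∈ T.path c ↔ c ∈ T.ancestors u ∧ T.sizeClass u = T.sizeClass c := by
  simp [path]

theorem self_mem_path (c : Fin n) : c ∈ T.path c := mem_path.2 ⟨mem_ancestors_self c, rfl⟩

theorem sizeClass_le_of_mem_ancestors (h : a ∈ T.ancestors b) : T.sizeClass b ≤ T.sizeClass a :=
  Nat.log_mono_right (card_descendants_le h)

theorem sizeClass_le_log (v : Fin n) : T.sizeClass v ≤ Nat.log 2 n :=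
  Nat.log_mono_right ((Finset.card_le_univ _).trans_eq (Fintype.card_fin n))

theorem two_pow_sizeClass_le (v : Fin n) : 2 ^ T.sizeClass v ≤ (T.descendants v).card :=
  Nat.pow_log_le_self 2 (Finset.card_ne_zero_of_mem (mem_descendants.2 (mem_ancestors_self v)))

/-- Two disjoint subtrees of size at least `2 ^ k` do not fit into one of size less than
`2 ^ (k + 1)`. -/
theorem mem_ancestors_total_of_mem_path (ha : a ∈ T.path c) (hb : b ∈ T.path c) :
    a ∈ T.ancestors b ∨ b ∈ T.ancestors a := by
  by_contra! h
  obtain ⟨hca, hac⟩ := mem_path.1 ha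
  obtain ⟨hcb, hbc⟩ := mem_path.1 hb
  have hdisj : Disjoint (T.descendants a) (T.descendants b) :=
    Finset.disjoint_left.2 fun u hua hub =>
      not_or_intro h.1 h.2 (mem_ancestors_total (mem_descendants.1 hua) (mem_descendants.1 hub))
  have hunion : T.descendants a ∪ T.descendants b ⊆ T.descendants c :=
    Finset.union_subset
      (fun u hu => mem_descendants.2 (mem_ancestors_trans hca (mem_descendants.1 hu)))
      fun u hu => mem_descendants.2 (mem_ancestors_trans hcb (mem_descendants.1 hu))
  have hcard := Finset.card_le_card hunion
  rw [Finset.card_union_of_disjoint hdisj] at hcard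
  have hlta : 2 ^ T.sizeClass c ≤ (T.descendants a).card := hac ▸ two_pow_sizeClass_le a
  have hltb : 2 ^ T.sizeClass c ≤ (T.descendants b).card := hbc ▸ two_pow_sizeClass_le b
  have hltc : (T.descendants c).card < 2 ^ (T.sizeClass c + 1) :=
    Nat.lt_pow_succ_log_self one_lt_two _
  lia

theorem exists_mem_heads_mem_path (u : Fin n) : ∃ c ∈ T.heads, u ∈ T.path c := by
  obtain ⟨c, ⟨hcu, hc⟩, hmin⟩ := Set.exists_min_image
    {x ∈ T.ancestors u | T.sizeClass x = T.sizeClass u} T.weight (Set.toFinite _)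
    ⟨u, mem_ancestors_self u, rfl⟩
  refine ⟨c, or_iff_not_imp_left.2 fun hroot hparent => ?_, mem_path.2 ⟨hcu, hc.symm⟩⟩
  exact (hmin _ ⟨parent_mem_ancestors hcu, hparent ▸ hc⟩).not_gt (T.weight_parent_lt c hroot)

theorem sizeClass_lt_of_mem_heads (hb : b ∈ T.heads) (h : a ∈ T.ancestors b) (hne : a ≠ b) :
    T.sizeClass b < T.sizeClass a := by
  have hroot : b ≠ T.root := by
    rintro rfl
    exact hne (by simpa only [ancestors_root, Set.mem_singleton_iff] using h)
  have hparent : T.parent b ∈ T.ancestors b := parent_mem_ancestors (mem_ancestors_self b)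
  calc T.sizeClass b < T.sizeClass (T.parent b) :=
        (sizeClass_le_of_mem_ancestors hparent).lt_of_ne (hb.resolve_left hroot)
    _ ≤ T.sizeClass a := sizeClass_le_of_mem_ancestors ((mem_ancestors_iff.1 h).resolve_left hne)

theorem sizeClass_injOn_heads (v : Fin n) : Set.InjOn T.sizeClass (T.ancestors v ∩ T.heads) := by
  intro a ha b hb hab
  by_contra hne
  rcases mem_ancestors_total ha.1 hb.1 with h | h
  · exact (sizeClass_lt_of_mem_heads hb.2 h hne).ne' hab
  · exact (sizeClass_lt_of_mem_heads ha.2 h (Ne.symm hne)).ne hab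

theorem ncard_heads_le (v : Fin n) : (T.ancestors v ∩ T.heads).ncard ≤ Nat.log 2 n + 1 := by
  rw [← (sizeClass_injOn_heads v).ncard_image, ← Set.ncard_Iic_nat]
  exact Set.ncard_le_ncard (Set.image_subset_iff.2 fun u _ => sizeClass_le_log u)

open Classical in
variable (T) in
theorem sum_card_path_le : ∑ c with c ∈ T.heads, (T.path c).card ≤ n := by
  rw [← Finset.card_biUnion fun a ha b hb hab => Finset.disjoint_left.2 fun u hua hub => hab ?_]
  · exact (Finset.card_le_univ _).trans_eq (Fintype.card_fin n)
  · obtain ⟨hau, hua⟩ := mem_path.1 hua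
    obtain ⟨hbu, hub⟩ := mem_path.1 hub
    exact sizeClass_injOn_heads u ⟨hau, by simpa using ha⟩ ⟨hbu, by simpa using hb⟩
      (hua.symm.trans hub)

theorem isPredecessor_self_of_weight_le (h : T.weight v ≤ d) :
    IsPredecessor (T.ancestors v) T.weight d (some v) :=
  ⟨mem_ancestors_self v, h, fun _ hj _ => weight_le_of_mem_ancestors hj⟩

variable (T) in
/-- The parent of a node, or `none` for the root. -/
def parentOption (v : Fin n) : Option (Fin n) := if v = T.root then none else some (T.parent v)

theorem isPredecessor_parentOption (hcv : c ∈ T.ancestors v) (hc : T.shifted.weight c ≤ d + 1)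
    (hd : d < T.weight c) : IsPredecessor (T.ancestors v) T.weight d (T.parentOption c) := by
  rcases eq_or_ne c T.root with rfl | hroot
  · rw [parentOption, if_pos rfl]
    exact fun i _ => hd.trans_le (weight_le_of_mem_ancestors (root_mem_ancestors i))
  rw [shifted_weight_of_ne hroot] at hc
  rw [parentOption, if_neg hroot]
  refine ⟨parent_mem_ancestors hcv, Nat.le_of_succ_le_succ hc, fun j hj hjd => ?_⟩
  have hjc : j ∈ T.ancestors c := mem_ancestors_of_weight_le hj hcv (hjd.trans hd.le)
  have hne : j ≠ c := by
    rintro rfl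
    exact hjd.not_gt hd
  exact weight_le_of_mem_ancestors ((mem_ancestors_iff.1 hjc).resolve_left hne)

/-- The head of the path of `j` can only be `c`. -/
theorem mem_path_of_isPredecessor_heads {j : Fin n}
    (hc : IsPredecessor (T.ancestors v ∩ T.heads) T.shifted.weight d (some c))
    (hjv : j ∈ T.ancestors v) (hcj : c ∈ T.ancestors j) (hj : T.shifted.weight j ≤ d) :
    j ∈ T.path c := by
  obtain ⟨h, hh, hjh⟩ := exists_mem_heads_mem_path (T := T) j
  obtain ⟨hhj, hclass⟩ := mem_path.1 hjh
  have hhv : h ∈ T.ancestors v := mem_ancestors_trans hhj hjv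
  have hle : T.shifted.weight h ≤ T.shifted.weight c :=
    hc.2.2 h ⟨hhv, hh⟩ ((weight_le_of_mem_ancestors (T := T.shifted) hhj).trans hj)
  have hhc : h ∈ T.ancestors c := mem_ancestors_of_weight_le (T := T.shifted) hhv hc.1.1 hle
  refine mem_path.2 ⟨hcj, (sizeClass_le_of_mem_ancestors hcj).antisymm ?_⟩
  exact (sizeClass_le_of_mem_ancestors hhc).trans_eq hclass.symm

theorem isPredecessor_of_isPredecessor_path
    (hc : IsPredecessor (T.ancestors v ∩ T.heads) T.shifted.weight (d + 1) (some c))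
    (hd : d < T.weight v) (hu : IsPredecessor (T.path c) T.weight d (some u)) :
    IsPredecessor (T.ancestors v) T.weight d (some u) := by
  have hcv : c ∈ T.ancestors v := hc.1.1
  have hcu : T.weight c ≤ T.weight u := weight_le_of_mem_ancestors (mem_path.1 hu.1).1
  obtain ⟨j, hjv, hdj, hj⟩ := exists_lt_weight_shifted_weight_le hd
  have huj : T.weight u < T.weight j := hu.2.1.trans_lt hdj
  have hjc : j ∈ T.path c := mem_path_of_isPredecessor_heads hc hjv
    (mem_ancestors_of_weight_le hcv hjv (hcu.trans huj.le)) hj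
  have hu_mem : u ∈ T.ancestors j := (mem_ancestors_total_of_mem_path hu.1 hjc).resolve_right
    fun h => (weight_le_of_mem_ancestors h).not_gt huj
  refine ⟨mem_ancestors_trans hu_mem hjv, hu.2.1, fun i hiv hid => ?_⟩
  rcases mem_ancestors_total hcv hiv with h | h
  · have hi : T.shifted.weight i ≤ d + 1 := (shifted_weight_le i).trans (hid.trans d.le_succ)
    exact hu.2.2 i (mem_path_of_isPredecessor_heads hc hiv h hi) hid
  · exact (weight_le_of_mem_ancestors h).trans hcu

end WeightedTree

/-! ## Search on the paths -/

section Predecessor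

variable {ι ι' : Type*} {key : ι → ℕ}

theorem IsPredecessor.map {f : ι' → ι} {d : ℕ} {o : Option ι'}
    (h : IsPredecessor Set.univ (fun i => key (f i)) d o) :
    IsPredecessor (Set.range f) key d (o.map f) := by
  cases o with
  | none => exact Set.forall_mem_range.2 fun i => h i trivial
  | some i => exact ⟨⟨i, rfl⟩, h.2.1, Set.forall_mem_range.2 fun j => h.2.2 j trivial⟩

theorem exists_strictMono_range_eq {s : Finset ι} (hs : s.Nonempty) (hkey : Set.InjOn key s) :
    ∃ f : ℕ → ι, StrictMono (fun i : Fin s.card => key (f i)) ∧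
      Set.range (fun i : Fin s.card => f i) = s := by
  classical
  let e := (s.image key).orderEmbOfFin (Finset.card_image_of_injOn hkey)
  choose g hgs hge using fun i => Finset.mem_image.1 ((s.image key).orderEmbOfFin_mem _ i : e i ∈ _)
  refine ⟨fun i => if h : i < s.card then g ⟨i, h⟩ else hs.choose, ?_, ?_⟩ <;>
    simp only [Fin.is_lt, ↓reduceDIte, Fin.eta, hge]
  · exact e.strictMono
  · refine (Set.range_subset_iff.2 hgs).antisymm fun u hu => ?_
    obtain ⟨i, hi⟩ : key u ∈ Set.range e := by
      rw [Finset.range_orderEmbOfFin]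
      exact Finset.mem_image_of_mem key hu
    exact ⟨i, hkey (hgs i) hu ((hge i).trans hi)⟩

end Predecessor

namespace WordRAM

variable {w : ℕ} {s : State w} {e : Expr} {a k t x : ℕ} {p q : Prog} {Q : State w → Prop}

theorem HasValue.congr {s' : State w} (h : s.EqBelow k s') (hk : e.regBound ≤ k)
    (hx : HasValue s e x) : HasValue s' e x := by
  rwa [HasValue, Expr.eval_congr h e hk]

theorem HasValue.queryState_reg_zero {m : Memory w} {d : BitVec w} (hx : x < 2 ^ w) :
    HasValue (queryState m [BitVec.ofNat w x, d]) (.reg 0) x :=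
  ⟨BitVec.ofNat w x, rfl, by simp [Nat.mod_eq_of_lt hx]⟩

/-- The query that answers with the value of `e`. -/
def Expr.answer (e : Expr) (k : ℕ) : Prog := .seq (e.compile k) (.copy 0 k)

theorem Expr.runs_answer (hx : HasValue s e x) (hk : e.regBound ≤ k) :
    Runs (e.answer k) s (e.cost + 1) fun s' => s'.mem = s.mem ∧ (s'.regs 0).toNat = x := by
  obtain ⟨y, hy, rfl⟩ := hx
  exact (e.runs_compile hk hy).seq fun s' h => .copy _ _ ⟨h.1.1, by simp [h.2]⟩

/-- Runs `p` if the content of register `a` is less than the value of `e`, and `q` otherwise. -/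
def branch (a : ℕ) (e : Expr) (k : ℕ) (p q : Prog) : Prog :=
  .seq (e.compile k) (.ite (.lt a k) p q)

theorem runs_branch (hx : HasValue s e x) (hk : e.regBound ≤ k) (ha : a < k)
    (hp : (s.regs a).toNat < x → ∀ s', s.EqBelow k s' → Runs p s' t Q)
    (hq : x ≤ (s.regs a).toNat → ∀ s', s.EqBelow k s' → Runs q s' t Q) :
    Runs (branch a e k p q) s (e.cost + (t + 1)) Q := by
  obtain ⟨y, hy, rfl⟩ := hx
  refine (e.runs_compile hk hy).seq fun s₁ ⟨h, hval⟩ => ?_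
  have htest : (Test.lt a k).holds s₁ ↔ (s.regs a).toNat < y.toNat := by
    rw [Test.holds, h.2 a ha, hval, BitVec.lt_def]
  rcases lt_or_ge (s.regs a).toNat y.toNat with hlt | hle
  · exact .ite_true (htest.2 hlt) (hp hlt s₁ h)
  · exact .ite_false (mt htest.1 hle.not_gt) (hq hle s₁ h)

/-- Sets the registers below `r` to `0`. -/
def clear : ℕ → Prog
  | 0 => .skip
  | r + 1 => .seq (clear r) (.const r 0)

theorem runs_clear (r : ℕ) (s : State w) : Runs (clear r) s r fun s' =>
    s'.mem = s.mem ∧ ∀ i, s'.regs i = if i < r then 0 else s.regs i := by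
  induction r with
  | zero => exact ⟨s, 0, .skip s, le_rfl, rfl, fun i => (if_neg i.not_lt_zero).symm⟩
  | succ r ih =>
    refine ih.seq fun s' ⟨hmem, hregs⟩ => .const _ _ ⟨hmem, fun i => ?_⟩
    simp only [State.setReg, Function.update_apply, hregs]
    grind

/-- Runs the packed program `search` on the block whose length and position are in the registers `R`
and `R + 1`, with the content of register `1` as its argument. The result is an index in the block,
and the answer is looked up in the block of the array `o`. -/
def searchBlock (o R k : ℕ) (search : Prog) : Prog :=
  .seq (.copy (R + 2) 1) <| .seq (clear R) <| .seq (.copy 0 (R + 2)) <|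
    .seq (search.pack R (o + 1) k) <|
      Expr.answer (.load o (.op .add (.reg 0) (.reg (R + 1)))) (R + 2)

theorem runs_searchBlock {ι : Type*} {S : Finset ι} {len : ι → ℕ} {N : ℕ}
    {A : Allocation S len N} {o R i : ℕ} {loc : ι → Memory w} {f : ι → ℕ → ℕ} {c : ι}
    {search : Prog} (hM : s.mem.StoresAt o (A.array w f :: packed R k A loc)) (hc : c ∈ S)
    (hN : N < 2 ^ w) (hsize : (loc c).size ≤ k * len c)
    (hans : Answers search (loc c) [s.regs 1] t i) (hbound : search.bound ≤ R) (hR : 1 < R)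
    (hlen : (s.regs R).toNat = len c) (hbase : (s.regs (R + 1)).toNat = A.base c)
    (hi : i < len c) (hf : f c i < 2 ^ w) :
    Runs (searchBlock o R k search) s (R + 7 + (2 * k + 2) * t) fun s' =>
      s'.mem = s.mem ∧ (s'.regs 0).toNat = f c i := by
  have hfit := (A.base_add_len_le c hc).trans_lt hN
  have hblock : (⟨o + 1, k, len c, A.base c⟩ : Block).Holds R (loc c) s.mem :=
    Block.holds_of_storesAt_packed (hM.right (l₁ := [A.array w f])) hc fun seg =>
      ((loc c).length_array_le seg).trans hsize
  refine .mono_time (.copy_seq ((runs_clear R _).seq fun s₁ ⟨hmem₁, hregs₁⟩ => .copy_seq ?_)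
    (t := R + (1 + ((2 * k + 2) * t + 5)))) (by lia)
  refine (Block.runs_pack_of_answers (B := ⟨o + 1, k, len c, A.base c⟩) hans hbound (by lia) hfit
    ?_ ?_ ?_ ?_ ?_).seq fun s₂ ⟨hmem₂, hout, hbase₂⟩ => ?_
  · rw [State.setReg, hmem₁]
    exact hblock
  · simp [hregs₁]
  · intro r hr hrR
    simp [State.setReg, hregs₁, hr.ne', hrR]
  · simpa [State.setReg, hregs₁, show R ≠ 0 by lia] using hlen
  · simpa [State.setReg, hregs₁] using hbase
  have hmem : s₂.mem = s.mem := hmem₂.trans hmem₁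
  have hsum : HasValue s₂ (.op .add (.reg 0) (.reg (R + 1))) (A.base c + i) := by
    have hsum := (HasValue.reg (s := s₂) 0).add (.reg (R + 1)) (by lia)
    rwa [hout, hbase₂, add_comm i] at hsum
  rw [← hmem] at hM ⊢
  exact Expr.runs_answer (.load_array (hM.array_eq 0 rfl) hsum hc hi hf)
    (by simp [Expr.regBound])

end WordRAM

/-! ## Weighted ancestor search -/

section

open WordRAM WeightedTree

variable {n w U k t o R : ℕ} {T : WeightedTree n} {search : Prog} {head : Expr} {s : State w}
  {c v : Fin n}

/-- Linear space predecessor search within `t` steps for up to `n` numbers below `U`. -/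
def IsPredecessorSearch (n w U k t : ℕ) (search : Prog) : Prop :=
  ∀ (m : ℕ) (key : Fin m → ℕ), 0 < m → m ≤ n → StrictMono key → (∀ i, key i < U) →
    ∃ mem : Memory w, mem.size ≤ k * m ∧ ∀ x : BitVec w, x.toNat < U →
      ∃ ans, IsPredecessor Set.univ key x.toNat ans ∧ Answers search mem [x] t (encodeAnswer ans)

namespace WeightedTree

theorem weight_injOn_path (c : Fin n) : Set.InjOn T.weight (T.path c) := by
  intro a ha b hb hab
  by_contra hne
  rcases mem_ancestors_total_of_mem_path ha hb with h | h
  · exact (weight_lt_of_mem_ancestors h hne).ne hab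
  · exact (weight_lt_of_mem_ancestors h (Ne.symm hne)).ne' hab

theorem exists_memory_path (hw : ∀ v, T.weight v < U)
    (hsearch : IsPredecessorSearch n w U k t search) (c : Fin n) :
    ∃ (node : ℕ → Fin n) (mem : Memory w), mem.size ≤ k * (T.path c).card ∧
      ∀ x : BitVec w, T.weight c ≤ x.toNat → x.toNat < U → ∃ i < (T.path c).card,
        IsPredecessor (T.path c) T.weight x.toNat (some (node i)) ∧ Answers search mem [x] t i := by
  have hne : (T.path c).Nonempty := ⟨c, self_mem_path c⟩
  obtain ⟨node, hmono, hrange⟩ := exists_strictMono_range_eq hne (weight_injOn_path c)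
  obtain ⟨mem, hsize, hans⟩ := hsearch _ _ hne.card_pos
    ((Finset.card_le_univ _).trans_eq (Fintype.card_fin n)) hmono fun i => hw (node i)
  refine ⟨node, mem, hsize, fun x hcx hx => ?_⟩
  obtain ⟨ans, hpred, hrun⟩ := hans x hx
  have hpath := hrange ▸ hpred.map (f := fun i : Fin (T.path c).card => node i)
  cases ans with
  | none => exact absurd (hpath c (self_mem_path c)) hcx.not_gt
  | some i => exact ⟨i, i.2, hpath, hrun⟩

variable (T) in
open Classical in
/-- Predecessor search with the program `search` on all paths of the decomposition: the memory for
the path with head `c` is `loc c`, and its answers are indices in the sequence `node c` of nodes. -/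
structure PathSearch (w U k t : ℕ) (search : Prog) where
  alloc : Allocation {c | c ∈ T.heads} (fun c => (T.path c).card) n
  node : Fin n → ℕ → Fin n
  loc : Fin n → Memory w
  size_loc_le : ∀ c, (loc c).size ≤ k * (T.path c).card
  exists_answers : ∀ (c : Fin n) (x : BitVec w), T.weight c ≤ x.toNat → x.toNat < U →
    ∃ i < (T.path c).card, IsPredecessor (T.path c) T.weight x.toNat (some (node c i)) ∧
      Answers search (loc c) [x] t i

namespace PathSearch

theorem nonempty_of_isPredecessorSearch (hw : ∀ v, T.weight v < U)
    (hsearch : IsPredecessorSearch n w U k t search) :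
    Nonempty (T.PathSearch w U k t search) := by
  choose node loc hsize hans using exists_memory_path hw hsearch
  obtain ⟨alloc⟩ := Allocation.exists_of_sum_le T.sum_card_path_le
  exact ⟨alloc, node, loc, hsize, hans⟩

/-- The data structure below the heads: the weights, the parents, the lengths and positions of the
paths, the nodes of the paths, and the packed memories of the paths. -/
noncomputable def memory (P : T.PathSearch w U k t search) (R : ℕ) : Memory w :=
  table w T.weight :: table w (fun v => encodeAnswer (T.parentOption v)) ::
    table w (fun c => (T.path c).card) :: table w (fun c => P.alloc.base c) ::
      P.alloc.array w (fun c i => P.node c i) :: packed R k P.alloc P.loc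

theorem size_memory (P : T.PathSearch w U k t search) (R : ℕ) :
    (P.memory R).size = (R * k + 5) * n := by
  have := size_packed R k P.alloc P.loc
  simp only [memory, Memory.size, Allocation.array, List.map_cons, List.sum_cons,
    length_table] at this ⊢
  lia

/-- The search on the path whose head is the value of `head`. -/
def pathQuery (o R k : ℕ) (head : Expr) (search : Prog) : Prog :=
  .seq (Expr.compile (.load (o + 2) head) R) <|
    .seq (Expr.compile (.load (o + 3) head) (R + 1)) <| searchBlock (o + 4) R k search

theorem runs_pathQuery (P : T.PathSearch w U k t search) (hM : s.mem.StoresAt o (P.memory R))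
    (hc : c ∈ T.heads) (hhead : HasValue s head c) (hhR : head.regBound ≤ R) (hn : n < 2 ^ w)
    (hbound : search.bound ≤ R) (hR : 1 < R) {i : ℕ} (hi : i < (T.path c).card)
    (hans : Answers search (P.loc c) [s.regs 1] t i) :
    Runs (pathQuery o R k head search) s (2 * head.cost + R + 9 + (2 * k + 2) * t) fun s' =>
      s'.mem = s.mem ∧ (s'.regs 0).toNat = P.node c i := by
  classical
  have hmem : c ∈ ({c | c ∈ T.heads} : Finset (Fin n)) := by simpa using hc
  have hfit := P.alloc.base_add_len_le c hmem
  obtain ⟨x, hx, hxlen⟩ := hhead.load_table (hM.array_eq 2 rfl) c.2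
    (lt_of_le_of_lt (Finset.card_le_univ _) (by simpa using hn))
  refine .mono_time ((Expr.runs_compile (.load (o + 2) head) hhR hx).seq fun s₁ ⟨h₁, hlen₁⟩ => ?_)
    (t₁ := head.cost + 1 + (head.cost + 1 + (R + 7 + (2 * k + 2) * t))) (by lia)
  rw [← h₁.1] at hM
  obtain ⟨y, hy, hybase⟩ :=
    (hhead.congr h₁ hhR).load_table (hM.array_eq 3 rfl) c.2
      ((Nat.le_of_add_right_le hfit).trans_lt hn)
  refine (Expr.runs_compile (.load (o + 3) head) (hhR.trans R.le_succ) hy).seq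
    fun s₂ ⟨h₂, hbase₂⟩ => ?_
  rw [← h₂.1] at hM
  have harg : s₂.regs 1 = s.regs 1 := (h₂.2 1 (by lia)).trans (h₁.2 1 hR)
  rw [← h₁.1, ← h₂.1]
  exact runs_searchBlock (hM.right (l₁ := List.take 4 (P.memory R))) hmem hn (P.size_loc_le c)
    (harg ▸ hans) hbound hR (by rw [h₂.2 R R.lt_succ_self, hlen₁, hxlen]) (by rw [hbase₂, hybase])
    hi ((P.node c i).2.trans hn)

/-- Weighted ancestor search, given that the value of `head` is the lowest head above the query node
whose parent is light enough. The answer is the query node, the parent of this head, or a node on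
the path of this head. -/
def query (o R k : ℕ) (head : Expr) (search : Prog) : Prog :=
  branch 1 (.load o (.reg 0)) R
    (branch 1 (.load o head) R ((Expr.load (o + 1) head).answer R) (pathQuery o R k head search))
    .skip

theorem runs_query_of_lt (P : T.PathSearch w U k t search) (hM : s.mem.StoresAt o (P.memory R))
    (hwU : ∀ v, T.weight v < U) (hU : U ≤ 2 ^ w) (hd : (s.regs 1).toNat < T.weight v)
    (hc : IsPredecessor (T.ancestors v ∩ T.heads) T.shifted.weight ((s.regs 1).toNat + 1) (some c))
    (hhead : HasValue s head c) (hhR : head.regBound ≤ R) (hn : n < 2 ^ w)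
    (hbound : search.bound ≤ R) (hR : 1 < R) :
    Runs (branch 1 (.load o head) R ((Expr.load (o + 1) head).answer R)
      (pathQuery o R k head search)) s (3 * head.cost + R + 11 + (2 * k + 2) * t) fun s' =>
        s'.mem = s.mem ∧ ∃ ans, IsPredecessor (T.ancestors v) T.weight (s.regs 1).toNat ans ∧
          (s'.regs 0).toNat = encodeAnswer ans := by
  have hweight := hhead.load_table (hM.array_eq 0 rfl) c.2 ((hwU c).trans_le hU)
  refine .mono_time (runs_branch hweight hhR hR (fun hdc s₁ h => ?_) fun hdc s₁ h => ?_)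
    (t₁ := head.cost + 1 + (2 * head.cost + R + 9 + (2 * k + 2) * t + 1)) (by lia) <;>
    rw [← h.1] at hM ⊢
  · have hparent := (hhead.congr h hhR).load_table (hM.array_eq 1 rfl) c.2
      ((encodeAnswer_le _).trans_lt hn)
    exact (Expr.runs_answer hparent hhR).mono (by simp only [Expr.cost]; lia) fun s₂ h₂ =>
      ⟨h₂.1, _, isPredecessor_parentOption hc.1.1 hc.2.1 hdc, h₂.2⟩
  · obtain ⟨i, hi, hpred, hans⟩ := P.exists_answers c _ hdc (hd.trans (hwU v))
    exact (P.runs_pathQuery hM hc.1.2 (hhead.congr h hhR) hhR hn hbound hR hi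
      (h.2 1 hR ▸ hans)).mono le_rfl fun s₂ h₂ =>
        ⟨h₂.1, _, isPredecessor_of_isPredecessor_path hc hd hpred, h₂.2⟩

theorem runs_query (P : T.PathSearch w U k t search) (hM : s.mem.StoresAt o (P.memory R))
    (hwU : ∀ v, T.weight v < U) (hU : U ≤ 2 ^ w) (hv : (s.regs 0).toNat = v)
    (hhead : (s.regs 1).toNat < T.weight v → ∃ c : Fin n, HasValue s head c ∧
      IsPredecessor (T.ancestors v ∩ T.heads) T.shifted.weight ((s.regs 1).toNat + 1) (some c))
    (hhR : head.regBound ≤ R) (hn : n < 2 ^ w) (hbound : search.bound ≤ R) (hR : 1 < R) :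
    Runs (query o R k head search) s (3 * head.cost + R + 14 + (2 * k + 2) * t) fun s' =>
      s'.mem = s.mem ∧ ∃ ans, IsPredecessor (T.ancestors v) T.weight (s.regs 1).toNat ans ∧
        (s'.regs 0).toNat = encodeAnswer ans := by
  have hweight : HasValue s (.load o (.reg 0)) (T.weight v) :=
    (hv ▸ HasValue.reg 0).load_table (hM.array_eq 0 rfl) v.2 ((hwU v).trans_le hU)
  refine .mono_time (runs_branch hweight (by simp only [Expr.regBound]; lia) hR
    (fun hd s₁ h => ?_) fun hd s₁ h => ?_)
    (t₁ := 2 + (3 * head.cost + R + 11 + (2 * k + 2) * t + 1)) (by lia)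
  · obtain ⟨c, hc, hpred⟩ := hhead hd
    rw [← h.1] at hM ⊢
    rw [← h.2 1 hR] at hd hpred ⊢
    exact P.runs_query_of_lt hM hwU hU hd hpred (hc.congr h hhR) hhR hn hbound hR
  · exact ⟨s₁, 0, .skip s₁, Nat.zero_le _, h.1, some v, isPredecessor_self_of_weight_le hd,
      by rw [h.2 0 (by lia), hv, encodeAnswer]⟩

end PathSearch

theorem exists_head_of_isSearchStructure {m : Memory w} {query : ℕ → Expr → Expr → Expr}
    (hm : T.shifted.IsSearchStructure T.heads m query) (hM : s.mem.StoresAt 0 m)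
    (hw : ∀ v, T.weight v < 2 ^ w) (hv : (s.regs 0).toNat = v)
    (hd : (s.regs 1).toNat < T.weight v) :
    ∃ c : Fin n, HasValue s (query 0 (.reg 0) (.op .add (.reg 1) (.const 1))) c ∧
      IsPredecessor (T.ancestors v ∩ T.heads) T.shifted.weight ((s.regs 1).toNat + 1) (some c) := by
  have hlt : (s.regs 1).toNat + 1 < 2 ^ w := by have := hw v; lia
  obtain ⟨ans, hans, hval⟩ := hm s 0 hM v _ (.reg 0) _ (hv ▸ HasValue.reg 0)
    ((HasValue.reg 1).add (.const (by lia)) hlt)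
  cases ans with
  | none =>
    have hroot := hans T.root ⟨root_mem_ancestors v, .inl rfl⟩
    exact absurd (hroot.trans_eq (if_pos rfl)) (Nat.not_lt_zero _)
  | some c => exact ⟨c, hval, hans⟩

theorem exists_markedAncestorSearch (κ C : ℕ) : ∃ (c : ℕ) (query : Prog),
    ∀ (n w : ℕ) (T : WeightedTree n) (marked : Set (Fin n)),
      LogWordSize κ n w → (∀ v, T.weight v < 2 ^ w) →
      (∀ v, T.IsLeaf v → (T.ancestors v ∩ marked).ncard ≤ C * (Nat.log 2 n + 1)) →
      ∃ mem : Memory w, mem.size ≤ c * n ∧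
        ∀ (v : Fin n) (d : BitVec w),
          ∃ ans : Option (Fin n), IsPredecessor (T.ancestors v ∩ marked) T.weight d.toNat ans ∧
            Answers query mem [BitVec.ofNat w v, d] c (encodeAnswer ans) := by
  obtain ⟨_, c, query, hquery⟩ := exists_isSearchStructure κ C
  set e := query 0 (.reg 0) (.reg 1)
  refine ⟨c + (e.cost + 1), e.answer e.regBound, fun n w T marked hlog hw hleaf => ?_⟩
  have hcard (v : Fin n) : (T.ancestors v ∩ marked).ncard ≤ C * (Nat.log 2 n + 1) := by
    obtain ⟨l, hl, hvl⟩ := exists_isLeaf T v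
    have hsub : T.ancestors v ∩ marked ⊆ T.ancestors l ∩ marked :=
      fun u hu => ⟨mem_ancestors_trans hu.1 hvl, hu.2⟩
    exact (Set.ncard_le_ncard hsub).trans (hleaf l hl)
  obtain ⟨mem, -, hsize, hmem⟩ := hquery n w T marked hlog hw hcard
  refine ⟨mem, hsize.trans (Nat.mul_le_mul_right n (Nat.le_add_right _ _)), fun v d => ?_⟩
  obtain ⟨ans, hans, hval⟩ := hmem (queryState mem [BitVec.ofNat w v, d]) 0 (.refl mem) v d.toNat
    _ _ (HasValue.queryState_reg_zero (v.2.trans hlog.1)) (.reg 1)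
  obtain ⟨s, t, hrun, ht, hs, hout⟩ := Expr.runs_answer hval le_rfl
  exact ⟨ans, hans, s, t, hrun, ht.trans (Nat.le_add_left _ _), hout, hs⟩

theorem linearSpaceWeightedAncestor_of_linearSpacePredecessor {κ : ℕ} {pred : ℕ → ℕ → ℕ}
    (hpos : ∀ m U, 1 ≤ pred m U) (hmono : ∀ U, Monotone fun m => pred m U)
    (h : LinearSpacePredecessor κ pred) : LinearSpaceWeightedAncestor κ pred := by
  obtain ⟨k, search, hsearch⟩ := h
  obtain ⟨A, c, query, hquery⟩ := exists_isSearchStructure κ 1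
  set head := query 0 (.reg 0) (.op .add (.reg 1) (.const 1))
  set R := max search.bound (max 2 head.regBound)
  refine ⟨c + (R * k + 5) + (3 * head.cost + R + 14) + (2 * k + 2) * k,
    PathSearch.query A R k head search, fun n w U T hlog hU hwU => ?_⟩
  have hw (v : Fin n) : T.weight v < 2 ^ w := (hwU v).trans_le hU
  have hpaths : IsPredecessorSearch n w U k (k * pred n U) search := fun m key hm hmn hkey hlt => by
    obtain ⟨mem, hsize, hans⟩ := hsearch n w U m key hlog hU hm hmn hkey hlt
    refine ⟨mem, hsize, fun x hx => ?_⟩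
    obtain ⟨ans, hpred, s, t, hrun, ht, hs⟩ := hans x hx
    exact ⟨ans, hpred, s, t, hrun, ht.trans (Nat.mul_le_mul_left k (hmono U hmn)), hs⟩
  obtain ⟨P⟩ := PathSearch.nonempty_of_isPredecessorSearch hwU hpaths
  obtain ⟨m, hlen, hsize, hm⟩ := hquery n w T.shifted T.heads hlog
    (fun v => (shifted_weight_le v).trans_lt (hw v)) fun v =>
      (ncard_heads_le (T := T) v).trans_eq (one_mul _).symm
  refine ⟨m ++ P.memory R, ?_, fun v d => ?_⟩
  · rw [Memory.size_append, P.size_memory]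
    exact (Nat.add_le_add_right hsize _).trans (by lia)
  have hM := Memory.StoresAt.refl (m ++ P.memory R)
  have hMP : (m ++ P.memory R).StoresAt A (P.memory R) := by simpa [hlen] using hM.right
  set s := queryState (m ++ P.memory R) [BitVec.ofNat w v, d]
  have hv : (s.regs 0).toNat = v := Nat.mod_eq_of_lt (v.2.trans hlog.1)
  obtain ⟨s', t, hrun, ht, hmem, ans, hans, hout⟩ := P.runs_query (s := s) (head := head) hMP hwU hU
    hv (exists_head_of_isSearchStructure hm hM.left hw hv) (by lia) hlog.1 (by lia) (by lia)
  refine ⟨ans, hans, s', t, hrun, ht.trans ?_, hout, hmem⟩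
  calc 3 * head.cost + R + 14 + (2 * k + 2) * (k * pred n U)
      ≤ (3 * head.cost + R + 14) * pred n U + (2 * k + 2) * k * pred n U := by
        rw [← mul_assoc]
        exact Nat.add_le_add_right (Nat.le_mul_of_pos_right _ (hpos n U)) _
    _ ≤ _ := by
        rw [← add_mul]
        exact Nat.mul_le_mul_right _ (by lia)

end WeightedTree

end

open WordRAM in
theorem mainTheorem2 (κ : ℕ) :
    (∀ C : ℕ, ∃ (c : ℕ) (query : Prog), ∀ (n w : ℕ) (T : WeightedTree n) (marked : Set (Fin n)),
      LogWordSize κ n w → (∀ v, T.weight v < 2 ^ w) →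
      (∀ v, T.IsLeaf v → (T.ancestors v ∩ marked).ncard ≤ C * (Nat.log 2 n + 1)) →
      ∃ mem : Memory w, mem.size ≤ c * n ∧
        ∀ (v : Fin n) (d : BitVec w),
          ∃ ans : Option (Fin n), IsPredecessor (T.ancestors v ∩ marked) T.weight d.toNat ans ∧
            Answers query mem [BitVec.ofNat w v, d] c (encodeAnswer ans)) ∧
    (∀ pred : ℕ → ℕ → ℕ, (∀ m U, 1 ≤ pred m U) → (∀ U, Monotone fun m => pred m U) →
      LinearSpacePredecessor κ pred → LinearSpaceWeightedAncestor κ pred) :=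
  ⟨WeightedTree.exists_markedAncestorSearch κ, fun _ hpos hmono h =>
    WeightedTree.linearSpaceWeightedAncestor_of_linearSpacePredecessor hpos hmono h⟩
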